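/- All manifolds are smooth, finite-dimensional, Hausdorff and second countable. Let $G$ be a Lie group with Lie algebra $\mathfrak g$ acting smoothly, freely and properly from the right on a manifold $Q$, let $\mu\in\mathfrak g^*$, and let $G_\mu\subset G$ be the isotropy subgroup of $\mu$ under the coadjoint action. Let $\omega$ be a principal connection on $\pi:Q\to Q/G$, i.e. a smooth $\mathfrak g$-valued one-form on $Q$ with $\omega(\xi_Q)=\xi$ for all $\xi\in\mathfrak g$ and $R_g^*\omega=\mathrm{Ad}_{g^{-1}}\circ\omega$ for all $g\in G$, where $R_g(q)=qg$, $\sigma_q(g)=qg$ and $\xi_Q(q)=\sigma_q(\xi)=T_e\sigma_q(\xi)$. Let $\pi_\mu:Q\to Q/G_\mu$ be the projection, let $\tilde{\mathfrak g}=(Q\times\mathfrak g)/G$ be the adjoint bundle, the quotient by the action $(q,\xi)g=(qg,\mathrm{Ad}_{g^{-1}}\xi)$, with classes $[q,\xi]_G$, and let $TQ/G_\mu$ be the quotient by the tangent-lifted action. Then $Q/G$, $Q/G_\mu$, $\tilde{\mathfrak g}$ and $TQ/G_\mu$ are quotient manifolds (with the quotient topology and the smooth structure for which the projection is a submersion),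 the fibred product $$T(Q/G)\times_{Q/G} Q/G_\mu\times_{Q/G}\tilde{\mathfrak g}$$ is an embedded submanifold of $T(Q/G)\times Q/G_\mu\times\tilde{\mathfrak g}$, and the map $$\phi_\omega: TQ/G_\mu\to T(Q/G)\times_{Q/G} Q/G_\mu\times_{Q/G}\tilde{\mathfrak g},\qquad \phi_\omega([v_q]_{G_\mu})=\big(T\pi(v_q),\,\pi_\mu(q),\,[q,\omega(v_q)]_G\big)$$ is a well-defined diffeomorphism. Every $v_x\in T_x(Q/G)$ has a unique horizontal lift $(v_x)^h_q\in\ker\omega_q\subset T_qQ$ with $T\pi((v_x)^h_q)=v_x$ at each $q\in\pi^{-1}(x)$, and the inverse of $\phi_\omega$ is $$\psi_\omega(v_x,y,\tilde\xi)=\big[(v_x)^h_q+\sigma_q(\xi)\big]_{G_\mu}\quad\text{for any } q\in Q,\ \xi\in\mathfrak g \text{ with } y=\pi_\mu(q),\ \tilde\xi=[q,\xi]_G .$$ -/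

import Mathlib

open scoped Manifold ContDiff

noncomputable section

namespace RouthReduction

/-! Throughout, `Q` is a manifold modelled on `E`, and `G` is a Lie group modelled on `𝔤`.
In Mathlib the tangent space of `G` at the identity is, by definition, the model space `𝔤`,
so `𝔤` is the (vector space underlying the) Lie algebra of `G`. -/

section LieGroup

variable {𝔤 : Type*} [NormedAddCommGroup 𝔤] [NormedSpace ℝ 𝔤]
  {G : Type*} [TopologicalSpace G] [ChartedSpace 𝔤 G] [Group G]

/-- The adjoint action `Ad_g`: the derivative at the identity of `h ↦ g h g⁻¹`. -/
def Ad (g : G) : 𝔤 →L[ℝ] 𝔤 :=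
  mfderiv 𝓘(ℝ, 𝔤) 𝓘(ℝ, 𝔤) (fun h : G => g * h * g⁻¹) (1 : G)

lemma contMDiff_conj [LieGroup 𝓘(ℝ, 𝔤) ∞ G] (g : G) :
    ContMDiff 𝓘(ℝ, 𝔤) 𝓘(ℝ, 𝔤) ∞ (fun h : G => g * h * g⁻¹) :=
  (contMDiff_const.mul contMDiff_id).mul contMDiff_const

lemma Ad_one : Ad (1 : G) = ContinuousLinearMap.id ℝ 𝔤 := by
  have h : (fun h : G => (1 : G) * h * (1 : G)⁻¹) = id := by ext; simp
  unfold Ad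
  rw [h]
  exact mfderiv_id

lemma Ad_mul [LieGroup 𝓘(ℝ, 𝔤) ∞ G] (g g' : G) :
    (Ad (g * g') : 𝔤 →L[ℝ] 𝔤) = (Ad g).comp (Ad g') := by
  have h : (fun h : G => g * g' * h * (g * g')⁻¹)
      = (fun h : G => g * h * g⁻¹) ∘ (fun h : G => g' * h * g'⁻¹) := by
    ext; simp [mul_assoc]
  have h1 : HasMFDerivAt 𝓘(ℝ, 𝔤) 𝓘(ℝ, 𝔤) (fun h : G => g' * h * g'⁻¹) (1 : G)
      (Ad (𝔤 := 𝔤) g') :=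
    ((contMDiff_conj g').mdifferentiableAt (by simp)).hasMFDerivAt
  have h2 : HasMFDerivAt 𝓘(ℝ, 𝔤) 𝓘(ℝ, 𝔤) (fun h : G => g * h * g⁻¹) (g' * 1 * g'⁻¹)
      (Ad (𝔤 := 𝔤) g) := by
    have e : g' * 1 * g'⁻¹ = 1 := by simp
    rw [e]
    exact ((contMDiff_conj g).mdifferentiableAt (by simp)).hasMFDerivAt
  have h3 := h2.comp (1 : G) h1
  rw [← h] at h3
  exact h3.mfderiv

/-- The coadjoint action of `g` on `μ ∈ 𝔤*`: `⟨g · μ, ξ⟩ = ⟨μ, Ad_{g⁻¹} ξ⟩`. -/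
def coadjoint (g : G) (μ : 𝔤 →L[ℝ] ℝ) : 𝔤 →L[ℝ] ℝ := μ.comp (Ad g⁻¹)

/-- The isotropy subgroup `G_μ` of `μ ∈ 𝔤*` under the coadjoint action. -/
def isotropy (G : Type*) [TopologicalSpace G] [ChartedSpace 𝔤 G] [Group G]
    [LieGroup 𝓘(ℝ, 𝔤) ∞ G] (μ : 𝔤 →L[ℝ] ℝ) : Subgroup G where
  carrier := {g | coadjoint g μ = μ}
  one_mem' := by
    simp [coadjoint, Ad_one]
  mul_mem' := by
    intro a b ha hb
    simp only [Set.mem_ofPred_eq, coadjoint] at *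
    rw [mul_inv_rev, Ad_mul, ← ContinuousLinearMap.comp_assoc, hb, ha]
  inv_mem' := by
    intro a ha
    simp only [Set.mem_ofPred_eq, coadjoint] at *
    conv_lhs => rw [← ha]
    rw [ContinuousLinearMap.comp_assoc, ← Ad_mul]
    simp [Ad_one]

end LieGroup

section Action

variable {E : Type*} [NormedAddCommGroup E] [NormedSpace ℝ E]
  {Q : Type*} [TopologicalSpace Q] [ChartedSpace E Q]
  {𝔤 : Type*} [NormedAddCommGroup 𝔤] [NormedSpace ℝ 𝔤]
  {G : Type*} [TopologicalSpace G] [ChartedSpace 𝔤 G] [Group G]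
  [MulAction Gᵐᵒᵖ Q]

/-- The right translation `R_g : Q → Q`, `q ↦ q g`. A right action of `G` is an action of `Gᵐᵒᵖ`. -/
def R (Q : Type*) [MulAction Gᵐᵒᵖ Q] (g : G) (q : Q) : Q := MulOpposite.op g • q

/-- The right action `(q, g) ↦ q g` of `G` on `Q` is smooth. -/
def IsSmoothRightAction (E Q 𝔤 G : Type*) [NormedAddCommGroup E] [NormedSpace ℝ E]
    [TopologicalSpace Q] [ChartedSpace E Q] [NormedAddCommGroup 𝔤] [NormedSpace ℝ 𝔤]
    [TopologicalSpace G] [ChartedSpace 𝔤 G] [Group G] [MulAction Gᵐᵒᵖ Q] : Prop :=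
  ContMDiff (𝓘(ℝ, E).prod 𝓘(ℝ, 𝔤)) 𝓘(ℝ, E) ∞ (fun p : Q × G => R Q p.2 p.1)

lemma IsSmoothRightAction.contMDiff_R (hact : IsSmoothRightAction E Q 𝔤 G) (g : G) :
    ContMDiff 𝓘(ℝ, E) 𝓘(ℝ, E) ∞ (R Q g) :=
  ContMDiff.comp (g := fun p : Q × G => R Q p.2 p.1) (f := fun q : Q => (q, g)) hact
    (contMDiff_id.prodMk contMDiff_const)

/-- The infinitesimal action `σ_q(ξ) = ξ_Q(q)`: the derivative at the identity of `g ↦ q g`,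
applied to `ξ`. -/
def infinitesimalAction (E : Type*) {Q 𝔤 : Type*} [NormedAddCommGroup E] [NormedSpace ℝ E]
    [TopologicalSpace Q] [ChartedSpace E Q] [NormedAddCommGroup 𝔤] [NormedSpace ℝ 𝔤]
    (G : Type*) [TopologicalSpace G] [ChartedSpace 𝔤 G] [Group G] [MulAction Gᵐᵒᵖ Q]
    (q : Q) (ξ : 𝔤) : TangentSpace 𝓘(ℝ, E) q :=
  (mfderiv 𝓘(ℝ, 𝔤) 𝓘(ℝ, E) (fun g : G => R Q g q) (1 : G) : 𝔤 →L[ℝ] E) ξ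

/-- A principal connection: a smooth `𝔤`-valued one-form `ω` on `Q` with `ω(ξ_Q) = ξ` and
`R_g^* ω = Ad_{g⁻¹} ∘ ω`. -/
structure PrincipalConnection (E Q 𝔤 G : Type*) [NormedAddCommGroup E] [NormedSpace ℝ E]
    [TopologicalSpace Q] [ChartedSpace E Q] [IsManifold 𝓘(ℝ, E) ∞ Q]
    [NormedAddCommGroup 𝔤] [NormedSpace ℝ 𝔤]
    [TopologicalSpace G] [ChartedSpace 𝔤 G] [Group G] [MulAction Gᵐᵒᵖ Q] where
  /-- the value of the one-form at a point -/
  form : ∀ q : Q, TangentSpace 𝓘(ℝ, E) q →L[ℝ] 𝔤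
  smooth : ContMDiff 𝓘(ℝ, E).tangent 𝓘(ℝ, 𝔤) ∞
    (fun v : TangentBundle 𝓘(ℝ, E) Q => form v.proj v.snd)
  vertical : ∀ (q : Q) (ξ : 𝔤), form q (infinitesimalAction E G q ξ) = ξ
  equivariant : ∀ (g : G) (q : Q) (v : TangentSpace 𝓘(ℝ, E) q),
    form (R Q g q) (mfderiv 𝓘(ℝ, E) 𝓘(ℝ, E) (R Q g) q v) = Ad g⁻¹ (form q v)

/-- The orbit space `Q/G`, with the quotient topology. -/
abbrev OrbitSpace (Q G : Type*) [Group G] [MulAction Gᵐᵒᵖ Q] : Type _ :=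
  MulAction.orbitRel.Quotient Gᵐᵒᵖ Q

/-- The orbit space `Q/K` for a subgroup `K` of `G`, with the quotient topology. -/
abbrev SubOrbitSpace (Q : Type*) {G : Type*} [Group G] [MulAction Gᵐᵒᵖ Q] (K : Subgroup G) :
    Type _ :=
  MulAction.orbitRel.Quotient K.op Q

/-- The projection `π : Q → Q/G`. -/
def proj (Q G : Type*) [Group G] [MulAction Gᵐᵒᵖ Q] (q : Q) : OrbitSpace Q G :=
  Quotient.mk (MulAction.orbitRel Gᵐᵒᵖ Q) q

/-- The projection `π_K : Q → Q/K`. -/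
def subProj (Q : Type*) {G : Type*} [Group G] [MulAction Gᵐᵒᵖ Q] (K : Subgroup G) (q : Q) :
    SubOrbitSpace Q K :=
  Quotient.mk (MulAction.orbitRel K.op Q) q

/-- The projection `Q/K → Q/G`. -/
def subOrbitToOrbit (Q : Type*) {G : Type*} [Group G] [MulAction Gᵐᵒᵖ Q] (K : Subgroup G) :
    SubOrbitSpace Q K → OrbitSpace Q G :=
  Quotient.lift (proj Q G) (by
    rintro a b ⟨k, rfl⟩
    exact Quotient.sound ⟨(k : Gᵐᵒᵖ), rfl⟩)

/-- The orbit relation on `TQ` of the tangent lift `v_q ↦ TR_g(v_q)` of the action,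
restricted to `g` in a subgroup `K`. -/
def tangentOrbitRel (hact : IsSmoothRightAction E Q 𝔤 G) (K : Subgroup G) :
    Setoid (TangentBundle 𝓘(ℝ, E) Q) where
  r v w := ∃ g ∈ K, tangentMap 𝓘(ℝ, E) 𝓘(ℝ, E) (R Q g) v = w
  iseqv := by
    have hmul : ∀ (g h : G) (v : TangentBundle 𝓘(ℝ, E) Q),
        tangentMap 𝓘(ℝ, E) 𝓘(ℝ, E) (R Q h) (tangentMap 𝓘(ℝ, E) 𝓘(ℝ, E) (R Q g) v)
          = tangentMap 𝓘(ℝ, E) 𝓘(ℝ, E) (R Q (g * h)) v := by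
      intro g h v
      have e : R Q (g * h) = R Q h ∘ R Q g := by
        ext q; simp [R, mul_smul]
      rw [e, tangentMap_comp ((hact.contMDiff_R h).mdifferentiable (by simp))
        ((hact.contMDiff_R g).mdifferentiable (by simp))]
      rfl
    have hone : ∀ v : TangentBundle 𝓘(ℝ, E) Q,
        tangentMap 𝓘(ℝ, E) 𝓘(ℝ, E) (R Q (1 : G)) v = v := by
      intro v
      have e : R Q (1 : G) = id := by ext q; simp [R]
      rw [e, tangentMap_id]; rfl
    refine ⟨fun v => ⟨1, K.one_mem, hone v⟩, ?_, ?_⟩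
    · rintro v w ⟨g, hg, rfl⟩
      exact ⟨g⁻¹, K.inv_mem hg, by rw [hmul, mul_inv_cancel, hone]⟩
    · rintro u v w ⟨g, hg, rfl⟩ ⟨h, hh, rfl⟩
      exact ⟨g * h, K.mul_mem hg hh, (hmul g h u).symm⟩

/-- The quotient `TQ/K` by the lifted action of `K`, with the quotient topology. -/
abbrev TangentQuotient (hact : IsSmoothRightAction E Q 𝔤 G) (K : Subgroup G) : Type _ :=
  Quotient (tangentOrbitRel hact K)

/-- The projection `TQ → TQ/K`, `v ↦ [v]_K`. -/
def tangentProj (hact : IsSmoothRightAction E Q 𝔤 G) (K : Subgroup G)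
    (v : TangentBundle 𝓘(ℝ, E) Q) : TangentQuotient hact K :=
  Quotient.mk (tangentOrbitRel hact K) v

/-- The orbit relation on `Q × 𝔤` of the right action `(q, ξ) g = (q g, Ad_{g⁻¹} ξ)`. -/
def adjointOrbitRel (Q 𝔤 G : Type*) [NormedAddCommGroup 𝔤] [NormedSpace ℝ 𝔤]
    [TopologicalSpace G] [ChartedSpace 𝔤 G] [Group G] [LieGroup 𝓘(ℝ, 𝔤) ∞ G]
    [MulAction Gᵐᵒᵖ Q] : Setoid (Q × 𝔤) where
  r a b := ∃ g : G, (R Q g a.1, Ad g⁻¹ a.2) = b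
  iseqv := by
    have hmul : ∀ (g h : G) (a : Q × 𝔤),
        (R Q h (R Q g a.1), Ad h⁻¹ (Ad g⁻¹ a.2)) = (R Q (g * h) a.1, Ad (g * h)⁻¹ a.2) := by
      intro g h a
      rw [mul_inv_rev, Ad_mul]
      simp [R, mul_smul]
    have hone : ∀ a : Q × 𝔤, (R Q (1 : G) a.1, Ad (1 : G)⁻¹ a.2) = a := by
      intro a
      simp [R, Ad_one]
    refine ⟨fun a => ⟨1, hone a⟩, ?_, ?_⟩
    · rintro a _ ⟨g, rfl⟩
      exact ⟨g⁻¹, by rw [hmul, mul_inv_cancel, hone]⟩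
    · rintro a _ _ ⟨g, rfl⟩ ⟨h, rfl⟩
      exact ⟨g * h, (hmul g h a).symm⟩

/-- The adjoint bundle `(Q × 𝔤)/G`, with the quotient topology. -/
abbrev AdjointBundle (Q 𝔤 G : Type*) [NormedAddCommGroup 𝔤] [NormedSpace ℝ 𝔤]
    [TopologicalSpace G] [ChartedSpace 𝔤 G] [Group G] [LieGroup 𝓘(ℝ, 𝔤) ∞ G]
    [MulAction Gᵐᵒᵖ Q] : Type _ :=
  Quotient (adjointOrbitRel Q 𝔤 G)

/-- The class map `Q × 𝔤 → (Q × 𝔤)/G`, `(q, ξ) ↦ [q, ξ]_G`. -/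
def adjointMk (Q 𝔤 G : Type*) [NormedAddCommGroup 𝔤] [NormedSpace ℝ 𝔤]
    [TopologicalSpace G] [ChartedSpace 𝔤 G] [Group G] [LieGroup 𝓘(ℝ, 𝔤) ∞ G]
    [MulAction Gᵐᵒᵖ Q] (a : Q × 𝔤) : AdjointBundle Q 𝔤 G :=
  Quotient.mk (adjointOrbitRel Q 𝔤 G) a

/-- The bundle projection `(Q × 𝔤)/G → Q/G`, `[q, ξ]_G ↦ π(q)`. -/
def adjointToOrbit (Q 𝔤 G : Type*) [NormedAddCommGroup 𝔤] [NormedSpace ℝ 𝔤]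
    [TopologicalSpace G] [ChartedSpace 𝔤 G] [Group G] [LieGroup 𝓘(ℝ, 𝔤) ∞ G]
    [MulAction Gᵐᵒᵖ Q] : AdjointBundle Q 𝔤 G → OrbitSpace Q G :=
  Quotient.lift (fun a => proj Q G a.1) (by
    rintro a _ ⟨g, rfl⟩
    exact (Quotient.sound (⟨MulOpposite.op g, rfl⟩ :
      MulAction.orbitRel Gᵐᵒᵖ Q (R Q g a.1) a.1)).symm)

/-- The fibred product `T(Q/G) × Q/K × (Q × 𝔤)/G` over `Q/G`, as a subset of the product. -/
def fibredProduct (B : Type*) [NormedAddCommGroup B] [NormedSpace ℝ B] (Q 𝔤 : Type*) {G : Type*}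
    [TopologicalSpace Q] [NormedAddCommGroup 𝔤] [NormedSpace ℝ 𝔤]
    [TopologicalSpace G] [ChartedSpace 𝔤 G] [Group G] [LieGroup 𝓘(ℝ, 𝔤) ∞ G]
    [MulAction Gᵐᵒᵖ Q] [ChartedSpace B (OrbitSpace Q G)] (K : Subgroup G) :
    Set (TangentBundle 𝓘(ℝ, B) (OrbitSpace Q G) × SubOrbitSpace Q K × AdjointBundle Q 𝔤 G) :=
  {p | subOrbitToOrbit Q K p.2.1 = p.1.proj ∧ adjointToOrbit Q 𝔤 G p.2.2 = p.1.proj}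

end Action

section Quotient

variable {E H F K M X : Type*} [NormedAddCommGroup E] [NormedSpace ℝ E] [TopologicalSpace H]
  [NormedAddCommGroup F] [NormedSpace ℝ F] [TopologicalSpace K]
  [TopologicalSpace M] [ChartedSpace H M] [TopologicalSpace X] [ChartedSpace K X]

/-- `X` (a topological space with an atlas) is the smooth (Hausdorff, second countable)
quotient manifold of `M` along `p : M → X`: the quotient map `p` is a smooth submersion.
For given `p` there is at most one such smooth structure on `X`. -/
structure IsQuotientManifold (I : ModelWithCorners ℝ E H) (J : ModelWithCorners ℝ F K)
    (p : M → X) : Prop where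
  isManifold : IsManifold J ∞ X
  t2Space : T2Space X
  secondCountable : SecondCountableTopology X
  isQuotientMap : Topology.IsQuotientMap p
  isSubmersion : Manifold.IsSubmersion I J ∞ p

end Quotient

end RouthReduction

end

open RouthReduction

noncomputable section

namespace RouthReduction

open Set Filter Topology

section

/-! Everything is local over `Q/G`. A free and proper action has, near each orbit, an invariant open
set with an invariant coordinate `u` in `ℝ^b` and a group coordinate `τ` satisfying `τ(qg) = τ(q)g`
(`exists_localTriv`). Here `b` is `dim Q - dim G` and `r` is the dimension of the coadjoint orbit of
`μ`.

The map `g ↦ g · μ` has constant rank by equivariance, and its fibres are the cosets `g G_μ`. By the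
constant rank theorem these cosets are locally the fibres of a submersion `κ` from `G` to `ℝ^r`
(`exists_coadjoint_slice`), so `G/G_μ` never has to be constructed.

In a local trivialization the four projections then have the same fibres as explicit submersions to
vector spaces: `u` for `Q/G`, `(u, κ ∘ τ)` for `Q/G_μ`, `(u, Ad_τ ξ)` for the adjoint bundle, and
`((u, κ ∘ τ), (du(v), Ad_τ ω(v)))` for `TQ/G_μ`. The last uses that `(du, ω)` is an isomorphism on
each tangent space, because `ker du` is the vertical space and `ω` inverts `ξ ↦ σ_q(ξ)` there. Such
a submersion, a `SliceFunction`, descends to a chart of the quotient. Two of these charts are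
compatible because submersions have local sections and points of one fibre are exchanged by
diffeomorphisms preserving the fibres (`contDiffOn_transition`).

In these charts `φ_ω` is the injective linear map `((u, k), (w, η)) ↦ ((u, w), (u, k), (u, η))`
(`hasLinearCharts_reducedMap`), hence an embedding. Its image is the fibred product, by existence of
horizontal lifts (`range_reducedMap`). The fibred product receives the smooth structure transported
along `φ_ω`. The inclusion is then a smooth embedding because `φ_ω` is linear and injective in
charts, and `φ_ω` is a diffeomorphism onto it by construction
(`HasLinearCharts.exists_smoothEmbedding`). The formula for the inverse is checked by applying
`φ_ω`: `Tπ` kills `σ_q(ξ)` and `ω` kills the horizontal part. -/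

theorem hasMFDerivAt_prodMk_space {E H F F' M : Type*} [NormedAddCommGroup E]
    [NormedSpace ℝ E] [TopologicalSpace H] [NormedAddCommGroup F] [NormedSpace ℝ F]
    [TopologicalSpace M] [ChartedSpace H M] {I : ModelWithCorners ℝ E H}
    [NormedAddCommGroup F'] [NormedSpace ℝ F']
    {f : M → F} {g : M → F'} {x : M} {D : E →L[ℝ] F} {D' : E →L[ℝ] F'}
    (hf : HasMFDerivAt I 𝓘(ℝ, F) f x D) (hg : HasMFDerivAt I 𝓘(ℝ, F') g x D') :
    HasMFDerivAt I 𝓘(ℝ, F × F') (fun y => (f y, g y)) x (D.prod D') :=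
  ⟨hf.1.prodMk hg.1, hf.2.prodMk hg.2⟩

/-! ### Inverse function theorem and local structure of submersions -/

section InverseFunction

/-- The local inverse is smooth at the image of any point where the derivative is invertible.
Invertible operators form an open set, so restricting the source to the points with invertible
derivative makes the inverse smooth on the whole target. -/
theorem exists_openPartialHomeomorph_of_bijective_fderiv
    {E F : Type*} [NormedAddCommGroup E] [NormedSpace ℝ E] [CompleteSpace E]
    [NormedAddCommGroup F] [NormedSpace ℝ F] [CompleteSpace F]
    {f : E → F} {U : Set E} {a : E} (hU : IsOpen U) (ha : a ∈ U)
    (hf : ContDiffOn ℝ ∞ f U) (hb : Function.Bijective (fderiv ℝ f a)) :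
    ∃ γ : OpenPartialHomeomorph E F, a ∈ γ.source ∧ γ.source ⊆ U ∧ ⇑γ = f ∧
      ContDiffOn ℝ ∞ γ.symm γ.target := by
  have hfa : ∀ x ∈ U, ContDiffAt ℝ ∞ f x := fun x hx => hf.contDiffAt (hU.mem_nhds hx)
  let e : E ≃L[ℝ] F := ContinuousLinearEquiv.ofBijective (fderiv ℝ f a)
    (LinearMap.ker_eq_bot.2 hb.1) (LinearMap.range_eq_top.2 hb.2)
  have he : (e : E →L[ℝ] F) = fderiv ℝ f a := by ext; rfl
  have hd : HasFDerivAt f (e : E →L[ℝ] F) a := by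
    rw [he]; exact ((hfa a ha).differentiableAt (by simp)).hasFDerivAt
  let γ := (hfa a ha).toOpenPartialHomeomorph f hd (by simp)
  have hcont : ContinuousOn (fderiv ℝ f) U := hf.continuousOn_fderiv_of_isOpen hU (by simp)
  let V := U ∩ fderiv ℝ f ⁻¹' range ((↑) : (E ≃L[ℝ] F) → (E →L[ℝ] F))
  have hV : IsOpen V := hcont.isOpen_inter_preimage hU ContinuousLinearEquiv.isOpen
  have hγ : ⇑γ = f := rfl
  refine ⟨γ.restrOpen V hV, ⟨(hfa a ha).mem_toOpenPartialHomeomorph_source hd (by simp), ha,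
    e, he⟩, fun x hx => hx.2.1, hγ, fun y hy => ?_⟩
  have hy' : y ∈ γ.target := by simp at hy; exact hy.1
  have hx : (γ.restrOpen V hV).symm y ∈ V := ((γ.restrOpen V hV).map_target hy).2
  obtain ⟨e', he'⟩ := hx.2
  refine ContDiffAt.contDiffWithinAt ?_
  have := γ.contDiffAt_symm (f₀' := e') (n := ∞) hy' (by
    rw [he']; exact ((hfa _ hx.1).differentiableAt (by simp)).hasFDerivAt) (hfa _ hx.1)
  exact this

variable {E H F K M N : Type*} [NormedAddCommGroup E] [NormedSpace ℝ E] [CompleteSpace E]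
  [TopologicalSpace H] [NormedAddCommGroup F] [NormedSpace ℝ F] [CompleteSpace F]
  [TopologicalSpace K]
  [TopologicalSpace M] [ChartedSpace H M] [TopologicalSpace N] [ChartedSpace K N]
  {I : ModelWithCorners ℝ E H} {J : ModelWithCorners ℝ F K} [I.Boundaryless] [J.Boundaryless]
  [IsManifold I ∞ M] [IsManifold J ∞ N]

/-- The inverse function theorem on manifolds. -/
theorem exists_openPartialHomeomorph_of_bijective_mfderiv
    {f : M → N} {U : Set M} {m : M} (hU : IsOpen U) (hm : m ∈ U)
    (hf : ContMDiffOn I J ∞ f U) (hb : Function.Bijective (mfderiv I J f m)) :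
    ∃ Γ : OpenPartialHomeomorph M N, m ∈ Γ.source ∧ Γ.source ⊆ U ∧ EqOn Γ f Γ.source ∧
      ContMDiffOn I J ∞ Γ Γ.source ∧ ContMDiffOn J I ∞ Γ.symm Γ.target := by
  let φ : OpenPartialHomeomorph M E := (chartAt H m).transHomeomorph I.toHomeomorph
  let ψ : OpenPartialHomeomorph N F := (chartAt K (f m)).transHomeomorph J.toHomeomorph
  have hφe : ⇑φ = extChartAt I m := rfl
  have hφs : ⇑φ.symm = (extChartAt I m).symm := rfl
  have hφ : ContMDiffOn I 𝓘(ℝ, E) ∞ φ φ.source := contMDiffOn_extChartAt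
  have hφ' : ContMDiffOn 𝓘(ℝ, E) I ∞ φ.symm φ.target := by
    have := contMDiffOn_extChartAt_symm (I := I) (n := ∞) m
    rwa [extChartAt_target, I.range_eq_univ, inter_univ] at this
  have hψ : ContMDiffOn J 𝓘(ℝ, F) ∞ ψ ψ.source := contMDiffOn_extChartAt
  have hψ' : ContMDiffOn 𝓘(ℝ, F) J ∞ ψ.symm ψ.target := by
    have := contMDiffOn_extChartAt_symm (I := J) (n := ∞) (f m)
    rwa [extChartAt_target, J.range_eq_univ, inter_univ] at this
  have hmφ : m ∈ φ.source := mem_chart_source H m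
  have hmψ : f m ∈ ψ.source := mem_chart_source K (f m)
  let W : Set M := U ∩ f ⁻¹' ψ.source
  have hW : IsOpen W := hf.continuousOn.isOpen_inter_preimage hU ψ.open_source
  let W' : Set E := φ.target ∩ φ.symm ⁻¹' W
  have hW' : IsOpen W' := φ.symm.isOpen_inter_preimage hW
  let g : E → F := ψ ∘ f ∘ φ.symm
  have hg : ContDiffOn ℝ ∞ g W' := by
    rw [← contMDiffOn_iff_contDiffOn]
    refine hψ.comp (hf.comp (hφ'.mono fun x hx => hx.1) fun x hx => hx.2.1) fun x hx => hx.2.2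
  have ha : φ m ∈ W' := by
    refine ⟨φ.map_source hmφ, ?_⟩
    simp only [mem_preimage, φ.left_inv hmφ]
    exact ⟨hm, hmψ⟩
  -- The derivative of `f` at `m` is by definition that of `f` read in the preferred charts at `m`
  -- and `f m`, within the range of `I`, which is everything here.
  have hd : fderiv ℝ g (φ m) = mfderiv I J f m := by
    have hfm : MDifferentiableAt I J f m := (hf.contMDiffAt (hU.mem_nhds hm)).mdifferentiableAt
      (by simp)
    let D : E →L[ℝ] F := mfderiv I J f m
    have h2 : HasFDerivWithinAt g D univ (φ m) := by
      rw [← I.range_eq_univ]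
      exact hfm.hasMFDerivAt.2
    exact (hasFDerivWithinAt_univ.1 h2).fderiv
  obtain ⟨γ, hγa, hγs, hγ, hγ'⟩ := exists_openPartialHomeomorph_of_bijective_fderiv hW' ha hg
    (by rw [hd]; exact hb)
  let Γ : OpenPartialHomeomorph M N := (φ.trans γ).trans ψ.symm
  have hsrc : ∀ x ∈ Γ.source, x ∈ φ.source ∧ x ∈ W := by
    intro x hx
    simp only [Γ, OpenPartialHomeomorph.trans_source, mem_inter_iff, mem_preimage] at hx
    refine ⟨hx.1.1, ?_⟩
    have := (hγs hx.1.2).2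
    simpa only [mem_preimage, φ.left_inv hx.1.1] using this
  have heq : EqOn Γ f Γ.source := by
    intro x hx
    obtain ⟨h1, h2⟩ := hsrc x hx
    change ψ.symm (γ (φ x)) = f x
    rw [hγ]
    simp only [g, Function.comp, φ.left_inv h1]
    exact ψ.left_inv h2.2
  refine ⟨Γ, ?_, fun x hx => (hsrc x hx).2.1, heq, ?_, ?_⟩
  · simp only [Γ, OpenPartialHomeomorph.trans_source, mem_inter_iff, mem_preimage]
    refine ⟨⟨hmφ, hγa⟩, ?_⟩
    simp only [OpenPartialHomeomorph.trans_apply, hγ, g, Function.comp, φ.left_inv hmφ]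
    exact ψ.map_source hmψ
  · exact (hf.mono fun x hx => (hsrc x hx).2.1).congr heq
  · have h : Γ.target ⊆ ψ.source ∩ (ψ ⁻¹' (γ.target ∩ γ.symm ⁻¹' φ.target)) := by
      intro y hy
      simp only [Γ, OpenPartialHomeomorph.trans_target] at hy
      simp_all
    change ContMDiffOn J I ∞ (φ.symm ∘ γ.symm ∘ ψ) Γ.target
    refine hφ'.comp ((contMDiffOn_iff_contDiffOn.2 hγ').comp (hψ.mono fun y hy => (h hy).1)
      fun y hy => (h hy).2.1) fun y hy => (h hy).2.2

end InverseFunction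

section Submersion

variable {E H F M : Type*} [NormedAddCommGroup E] [NormedSpace ℝ E] [FiniteDimensional ℝ E]
  [TopologicalSpace H] [NormedAddCommGroup F] [NormedSpace ℝ F] [FiniteDimensional ℝ F]
  [TopologicalSpace M] [ChartedSpace H M]
  {I : ModelWithCorners ℝ E H} [I.Boundaryless] [IsManifold I ∞ M]

/-- A projection onto the kernel of `D`, followed by an identification of the kernel with `C`,
supplies the second component. -/
theorem exists_equiv_prod_of_surjective {C : Type*} [NormedAddCommGroup C] [NormedSpace ℝ C]
    [FiniteDimensional ℝ C] (D : E →L[ℝ] F) (hD : Function.Surjective D)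
    (hC : Module.finrank ℝ F + Module.finrank ℝ C = Module.finrank ℝ E) :
    ∃ L : E ≃L[ℝ] F × C, ∀ x, (L x).1 = D x := by
  have hr := D.toLinearMap.finrank_range_add_finrank_ker
  have hr' : D.toLinearMap.range = ⊤ := LinearMap.range_eq_top.2 hD
  rw [hr', finrank_top] at hr
  obtain ⟨p, hp⟩ := Submodule.exists_isCompl D.toLinearMap.ker
  let P : E →ₗ[ℝ] D.toLinearMap.ker := Submodule.projectionOnto _ p hp
  let l : D.toLinearMap.ker ≃ₗ[ℝ] C := LinearEquiv.ofFinrankEq _ _ (by omega)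
  let T : E →ₗ[ℝ] F × C := D.toLinearMap.prod (l.toLinearMap ∘ₗ P)
  have hinj : Function.Injective T := by
    rw [← LinearMap.ker_eq_bot, LinearMap.ker_eq_bot']
    intro x hx
    have h1 : x ∈ D.toLinearMap.ker := congrArg Prod.fst hx
    have h2 : P x = ⟨x, h1⟩ := Submodule.projectionOnto_apply_left hp ⟨x, h1⟩
    have h3 : l (P x) = 0 := congrArg Prod.snd hx
    rw [h2, map_eq_zero_iff l l.injective] at h3
    simpa using h3
  have hfin : Module.finrank ℝ E = Module.finrank ℝ (F × C) := by
    rw [Module.finrank_prod, hC]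
  refine ⟨(LinearEquiv.ofInjectiveOfFinrankEq T hinj hfin).toContinuousLinearEquiv, fun x => rfl⟩

/-- Near a point where its derivative is surjective, a smooth map to a vector space is, up to a
linear isomorphism, the first component of a chart. -/
theorem exists_chart_of_surjective_mfderiv {C : Type*} [NormedAddCommGroup C] [NormedSpace ℝ C]
    [FiniteDimensional ℝ C]
    (hC : Module.finrank ℝ F + Module.finrank ℝ C = Module.finrank ℝ E)
    {f : M → F} {U : Set M} {m : M} (hU : IsOpen U) (hm : m ∈ U)
    (hf : ContMDiffOn I 𝓘(ℝ, F) ∞ f U) (hs : Function.Surjective (mfderiv I 𝓘(ℝ, F) f m)) :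
    ∃ (φ : OpenPartialHomeomorph M H) (L : E ≃L[ℝ] F × C), φ ∈ IsManifold.maximalAtlas I ∞ M ∧
      m ∈ φ.source ∧ φ.source ⊆ U ∧ ∀ x ∈ φ.source, (L (I (φ x))).1 = f x := by
  have : CompleteSpace E := FiniteDimensional.complete ℝ E
  let D : E →L[ℝ] F := mfderiv I 𝓘(ℝ, F) f m
  obtain ⟨L, hL⟩ := exists_equiv_prod_of_surjective (C := C) D hs hC
  let V : Set M := U ∩ (chartAt H m).source
  have hV : IsOpen V := hU.inter (chartAt H m).open_source
  -- The first chart coordinate is replaced by `f` and the second is kept. The map `L` is adapted to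
  -- the derivative of `f` at `m`, so the derivative of `g` at `m` is the identity.
  let g : M → E := fun x => L.symm (f x, (L (extChartAt I m x)).2)
  have hg : ContMDiffOn I 𝓘(ℝ, E) ∞ g V := by
    refine L.symm.contDiff.contMDiff.comp_contMDiffOn ?_
    refine (hf.mono inter_subset_left).prodMk_space ?_
    exact (ContinuousLinearMap.snd ℝ F C).contDiff.contMDiff.comp_contMDiffOn
      (L.contDiff.contMDiff.comp_contMDiffOn (contMDiffOn_extChartAt.mono inter_subset_right))
  have hfm : MDifferentiableAt I 𝓘(ℝ, F) f m :=
    (hf.contMDiffAt (hU.mem_nhds hm)).mdifferentiableAt (by simp)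
  have hχ : HasMFDerivAt I 𝓘(ℝ, E) (extChartAt I m) m (ContinuousLinearMap.id ℝ E) := by
    have h1 := (mdifferentiableAt_extChartAt (I := I) (mem_chart_source H m)).hasMFDerivAt
    rwa [mfderiv_extChartAt_self (I := I) (x := m)] at h1
  have hgm : HasMFDerivAt I 𝓘(ℝ, E) g m (ContinuousLinearMap.id ℝ E) := by
    have h2 := (hasMFDerivAt_prodMk_space (D := D) hfm.hasMFDerivAt
      (((ContinuousLinearMap.snd ℝ F C).hasMFDerivAt (x := L (extChartAt I m m))).comp m
      ((L : E →L[ℝ] F × C).hasMFDerivAt (x := extChartAt I m m) |>.comp m hχ)))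
    have h3 := ((L.symm : F × C →L[ℝ] E).hasMFDerivAt
      (x := (f m, (L (extChartAt I m m)).2))).comp m h2
    have e : (L.symm : F × C →L[ℝ] E).comp (D.prod ((ContinuousLinearMap.snd ℝ F C).comp
        ((L : E →L[ℝ] F × C).comp (ContinuousLinearMap.id ℝ E)))) =
        ContinuousLinearMap.id ℝ E := by
      ext x
      change L.symm (D x, (L x).2) = x
      rw [← hL x]
      simp
    rw [← e]
    exact h3
  obtain ⟨Γ, h1, h2, h3, h4, h5⟩ := exists_openPartialHomeomorph_of_bijective_mfderiv hV
    ⟨hm, mem_chart_source H m⟩ hg (by rw [hgm.mfderiv]; exact Function.bijective_id)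
  refine ⟨Γ.transHomeomorph I.toHomeomorph.symm, L, ?_, h1, fun x hx => (h2 hx).1, ?_⟩
  · refine OpenPartialHomeomorph.mem_maximalAtlas_of_contMDiffOn (I := I) (n := ∞) _ ?_ ?_
    · have : ContMDiff 𝓘(ℝ, E) I ∞ I.symm := by
        have := I.contMDiffOn_symm (n := ∞)
        rwa [I.range_eq_univ, contMDiffOn_univ] at this
      exact this.comp_contMDiffOn h4
    · exact h5.comp I.contMDiff.contMDiffOn (fun x hx => by
        simpa using hx)
  · intro x hx
    have e : I ((Γ.transHomeomorph I.toHomeomorph.symm) x) = Γ x := by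
      change I (I.symm (Γ x)) = Γ x
      exact I.right_inv (by rw [I.range_eq_univ]; trivial)
    rw [e, h3 hx]
    simp [g]

/-- In a chart where `f` is the first component, the section freezes the second component at its
value at `m`. -/
theorem exists_section_of_surjective_mfderiv
    {f : M → F} {U : Set M} {m : M} (hU : IsOpen U) (hm : m ∈ U)
    (hf : ContMDiffOn I 𝓘(ℝ, F) ∞ f U) (hs : Function.Surjective (mfderiv I 𝓘(ℝ, F) f m)) :
    ∃ σ : F → M, ContMDiffAt 𝓘(ℝ, F) I ∞ σ (f m) ∧ σ (f m) = m ∧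
      ∀ᶠ a in 𝓝 (f m), f (σ a) = a := by
  have hle : Module.finrank ℝ F ≤ Module.finrank ℝ E :=
    LinearMap.finrank_le_finrank_of_surjective (f := (mfderiv I 𝓘(ℝ, F) f m).toLinearMap) hs
  obtain ⟨φ, L, h1, h2, -, h3⟩ := exists_chart_of_surjective_mfderiv
    (C := EuclideanSpace ℝ (Fin (Module.finrank ℝ E - Module.finrank ℝ F)))
    (by rw [finrank_euclideanSpace_fin]; omega) hU hm hf hs
  let j : F → H := fun a => I.symm (L.symm (a, (L (I (φ m))).2))
  have hj : ContMDiff 𝓘(ℝ, F) I ∞ j := by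
    have h : ContMDiff 𝓘(ℝ, E) I ∞ I.symm := by
      have := I.contMDiffOn_symm (n := ∞)
      rwa [I.range_eq_univ, contMDiffOn_univ] at this
    exact h.comp (L.symm.contDiff.contMDiff.comp
      (contDiff_id.prodMk contDiff_const).contMDiff)
  have hjm : j (f m) = φ m := by
    simp only [j]
    rw [← h3 m h2]
    simp
  have hjt : ∀ᶠ a in 𝓝 (f m), j a ∈ φ.target :=
    hj.continuous.continuousAt.eventually_mem
      (φ.open_target.mem_nhds (by rw [hjm]; exact φ.map_source h2))
  refine ⟨φ.symm ∘ j, ?_, ?_, ?_⟩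
  · refine ContMDiffAt.comp _ ?_ hj.contMDiffAt
    exact contMDiffAt_symm_of_mem_maximalAtlas h1 (by rw [hjm]; exact φ.map_source h2)
  · simp [hjm, φ.left_inv h2]
  · filter_upwards [hjt] with a ha
    simp only [Function.comp]
    rw [← h3 _ (φ.map_target ha), φ.right_inv ha]
    simp only [j]
    rw [I.right_inv (by rw [I.range_eq_univ]; trivial)]
    simp

/-- Submersions are open: a continuous local section through `m` pulls neighbourhoods of `m` back to
neighbourhoods of `f m`. -/
theorem nhds_le_map_of_surjective_mfderiv
    {f : M → F} {U : Set M} {m : M} (hU : IsOpen U) (hm : m ∈ U)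
    (hf : ContMDiffOn I 𝓘(ℝ, F) ∞ f U) (hs : Function.Surjective (mfderiv I 𝓘(ℝ, F) f m)) :
    𝓝 (f m) ≤ map f (𝓝 m) := by
  obtain ⟨σ, h1, h2, h3⟩ := exists_section_of_surjective_mfderiv hU hm hf hs
  intro s hs'
  have h4 : Tendsto σ (𝓝 (f m)) (𝓝 m) := by
    have := h1.continuousAt.tendsto
    rwa [h2] at this
  filter_upwards [h4 hs', h3] with a ha ha'
  rw [← ha']
  exact ha

end Submersion

end

/-! ### Charts of a quotient from submersions with the same fibres -/

section

section Slice

variable {E H M X : Type*} [NormedAddCommGroup E] [NormedSpace ℝ E] [TopologicalSpace H]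
  [TopologicalSpace M] [ChartedSpace H M]

/-- A submersion `fn` from an open set of `M` to a vector space `F`, with the same fibres as the
restriction of `p` to that open set. -/
structure SliceFunction (I : ModelWithCorners ℝ E H) (p : M → X) (F : Type*)
    [NormedAddCommGroup F] [NormedSpace ℝ F] where
  /-- the domain -/
  dom : Set M
  /-- the function -/
  fn : M → F
  /-- a base point in the domain -/
  pt : M
  pt_mem : pt ∈ dom
  isOpen_dom : IsOpen dom
  contMDiffOn : ContMDiffOn I 𝓘(ℝ, F) ∞ fn dom
  surjective : ∀ m ∈ dom, Function.Surjective (mfderiv I 𝓘(ℝ, F) fn m)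
  eq_iff : ∀ m ∈ dom, ∀ m' ∈ dom, p m = p m' ↔ fn m = fn m'

variable {I : ModelWithCorners ℝ E H} {p : M → X} {F : Type*}
  [NormedAddCommGroup F] [NormedSpace ℝ F]

namespace SliceFunction

open Classical in
/-- The map induced on the quotient by a slice function. -/
def toQuot (S : SliceFunction I p F) (x : X) : F :=
  if h : ∃ m ∈ S.dom, p m = x then S.fn h.choose else 0

open Classical in
/-- The inverse of the map induced on the quotient by a slice function. -/
def ofQuot (S : SliceFunction I p F) (a : F) : X :=
  -- `X` has no distinguished element, so the base point of the slice provides the value outside the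
  -- image.
  if h : ∃ m ∈ S.dom, S.fn m = a then p h.choose else p S.pt

theorem toQuot_apply (S : SliceFunction I p F) {m : M} (hm : m ∈ S.dom) :
    S.toQuot (p m) = S.fn m := by
  have h : ∃ m' ∈ S.dom, p m' = p m := ⟨m, hm, rfl⟩
  rw [toQuot, dif_pos h]
  exact (S.eq_iff _ h.choose_spec.1 _ hm).1 h.choose_spec.2

theorem ofQuot_apply (S : SliceFunction I p F) {m : M} (hm : m ∈ S.dom) :
    S.ofQuot (S.fn m) = p m := by
  have h : ∃ m' ∈ S.dom, S.fn m' = S.fn m := ⟨m, hm, rfl⟩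
  rw [ofQuot, dif_pos h]
  exact (S.eq_iff _ h.choose_spec.1 _ hm).2 h.choose_spec.2

variable [FiniteDimensional ℝ E] [FiniteDimensional ℝ F] [I.Boundaryless] [IsManifold I ∞ M]

theorem nhds_le (S : SliceFunction I p F) {m : M} (hm : m ∈ S.dom) :
    𝓝 (S.fn m) ≤ map S.fn (𝓝 m) :=
  nhds_le_map_of_surjective_mfderiv S.isOpen_dom hm S.contMDiffOn (S.surjective m hm)

variable [TopologicalSpace X]

/-- The chart of the quotient induced by a slice function. -/
def chart (hp : IsOpenQuotientMap p) (S : SliceFunction I p F) : OpenPartialHomeomorph X F where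
  toFun := S.toQuot
  invFun := S.ofQuot
  source := p '' S.dom
  target := S.fn '' S.dom
  map_source' := by
    rintro _ ⟨m, hm, rfl⟩
    exact ⟨m, hm, (S.toQuot_apply hm).symm⟩
  map_target' := by
    rintro _ ⟨m, hm, rfl⟩
    exact ⟨m, hm, (S.ofQuot_apply hm).symm⟩
  left_inv' := by
    rintro _ ⟨m, hm, rfl⟩
    rw [S.toQuot_apply hm, S.ofQuot_apply hm]
  right_inv' := by
    rintro _ ⟨m, hm, rfl⟩
    rw [S.ofQuot_apply hm, S.toQuot_apply hm]
  open_source := hp.isOpenMap _ S.isOpen_dom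
  open_target := by
    rw [isOpen_iff_mem_nhds]
    rintro _ ⟨m, hm, rfl⟩
    refine S.nhds_le hm (mem_map.2 ?_)
    filter_upwards [S.isOpen_dom.mem_nhds hm] with x hx using ⟨x, hx, rfl⟩
  continuousOn_toFun := by
    rintro _ ⟨m, hm, rfl⟩
    refine ContinuousAt.continuousWithinAt ?_
    rw [ContinuousAt, S.toQuot_apply hm]
    refine Tendsto.mono_left ?_ (hp.isOpenMap.nhds_le m)
    rw [tendsto_map'_iff]
    refine (S.contMDiffOn.continuousOn.continuousAt (S.isOpen_dom.mem_nhds hm)).tendsto.congr' ?_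
    filter_upwards [S.isOpen_dom.mem_nhds hm] with x hx using (S.toQuot_apply hx).symm
  continuousOn_invFun := by
    rintro _ ⟨m, hm, rfl⟩
    refine ContinuousAt.continuousWithinAt ?_
    rw [ContinuousAt, S.ofQuot_apply hm]
    -- Since `fn` is open at `m`, continuity of the inverse may be tested after composing with `fn`,
    -- where it becomes continuity of `p`.
    refine Tendsto.mono_left ?_ (S.nhds_le hm)
    rw [tendsto_map'_iff]
    refine hp.continuous.continuousAt.tendsto.congr' ?_
    filter_upwards [S.isOpen_dom.mem_nhds hm] with x hx using (S.ofQuot_apply hx).symm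

theorem chart_apply (hp : IsOpenQuotientMap p) (S : SliceFunction I p F) {m : M} (hm : m ∈ S.dom) :
    S.chart hp (p m) = S.fn m := S.toQuot_apply hm

/-- Near `S.fn m` the transition map is `S'.fn ∘ γ ∘ σ`, where `σ` is a local section of `S.fn`
through `m` and `γ` preserves the fibres of `p` and moves `m` into the domain of `S'`. No such `γ`
would be needed if the two domains met in the fibre of `m`. -/
theorem contDiffOn_transition (hp : IsOpenQuotientMap p)
    (hγ : ∀ m m' : M, p m = p m' → ∃ γ : M → M, ContMDiff I I ∞ γ ∧ γ m = m' ∧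
      ∀ x, p (γ x) = p x) (S S' : SliceFunction I p F) :
    ContDiffOn ℝ ∞ (S'.chart hp ∘ (S.chart hp).symm) ((S.chart hp).symm.trans (S'.chart hp)).source
    := by
  rintro a ⟨⟨m, hm, rfl⟩, ha⟩
  obtain ⟨m', hm', h⟩ : S.ofQuot (S.fn m) ∈ p '' S'.dom := ha
  rw [S.ofQuot_apply hm] at h
  obtain ⟨γ, h1, h2, h3⟩ := hγ m m' h.symm
  obtain ⟨σ, hσ, hσm, hσf⟩ :=
    exists_section_of_surjective_mfderiv S.isOpen_dom hm S.contMDiffOn (S.surjective m hm)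
  refine ContDiffAt.contDiffWithinAt ?_
  have hc : ContMDiffAt 𝓘(ℝ, F) 𝓘(ℝ, F) ∞ (S'.fn ∘ γ ∘ σ) (S.fn m) := by
    refine ContMDiffAt.comp _ (I' := I) ?_ (h1.contMDiffAt.comp _ hσ)
    refine S'.contMDiffOn.contMDiffAt (S'.isOpen_dom.mem_nhds ?_)
    simpa [hσm, h2] using hm'
  refine (contMDiffAt_iff_contDiffAt.1 hc).congr_of_eventuallyEq ?_
  have t1 : ∀ᶠ a in 𝓝 (S.fn m), σ a ∈ S.dom :=
    hσ.continuousAt.eventually_mem (by rw [hσm]; exact S.isOpen_dom.mem_nhds hm)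
  have t2 : ∀ᶠ a in 𝓝 (S.fn m), γ (σ a) ∈ S'.dom :=
    (ContinuousAt.comp (g := γ) h1.continuous.continuousAt hσ.continuousAt).eventually_mem
      (by simp only [Function.comp]; rw [hσm, h2]; exact S'.isOpen_dom.mem_nhds hm')
  filter_upwards [t1, t2, hσf] with a h1 h2 h4
  change S'.toQuot (S.ofQuot a) = S'.fn (γ (σ a))
  rw [← h4, S.ofQuot_apply h1, ← h3, S'.toQuot_apply h2, h4]

/-- The charted space structure on a quotient given by slice functions. -/
@[reducible] def chartedSpace (hp : IsOpenQuotientMap p) (S : X → SliceFunction I p F)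
    (hS : ∀ x, x ∈ p '' (S x).dom) :
    ChartedSpace F X where
  -- The atlas contains the charts of all slice functions, not just the selected ones, so it does
  -- not depend on `S` and every slice function met later gives a chart.
  atlas := range (chart (I := I) (F := F) hp)
  chartAt x := (S x).chart hp
  mem_chart_source x := hS x
  chart_mem_atlas x := ⟨S x, rfl⟩

/-- Points over distinct points of `Y` are separated there. Points over the same point lie in the
domain of a common chart, which is injective with Hausdorff target. -/
theorem t2Space_of_base (hp : IsOpenQuotientMap p)
    {Y : Type*} [TopologicalSpace Y] [T2Space Y] {b : X → Y}
    (hb : Continuous b)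
    (h : ∀ x x' : X, b x = b x' →
      ∃ S : SliceFunction I p F, x ∈ p '' S.dom ∧ x' ∈ p '' S.dom) : T2Space X := by
  refine ⟨fun x x' hx => ?_⟩
  by_cases hbx : b x = b x'
  · obtain ⟨S, h1, h2⟩ := h x x' hbx
    have hne : S.chart hp x ≠ S.chart hp x' := fun e => hx ((S.chart hp).injOn h1 h2 e)
    obtain ⟨u, v, hu, hv, hxu, hxv, huv⟩ := t2_separation hne
    refine ⟨_, _, (S.chart hp).isOpen_inter_preimage hu, (S.chart hp).isOpen_inter_preimage hv,
      ⟨h1, hxu⟩, ⟨h2, hxv⟩, ?_⟩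
    rw [Set.disjoint_left]
    rintro z ⟨-, hz⟩ ⟨-, hz'⟩
    exact Set.disjoint_left.1 huv hz hz'
  · obtain ⟨u, v, hu, hv, hxu, hxv, huv⟩ := t2_separation hbx
    exact ⟨_, _, hu.preimage hb, hv.preimage hb, hxu, hxv, huv.preimage b⟩

variable (hp : IsOpenQuotientMap p)

variable [ChartedSpace F X]

theorem isManifold_quotient
    (hγ : ∀ m m' : M, p m = p m' → ∃ γ : M → M, ContMDiff I I ∞ γ ∧ γ m = m' ∧
      ∀ x, p (γ x) = p x)
    (hat : atlas F X = range (chart (I := I) (F := F) hp)) : IsManifold 𝓘(ℝ, F) ∞ X := by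
  refine isManifold_of_contDiffOn _ _ _ ?_
  rw [hat]
  rintro _ _ ⟨S, rfl⟩ ⟨S', rfl⟩
  simpa using contDiffOn_transition hp hγ S S'

theorem chart_mem_maximalAtlas [IsManifold 𝓘(ℝ, F) ∞ X]
    (hat : atlas F X = range (chart (I := I) (F := F) hp)) (S : SliceFunction I p F) :
    S.chart hp ∈ IsManifold.maximalAtlas 𝓘(ℝ, F) ∞ X :=
  IsManifold.subset_maximalAtlas (by rw [hat]; exact ⟨S, rfl⟩)

/-- In a chart of `M` whose first component is `S.fn` and in the induced chart of `X`, the map `p`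
is the projection to the first factor. -/
theorem isSubmersion_quotient [IsManifold 𝓘(ℝ, F) ∞ X]
    (hat : atlas F X = range (chart (I := I) (F := F) hp))
    (hcov : ∀ m : M, ∃ S : SliceFunction I p F, m ∈ S.dom) :
    Manifold.IsSubmersion I 𝓘(ℝ, F) ∞ p := by
  refine Manifold.IsSubmersionOfComplement.isSubmersion
    (F := EuclideanSpace ℝ (Fin (Module.finrank ℝ E - Module.finrank ℝ F))) fun m => ?_
  obtain ⟨S, hm⟩ := hcov m
  have hle : Module.finrank ℝ F ≤ Module.finrank ℝ E :=
    LinearMap.finrank_le_finrank_of_surjective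
      (f := (mfderiv I 𝓘(ℝ, F) S.fn m).toLinearMap) (S.surjective m hm)
  obtain ⟨φ, L, h1, h2, h3, h4⟩ := exists_chart_of_surjective_mfderiv
    (C := EuclideanSpace ℝ (Fin (Module.finrank ℝ E - Module.finrank ℝ F)))
    (by rw [finrank_euclideanSpace_fin]; omega) S.isOpen_dom hm S.contMDiffOn (S.surjective m hm)
  refine Manifold.IsSubmersionAtOfComplement.mk_of_continuousAt hp.continuous.continuousAt L φ
    (S.chart hp) h2 ⟨m, hm, rfl⟩ h1 (chart_mem_maximalAtlas hp hat S) ?_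
  intro y hy
  have hy1 : I.symm y ∈ φ.target := by
    rw [OpenPartialHomeomorph.extend_target] at hy
    exact hy.1
  have hx := φ.map_target hy1
  change S.chart hp (p (φ.symm (I.symm y))) = (L y).1
  rw [S.chart_apply hp (h3 hx), ← h4 _ hx, φ.right_inv hy1,
    I.right_inv (by rw [I.range_eq_univ]; trivial)]

theorem isQuotientManifold [SecondCountableTopology M]
    (hγ : ∀ m m' : M, p m = p m' → ∃ γ : M → M, ContMDiff I I ∞ γ ∧ γ m = m' ∧
      ∀ x, p (γ x) = p x)
    (hat : atlas F X = range (chart (I := I) (F := F) hp))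
    (hcov : ∀ m : M, ∃ S : SliceFunction I p F, m ∈ S.dom) (hT2 : T2Space X) :
    IsQuotientManifold I 𝓘(ℝ, F) p :=
  have := isManifold_quotient hp hγ hat
  { isManifold := this
    t2Space := hT2
    secondCountable := hp.isQuotientMap.secondCountableTopology hp.isOpenMap
    isQuotientMap := hp.isQuotientMap
    isSubmersion := isSubmersion_quotient hp hat hcov }

end SliceFunction

end Slice

end

/-! ### Constant rank theorem -/

section

section ConstantRank

variable {E H F M : Type*} [NormedAddCommGroup E] [NormedSpace ℝ E] [FiniteDimensional ℝ E]
  [TopologicalSpace H] [NormedAddCommGroup F] [NormedSpace ℝ F] [FiniteDimensional ℝ F]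
  [TopologicalSpace M] [ChartedSpace H M]
  {I : ModelWithCorners ℝ E H} [I.Boundaryless] [IsManifold I ∞ M]

/-- The rank of the derivative of `f` at `x`. -/
def rankAt (I : ModelWithCorners ℝ E H) (f : M → F) (x : M) : ℕ :=
  Module.finrank ℝ (LinearMap.range (mfderiv I 𝓘(ℝ, F) f x : E →L[ℝ] F).toLinearMap)

/-- A map of locally constant rank `r` has locally the same fibres as a submersion to `ℝ^r`. -/
theorem exists_submersion_of_constant_rank {f : M → F} {U : Set M} {m : M} {r : ℕ}
    (hU : IsOpen U) (hm : m ∈ U) (hf : ContMDiffOn I 𝓘(ℝ, F) ∞ f U)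
    (hr : rankAt I f m = r) (hle : ∀ x ∈ U, rankAt I f x ≤ r) :
    ∃ (h : M → EuclideanSpace ℝ (Fin r)) (N : Set M), IsOpen N ∧ m ∈ N ∧
      ContMDiffOn I 𝓘(ℝ, EuclideanSpace ℝ (Fin r)) ∞ h N ∧
      (∀ x ∈ N, Function.Surjective (mfderiv I 𝓘(ℝ, EuclideanSpace ℝ (Fin r)) h x)) ∧
      ∀ x ∈ N, ∀ y ∈ N, f x = f y ↔ h x = h y := by
  let D : M → E →L[ℝ] F := fun x => mfderiv I 𝓘(ℝ, F) f x
  have hD : ∀ x ∈ U, HasMFDerivAt I 𝓘(ℝ, F) f x (D x) := fun x hx =>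
    ((hf.contMDiffAt (hU.mem_nhds hx)).mdifferentiableAt (by simp)).hasMFDerivAt
  let R := LinearMap.range (D m).toLinearMap
  obtain ⟨P₀, hP₀⟩ := R.subtype.exists_leftInverse_of_injective (by simp)
  let l : R ≃ₗ[ℝ] EuclideanSpace ℝ (Fin r) := LinearEquiv.ofFinrankEq _ _ (by
    rw [finrank_euclideanSpace_fin]; exact hr)
  -- A projection onto the image of the derivative at `m`, in coordinates. The submersion is `P ∘
  -- f`, and it remains to see that `f` is locally a function of `P ∘ f`.
  let P : F →L[ℝ] EuclideanSpace ℝ (Fin r) := (l.toLinearMap ∘ₗ P₀).toContinuousLinearMap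
  have hPD : Function.Surjective (P.comp (D m)) := by
    intro a
    obtain ⟨v, hv⟩ := (l.symm a).2
    refine ⟨v, ?_⟩
    change l (P₀ (D m v)) = a
    have h1 : D m v = R.subtype (l.symm a) := hv
    have h2 : P₀ (R.subtype (l.symm a)) = l.symm a := LinearMap.congr_fun hP₀ (l.symm a)
    rw [h1, h2, l.apply_symm_apply]
  have hh : ContMDiffOn I 𝓘(ℝ, EuclideanSpace ℝ (Fin r)) ∞ (P ∘ f) U :=
    P.contDiff.contMDiff.comp_contMDiffOn hf
  have hhD : ∀ x ∈ U, HasMFDerivAt I 𝓘(ℝ, EuclideanSpace ℝ (Fin r)) (P ∘ f) x (P.comp (D x)) :=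
    fun x hx => (P.hasMFDerivAt (x := f x)).comp x (hD x hx)
  have hdim : r ≤ Module.finrank ℝ E := by
    rw [← hr]; exact LinearMap.finrank_range_le (D m).toLinearMap
  obtain ⟨φ, L, h1, h2, h3, h4⟩ := exists_chart_of_surjective_mfderiv
    (C := EuclideanSpace ℝ (Fin (Module.finrank ℝ E - r)))
    (by rw [finrank_euclideanSpace_fin, finrank_euclideanSpace_fin]; omega) hU hm hh
    (by rw [(hhD m hm).mfderiv]; exact hPD)
  let T : Set (EuclideanSpace ℝ (Fin r) × EuclideanSpace ℝ (Fin (Module.finrank ℝ E - r))) :=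
    (fun z => I.symm (L.symm z)) ⁻¹' φ.target
  let s : EuclideanSpace ℝ (Fin r) × EuclideanSpace ℝ (Fin (Module.finrank ℝ E - r)) → M :=
    fun z => φ.symm (I.symm (L.symm z))
  have hT : IsOpen T := φ.open_target.preimage (I.continuous_symm.comp L.symm.continuous)
  have hsT : ∀ z ∈ T, s z ∈ φ.source := fun z hz => φ.map_target hz
  have hPf : ∀ z ∈ T, P (f (s z)) = z.1 := by
    intro z hz
    have := h4 _ (hsT z hz)
    rw [Function.comp] at this
    rw [← this, φ.right_inv hz, I.right_inv (by rw [I.range_eq_univ]; trivial)]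
    simp
  have hs : ContMDiffOn 𝓘(ℝ, EuclideanSpace ℝ (Fin r) ×
      EuclideanSpace ℝ (Fin (Module.finrank ℝ E - r))) I ∞ s T := by
    have h : ContMDiff 𝓘(ℝ, E) I ∞ I.symm := by
      have := I.contMDiffOn_symm (n := ∞)
      rwa [I.range_eq_univ, contMDiffOn_univ] at this
    exact (contMDiffOn_symm_of_mem_maximalAtlas h1).comp
      (h.comp L.symm.contDiff.contMDiff).contMDiffOn fun z hz => hz
  let S : (z : _) → (EuclideanSpace ℝ (Fin r) ×
      EuclideanSpace ℝ (Fin (Module.finrank ℝ E - r))) →L[ℝ] E := fun z => mfderiv 𝓘(ℝ, _) I s z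
  have hfs : ∀ z ∈ T, HasFDerivAt (f ∘ s) ((D (s z)).comp (S z)) z := by
    intro z hz
    have hsz : HasMFDerivAt 𝓘(ℝ, _) I s z (S z) :=
      ((hs.contMDiffAt (hT.mem_nhds hz)).mdifferentiableAt (by simp)).hasMFDerivAt
    exact hasMFDerivAt_iff_hasFDerivAt.1 ((hD (s z) (h3 (hsT z hz))).comp z hsz)
  have hPDS : ∀ z ∈ T, P.comp ((D (s z)).comp (S z)) = ContinuousLinearMap.fst ℝ _ _ := by
    intro z hz
    have e1 : HasFDerivAt (P ∘ f ∘ s) (P.comp ((D (s z)).comp (S z))) z :=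
      (P.hasFDerivAt).comp z (hfs z hz)
    refine e1.unique ((hasFDerivAt_fst (p := z)).congr_of_eventuallyEq ?_)
    filter_upwards [hT.mem_nhds hz] with w hw using hPf w hw
  have hsurj : ∀ z ∈ T, Function.Surjective (P.comp (D (s z))) := by
    intro z hz a
    refine ⟨S z (a, 0), ?_⟩
    exact congrArg (fun B : _ →L[ℝ] _ => B (a, 0)) (hPDS z hz)
  -- On the image of the derivative at `s z`, of dimension at most `r`, `P` is onto `ℝ^r` and
  -- therefore injective. It kills the derivative of `f ∘ s` along the second factor, so this
  -- derivative vanishes. Only the upper bound on the rank is needed; the lower one comes from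
  -- surjectivity.
  have hker : ∀ z ∈ T, ∀ c, D (s z) (S z (0, c)) = 0 := by
    intro z hz c
    let Pr : LinearMap.range (D (s z)).toLinearMap →ₗ[ℝ] EuclideanSpace ℝ (Fin r) :=
      P.toLinearMap.domRestrict _
    have hPr : Function.Surjective Pr := by
      intro a
      obtain ⟨v, hv⟩ := hsurj z hz a
      exact ⟨⟨D (s z) v, v, rfl⟩, hv⟩
    have hinj : Function.Injective Pr := by
      refine (LinearMap.injective_iff_surjective_of_finrank_eq_finrank ?_).2 hPr
      refine le_antisymm ?_ (LinearMap.finrank_le_finrank_of_surjective hPr)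
      rw [finrank_euclideanSpace_fin]
      exact hle _ (h3 (hsT z hz))
    have h0 : Pr ⟨D (s z) (S z (0, c)), _, rfl⟩ = Pr 0 := by
      rw [map_zero]
      exact congrArg (fun B : _ →L[ℝ] _ => B (0, c)) (hPDS z hz)
    exact congrArg Subtype.val (hinj h0)
  let z₀ := L (I (φ m))
  have hsφ : ∀ x ∈ φ.source, L (I (φ x)) ∈ T ∧ s (L (I (φ x))) = x := by
    intro x hx
    have e : I.symm (L.symm (L (I (φ x)))) = φ x := by simp
    refine ⟨?_, ?_⟩
    · change I.symm (L.symm (L (I (φ x)))) ∈ φ.target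
      rw [e]; exact φ.map_source hx
    · change φ.symm (I.symm (L.symm (L (I (φ x))))) = x
      rw [e, φ.left_inv hx]
  obtain ⟨ε, hε, hball⟩ := Metric.isOpen_iff.1 hT z₀ (hsφ m h2).1
  have hconst : ∀ a c c', (a, c) ∈ Metric.ball z₀ ε → (a, c') ∈ Metric.ball z₀ ε →
      f (s (a, c)) = f (s (a, c')) := by
    intro a c c' hc hc'
    -- Balls for the sup norm are products, so their slices in the second variable are balls. These
    -- are connected, and a vanishing derivative forces constancy.
    have hb : Metric.ball z₀ ε = Metric.ball z₀.1 ε ×ˢ Metric.ball z₀.2 ε :=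
      (ball_prod_same z₀.1 z₀.2 ε).symm
    rw [hb] at hc hc'
    have hd : ∀ c ∈ Metric.ball z₀.2 ε, HasFDerivAt (fun c => f (s (a, c)))
        (0 : EuclideanSpace ℝ (Fin (Module.finrank ℝ E - r)) →L[ℝ] F) c := by
      intro d hd
      have hz : (a, d) ∈ T := hball (by rw [hb]; exact ⟨hc.1, hd⟩)
      have := (hfs _ hz).comp d (hasFDerivAt_prodMk_right a d)
      have e0 : ((D (s (a, d))).comp (S (a, d))).comp (ContinuousLinearMap.inr ℝ
          (EuclideanSpace ℝ (Fin r)) (EuclideanSpace ℝ (Fin (Module.finrank ℝ E - r)))) = 0 :=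
        ContinuousLinearMap.ext fun c => hker _ hz c
      rw [← e0]
      exact this
    refine Metric.isOpen_ball.is_const_of_fderiv_eq_zero (𝕜 := ℝ)
      (convex_ball z₀.2 ε).isPreconnected
      (fun d hd' => (hd d hd').differentiableAt.differentiableWithinAt)
      (fun d hd' => (hd d hd').fderiv) hc.2 hc'.2
  refine ⟨P ∘ f, φ.source ∩ (fun x => L (I (φ x))) ⁻¹' Metric.ball z₀ ε, ?_, ⟨h2, ?_⟩,
    hh.mono fun x hx => h3 hx.1, ?_, ?_⟩
  · exact (L.continuous.comp_continuousOn
      (I.continuous.comp_continuousOn φ.continuousOn)).isOpen_inter_preimage φ.open_source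
      Metric.isOpen_ball
  · exact Metric.mem_ball_self hε
  · intro x hx
    rw [(hhD x (h3 hx.1)).mfderiv]
    obtain ⟨h5, h6⟩ := hsφ x hx.1
    have := hsurj _ h5
    rwa [h6] at this
  · intro x hx y hy
    refine ⟨fun e => by simp [e], fun e => ?_⟩
    obtain ⟨h5, h6⟩ := hsφ x hx.1
    obtain ⟨h7, h8⟩ := hsφ y hy.1
    have e1 : (L (I (φ x))).1 = (L (I (φ y))).1 := by rw [h4 x hx.1, h4 y hy.1, e]
    have := hconst (L (I (φ x))).1 (L (I (φ x))).2 (L (I (φ y))).2 hx.2 (by rw [e1]; exact hy.2)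
    rw [e1, Prod.mk.eta, h8, ← e1, Prod.mk.eta, h6] at this
    exact this

end ConstantRank

/-! ### Smoothness of `Ad`, coadjoint orbits and their cosets -/

section Adjoint

variable {𝔤 : Type*} [NormedAddCommGroup 𝔤] [NormedSpace ℝ 𝔤]
  {G : Type*} [TopologicalSpace G] [ChartedSpace 𝔤 G] [Group G] [LieGroup 𝓘(ℝ, 𝔤) ∞ G]

/-- The derivative of a smooth family is smooth when read in tangent coordinates. All conjugations
fix the identity, so the coordinate changes involved are derivatives of a chart at its own base
point, that is, identities, and the coordinate expression is `Ad` itself. -/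
theorem contMDiff_Ad : ContMDiff 𝓘(ℝ, 𝔤) 𝓘(ℝ, 𝔤 →L[ℝ] 𝔤) ∞ (fun g : G => (Ad g : 𝔤 →L[ℝ] 𝔤)) := by
  intro g₀
  have hf : ContMDiff (𝓘(ℝ, 𝔤).prod 𝓘(ℝ, 𝔤)) 𝓘(ℝ, 𝔤) ∞
      (Function.uncurry fun (g h : G) => g * h * g⁻¹) :=
    (contMDiff_fst.mul contMDiff_snd).mul contMDiff_fst.inv
  have := ContMDiffAt.mfderiv (fun (g h : G) => g * h * g⁻¹) (fun _ => (1 : G)) (m := ∞) (x₀ := g₀)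
    hf.contMDiffAt contMDiffAt_const (by simp)
  refine this.congr_of_eventuallyEq (Eventually.of_forall fun g => ?_)
  have e : ∀ x y : G, y = 1 → x = 1 → (mfderiv 𝓘(ℝ, 𝔤) 𝓘(ℝ, 𝔤) (extChartAt 𝓘(ℝ, 𝔤) y) x :
      𝔤 →L[ℝ] 𝔤) = ContinuousLinearMap.id ℝ 𝔤 := by
    rintro _ _ rfl rfl
    exact mfderiv_extChartAt_self
  have e' : (mfderivWithin 𝓘(ℝ, 𝔤) 𝓘(ℝ, 𝔤) (extChartAt 𝓘(ℝ, 𝔤) (1 : G)).symm (range 𝓘(ℝ, 𝔤))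
      (extChartAt 𝓘(ℝ, 𝔤) (1 : G) 1) : 𝔤 →L[ℝ] 𝔤) = ContinuousLinearMap.id ℝ 𝔤 :=
    mfderivWithin_range_extChartAt_symm
  refine Eq.trans ?_ (inTangentCoordinates_eq_mfderiv_comp (I := 𝓘(ℝ, 𝔤)) (I' := 𝓘(ℝ, 𝔤))
    (f := fun _ : G => (1 : G)) (g := fun x : G => x * 1 * x⁻¹)
    (ϕ := fun x : G => mfderiv 𝓘(ℝ, 𝔤) 𝓘(ℝ, 𝔤) (fun h : G => x * h * x⁻¹) 1)
    (mem_chart_source 𝔤 (1 : G)) (by simp)).symm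
  have e1 := e (g * 1 * g⁻¹) (g₀ * 1 * g₀⁻¹) (by simp) (by simp)
  ext ξ
  exact ((DFunLike.congr_fun e1 _).trans
    (congrArg (Ad g : 𝔤 →L[ℝ] 𝔤) (DFunLike.congr_fun e' ξ))).symm

theorem contMDiff_coadjoint (μ : 𝔤 →L[ℝ] ℝ) :
    ContMDiff 𝓘(ℝ, 𝔤) 𝓘(ℝ, 𝔤 →L[ℝ] ℝ) ∞ (fun g : G => coadjoint g μ) :=
  (ContinuousLinearMap.compL ℝ 𝔤 𝔤 ℝ μ).contDiff.contMDiff.comp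
    (contMDiff_Ad.comp (contMDiff_inv 𝓘(ℝ, 𝔤) ∞))

theorem coadjoint_mul (g h : G) (μ : 𝔤 →L[ℝ] ℝ) :
    coadjoint (g * h) μ = coadjoint g (coadjoint h μ) := by
  rw [coadjoint, mul_inv_rev, Ad_mul]
  rfl

theorem mem_isotropy {μ : 𝔤 →L[ℝ] ℝ} {g : G} : g ∈ isotropy G μ ↔ coadjoint g μ = μ := Iff.rfl

theorem coadjoint_one (μ : 𝔤 →L[ℝ] ℝ) : coadjoint (1 : G) μ = μ :=
  mem_isotropy.1 (isotropy G μ).one_mem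

theorem coadjoint_eq_iff {μ : 𝔤 →L[ℝ] ℝ} {g h : G} :
    coadjoint g μ = coadjoint h μ ↔ g⁻¹ * h ∈ isotropy G μ := by
  rw [mem_isotropy, coadjoint_mul]
  constructor
  · intro e
    rw [← e, ← coadjoint_mul, inv_mul_cancel, coadjoint_one]
  · intro e
    conv_lhs => rw [← e]
    rw [← coadjoint_mul, mul_inv_cancel, coadjoint_one]

theorem isClosed_isotropy (μ : 𝔤 →L[ℝ] ℝ) : IsClosed (isotropy G μ : Set G) :=
  isClosed_singleton.preimage (contMDiff_coadjoint (G := G) μ).continuous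

/-- The dimension of the coadjoint orbit of `μ`. -/
def orbitDim (G : Type*) [TopologicalSpace G] [ChartedSpace 𝔤 G] [Group G]
    [LieGroup 𝓘(ℝ, 𝔤) ∞ G] (μ : 𝔤 →L[ℝ] ℝ) : ℕ :=
  rankAt 𝓘(ℝ, 𝔤) (fun g : G => coadjoint g μ) 1

variable [FiniteDimensional ℝ 𝔤]

/-- The orbit map intertwines left translation by `g' g⁻¹` with a linear action on the dual, so its
derivative at `g` factors through its derivative at `g'`. Exchanging `g` and `g'` shows that the
rank is constant. -/
theorem rankAt_coadjoint_le (μ : 𝔤 →L[ℝ] ℝ) (g g' : G) :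
    rankAt 𝓘(ℝ, 𝔤) (fun g : G => coadjoint g μ) g ≤
      rankAt 𝓘(ℝ, 𝔤) (fun g : G => coadjoint g μ) g' := by
  let A : (𝔤 →L[ℝ] ℝ) →L[ℝ] (𝔤 →L[ℝ] ℝ) :=
    (ContinuousLinearMap.compL ℝ 𝔤 𝔤 ℝ).flip (Ad (g * g'⁻¹)⁻¹)
  let D : G → 𝔤 →L[ℝ] (𝔤 →L[ℝ] ℝ) := fun h =>
    mfderiv 𝓘(ℝ, 𝔤) 𝓘(ℝ, 𝔤 →L[ℝ] ℝ) (fun g : G => coadjoint g μ) h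
  let T : 𝔤 →L[ℝ] 𝔤 := mfderiv 𝓘(ℝ, 𝔤) 𝓘(ℝ, 𝔤) (fun h : G => (g' * g⁻¹) * h) g
  have hD : ∀ h : G, HasMFDerivAt 𝓘(ℝ, 𝔤) 𝓘(ℝ, 𝔤 →L[ℝ] ℝ) (fun g : G => coadjoint g μ) h (D h) :=
    fun h => ((contMDiff_coadjoint μ).mdifferentiableAt (by simp)).hasMFDerivAt
  have hT : HasMFDerivAt 𝓘(ℝ, 𝔤) 𝓘(ℝ, 𝔤) (fun h : G => (g' * g⁻¹) * h) g T :=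
    ((contMDiff_mul_left (I := 𝓘(ℝ, 𝔤)) (n := ∞) (a := g' * g⁻¹)).mdifferentiableAt
      (by simp)).hasMFDerivAt
  have h1 : HasMFDerivAt 𝓘(ℝ, 𝔤) 𝓘(ℝ, 𝔤 →L[ℝ] ℝ) (fun g : G => coadjoint g μ)
      ((g' * g⁻¹) * g) (D g') := by
    rw [inv_mul_cancel_right]; exact hD g'
  have h2 := (A.hasMFDerivAt (x := coadjoint ((g' * g⁻¹) * g) μ)).comp g (h1.comp g hT)
  have h3 : A ∘ (fun g : G => coadjoint g μ) ∘ (fun h : G => (g' * g⁻¹) * h) =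
      fun g : G => coadjoint g μ := by
    ext1 h
    change coadjoint (g * g'⁻¹) (coadjoint ((g' * g⁻¹) * h) μ) = coadjoint h μ
    rw [← coadjoint_mul]
    congr 1
    group
  rw [h3] at h2
  have h4 : D g = A.comp ((D g').comp T) := hasMFDerivAt_unique (hD g) h2
  change Module.finrank ℝ (LinearMap.range (D g).toLinearMap) ≤
    Module.finrank ℝ (LinearMap.range (D g').toLinearMap)
  rw [h4]
  have h5 : LinearMap.range (A.comp ((D g').comp T)).toLinearMap ≤
      (LinearMap.range (D g').toLinearMap).map A.toLinearMap := by
    rintro _ ⟨v, rfl⟩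
    exact ⟨D g' (T v), ⟨T v, rfl⟩, rfl⟩
  exact (Submodule.finrank_mono h5).trans (Submodule.finrank_map_le _ _)

/-- Near every point of `G` there is a submersion whose fibres are the cosets `g G_μ`. -/
theorem exists_coadjoint_slice (μ : 𝔤 →L[ℝ] ℝ) (g₀ : G) :
    ∃ (κ : G → EuclideanSpace ℝ (Fin (orbitDim G μ))) (N : Set G), IsOpen N ∧ g₀ ∈ N ∧
      ContMDiffOn 𝓘(ℝ, 𝔤) 𝓘(ℝ, EuclideanSpace ℝ (Fin (orbitDim G μ))) ∞ κ N ∧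
      (∀ x ∈ N, Function.Surjective
        (mfderiv 𝓘(ℝ, 𝔤) 𝓘(ℝ, EuclideanSpace ℝ (Fin (orbitDim G μ))) κ x)) ∧
      (∀ x ∈ N, ∀ y ∈ N, x⁻¹ * y ∈ isotropy G μ ↔ κ x = κ y) := by
  obtain ⟨κ, N, h1, h2, h3, h4, h5⟩ := exists_submersion_of_constant_rank isOpen_univ
    (mem_univ g₀) (contMDiff_coadjoint (G := G) μ).contMDiffOn
    (le_antisymm (rankAt_coadjoint_le μ g₀ 1) (rankAt_coadjoint_le μ 1 g₀))
    (fun x _ => rankAt_coadjoint_le μ x 1)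
  exact ⟨κ, N, h1, h2, h3, h4, fun x hx y hy => coadjoint_eq_iff.symm.trans (h5 x hx y hy)⟩

end Adjoint

end

/-! ### Local trivializations of a free proper action -/

section

section LocalTriv

variable {E : Type*} [NormedAddCommGroup E] [NormedSpace ℝ E]
  {Q : Type*} [TopologicalSpace Q] [ChartedSpace E Q]
  {𝔤 : Type*} [NormedAddCommGroup 𝔤] [NormedSpace ℝ 𝔤]
  {G : Type*} [TopologicalSpace G] [ChartedSpace 𝔤 G] [Group G]
  [MulAction Gᵐᵒᵖ Q]

section
variable {Q G : Type*} [Group G] [MulAction Gᵐᵒᵖ Q]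

theorem R_R (g h : G) (q : Q) : R Q h (R Q g q) = R Q (g * h) q := by
  simp [R, mul_smul]

theorem R_one (q : Q) : R Q (1 : G) q = q := by simp [R]

theorem R_inv_R (g : G) (q : Q) : R Q g⁻¹ (R Q g q) = q := by
  rw [R_R, mul_inv_cancel, R_one]

theorem R_R_inv (g : G) (q : Q) : R Q g (R Q g⁻¹ q) = q := by
  rw [R_R, inv_mul_cancel, R_one]

end

/-- The map `(g, q) ↦ (qg, q)` is closed by properness. The image of the pairs with `g` outside `N`
is thus closed, and by freeness it misses `(q₀, q₀)`; a product neighbourhood of that point avoiding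
it gives `O`. -/
theorem exists_open_forall_mem_of_properSMul [ProperSMul Gᵐᵒᵖ Q] [ContinuousMul G]
    (hfree : ∀ (q : Q) (g : G), R Q g q = q → g = 1) (q₀ : Q) {N : Set G} (hN : IsOpen N)
    (h1 : (1 : G) ∈ N) :
    ∃ O : Set Q, IsOpen O ∧ q₀ ∈ O ∧ ∀ q g, q ∈ O → R Q g q ∈ O → g ∈ N := by
  let C : Set (Gᵐᵒᵖ × Q) := {z | z.1.unop ∉ N}
  have hC : IsClosed C :=
    (hN.preimage (MulOpposite.continuous_unop.comp continuous_fst)).isClosed_compl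
  have hcl := (ProperSMul.isProperMap_smul_pair (G := Gᵐᵒᵖ) (X := Q)).isClosedMap C hC
  have hq : (q₀, q₀) ∈ ((fun z : Gᵐᵒᵖ × Q => (z.1 • z.2, z.2)) '' C)ᶜ := by
    rintro ⟨⟨g, q⟩, hg, e⟩
    obtain ⟨e1, rfl⟩ := Prod.mk.inj e
    apply hg
    have : g.unop = 1 := hfree q g.unop e1
    change g.unop ∈ N
    rwa [this]
  obtain ⟨O₁, O₂, ho1, ho2, hq1, hq2, hO⟩ := isOpen_prod_iff.1 hcl.isOpen_compl q₀ q₀ hq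
  refine ⟨O₁ ∩ O₂, ho1.inter ho2, ⟨hq1, hq2⟩, fun q g hq hg => ?_⟩
  by_contra hgN
  exact hO (⟨hg.1, hq.2⟩ : (R Q g q, q) ∈ O₁ ×ˢ O₂) ⟨(MulOpposite.op g, q), hgN, rfl⟩

/-- A local trivialization of `Q → Q/G` over an open set of `Q/G` which is diffeomorphic to an open
set of `ℝ^b`: the base coordinate `u` and the group coordinate `τ`. -/
structure LocalTriv (E Q 𝔤 G : Type*) [NormedAddCommGroup E] [NormedSpace ℝ E]
    [TopologicalSpace Q] [ChartedSpace E Q] [NormedAddCommGroup 𝔤] [NormedSpace ℝ 𝔤]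
    [TopologicalSpace G] [ChartedSpace 𝔤 G] [Group G] [MulAction Gᵐᵒᵖ Q] (b : ℕ) where
  /-- the domain in `Q` -/
  dom : Set Q
  /-- the base coordinate -/
  u : Q → EuclideanSpace ℝ (Fin b)
  /-- the group coordinate -/
  τ : Q → G
  isOpen_dom : IsOpen dom
  R_mem : ∀ q ∈ dom, ∀ g : G, R Q g q ∈ dom
  contMDiffOn_u : ContMDiffOn 𝓘(ℝ, E) 𝓘(ℝ, EuclideanSpace ℝ (Fin b)) ∞ u dom
  contMDiffOn_τ : ContMDiffOn 𝓘(ℝ, E) 𝓘(ℝ, 𝔤) ∞ τ dom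
  u_R : ∀ q ∈ dom, ∀ g : G, u (R Q g q) = u q
  τ_R : ∀ q ∈ dom, ∀ g : G, τ (R Q g q) = τ q * g
  exists_R : ∀ q ∈ dom, ∀ q' ∈ dom, u q = u q' → ∃ g : G, R Q g q = q'
  surjective : ∀ q ∈ dom, ∀ (α : EuclideanSpace ℝ (Fin b)) (ξ : 𝔤), ∃ v : E,
    (mfderiv 𝓘(ℝ, E) 𝓘(ℝ, EuclideanSpace ℝ (Fin b)) u q : E →L[ℝ] EuclideanSpace ℝ (Fin b)) v = α ∧
    (mfderiv 𝓘(ℝ, E) 𝓘(ℝ, 𝔤) τ q : E →L[ℝ] 𝔤) v = ξ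

variable [FiniteDimensional ℝ E] [FiniteDimensional ℝ 𝔤] [IsManifold 𝓘(ℝ, E) ∞ Q]

/-- In a chart at `q₀`, `s` is an affine slice along a complement of the tangent space to the orbit.
The derivative of `(a, g) ↦ s(a)g` at `(0, 1)` is the sum of the inclusion of this complement and
the infinitesimal action, hence injective, and the dimensions agree. -/
theorem exists_transversal (hact : IsSmoothRightAction E Q 𝔤 G) {b : ℕ}
    (hb : b + Module.finrank ℝ 𝔤 = Module.finrank ℝ E) (q₀ : Q)
    (hσ : Function.Injective (infinitesimalAction E G q₀ : 𝔤 → _)) :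
    ∃ (s : EuclideanSpace ℝ (Fin b) → Q) (V : Set (EuclideanSpace ℝ (Fin b))), IsOpen V ∧ 0 ∈ V ∧
      s 0 = q₀ ∧ ContMDiffOn 𝓘(ℝ, EuclideanSpace ℝ (Fin b)) 𝓘(ℝ, E) ∞ s V ∧
      Function.Bijective (mfderiv (𝓘(ℝ, EuclideanSpace ℝ (Fin b)).prod 𝓘(ℝ, 𝔤)) 𝓘(ℝ, E)
        (fun z : EuclideanSpace ℝ (Fin b) × G => R Q z.2 (s z.1)) (0, 1)) := by
  let σ : 𝔤 →L[ℝ] E := mfderiv 𝓘(ℝ, 𝔤) 𝓘(ℝ, E) (fun g : G => R Q g q₀) (1 : G)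
  have hσ' : Function.Injective σ := hσ
  obtain ⟨C, hC⟩ := Submodule.exists_isCompl (LinearMap.range σ.toLinearMap)
  have hrank : Module.finrank ℝ (LinearMap.range σ.toLinearMap) = Module.finrank ℝ 𝔤 :=
    LinearMap.finrank_range_of_inj hσ'
  have hCdim : Module.finrank ℝ (EuclideanSpace ℝ (Fin b)) = Module.finrank ℝ C := by
    have := Submodule.finrank_add_eq_of_isCompl hC
    rw [finrank_euclideanSpace_fin]
    omega
  let l : EuclideanSpace ℝ (Fin b) ≃ₗ[ℝ] C := LinearEquiv.ofFinrankEq _ _ hCdim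
  let j : EuclideanSpace ℝ (Fin b) →L[ℝ] E := (C.subtype ∘ₗ l.toLinearMap).toContinuousLinearMap
  let φ := extChartAt 𝓘(ℝ, E) q₀
  let s : EuclideanSpace ℝ (Fin b) → Q := fun a => φ.symm (φ q₀ + j a)
  have hVt : IsOpen φ.target := isOpen_extChartAt_target q₀
  let V : Set (EuclideanSpace ℝ (Fin b)) := (fun a => φ q₀ + j a) ⁻¹' φ.target
  have hV : IsOpen V := hVt.preimage (continuous_const.add j.continuous)
  have h0 : (0 : EuclideanSpace ℝ (Fin b)) ∈ V := by
    change φ q₀ + j 0 ∈ φ.target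
    rw [map_zero, add_zero]
    exact mem_extChartAt_target q₀
  have hs0 : s 0 = q₀ := by
    simp only [s, map_zero, add_zero]
    exact extChartAt_to_inv q₀
  have hs : ContMDiffOn 𝓘(ℝ, EuclideanSpace ℝ (Fin b)) 𝓘(ℝ, E) ∞ s V :=
    (contMDiffOn_extChartAt_symm q₀).comp
      (contDiff_const.add j.contDiff).contMDiff.contMDiffOn fun a ha => ha
  let m : EuclideanSpace ℝ (Fin b) × G → Q := fun z => R Q z.2 (s z.1)
  have hsd : HasMFDerivAt 𝓘(ℝ, EuclideanSpace ℝ (Fin b)) 𝓘(ℝ, E) s 0 j := by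
    have h1 : HasMFDerivAt 𝓘(ℝ, EuclideanSpace ℝ (Fin b)) 𝓘(ℝ, E) (fun a => φ q₀ + j a) 0 j :=
      (j.hasFDerivAt.const_add (φ q₀)).hasMFDerivAt
    have h2 : HasMFDerivAt 𝓘(ℝ, E) 𝓘(ℝ, E) φ.symm (φ q₀ + j 0) (ContinuousLinearMap.id ℝ E) := by
      rw [map_zero, add_zero]
      have h3 : MDifferentiableAt 𝓘(ℝ, E) 𝓘(ℝ, E) φ.symm (φ q₀) :=
        ((contMDiffOn_extChartAt_symm q₀).contMDiffAt
          (hVt.mem_nhds (mem_extChartAt_target q₀))).mdifferentiableAt (n := ∞) (by simp)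
      have h4 := mfderivWithin_range_extChartAt_symm (I := 𝓘(ℝ, E)) (x := q₀)
      rw [ModelWithCorners.range_eq_univ, mfderivWithin_univ] at h4
      have h5 := h3.hasMFDerivAt
      rw [h4] at h5
      exact h5
    exact h2.comp 0 h1
  have hsA : ContMDiffAt (𝓘(ℝ, EuclideanSpace ℝ (Fin b)).prod 𝓘(ℝ, 𝔤)) 𝓘(ℝ, E) ∞ m (0, 1) := by
    refine ContMDiffAt.comp (I' := 𝓘(ℝ, E).prod 𝓘(ℝ, 𝔤)) (g := fun p : Q × G => R Q p.2 p.1)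
      (f := fun z : EuclideanSpace ℝ (Fin b) × G => (s z.1, z.2)) (0, 1) hact.contMDiffAt ?_
    have h1 : ContMDiffAt (𝓘(ℝ, EuclideanSpace ℝ (Fin b)).prod 𝓘(ℝ, 𝔤)) 𝓘(ℝ, E) ∞
        (s ∘ (Prod.fst : EuclideanSpace ℝ (Fin b) × G → _)) (0, 1) :=
      ContMDiffAt.comp (0, (1 : G)) (hs.contMDiffAt (hV.mem_nhds h0)) contMDiffAt_fst
    exact h1.prodMk contMDiffAt_snd
  let D : EuclideanSpace ℝ (Fin b) × 𝔤 →L[ℝ] E :=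
    mfderiv (𝓘(ℝ, EuclideanSpace ℝ (Fin b)).prod 𝓘(ℝ, 𝔤)) 𝓘(ℝ, E) m (0, 1)
  have hD : HasMFDerivAt (𝓘(ℝ, EuclideanSpace ℝ (Fin b)).prod 𝓘(ℝ, 𝔤)) 𝓘(ℝ, E) m (0, 1) D :=
    (hsA.mdifferentiableAt (by simp)).hasMFDerivAt
  have hD1 : ∀ α, D (α, 0) = j α := by
    intro α
    have h1 : HasMFDerivAt 𝓘(ℝ, EuclideanSpace ℝ (Fin b))
        (𝓘(ℝ, EuclideanSpace ℝ (Fin b)).prod 𝓘(ℝ, 𝔤))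
        (fun a : EuclideanSpace ℝ (Fin b) => (a, (1 : G))) 0
        ((ContinuousLinearMap.id ℝ _).prod 0) :=
      (hasMFDerivAt_id (I := 𝓘(ℝ, EuclideanSpace ℝ (Fin b)))
        (0 : EuclideanSpace ℝ (Fin b))).prodMk (hasMFDerivAt_const (1 : G) _)
    have h2 := hD.comp 0 h1
    have h3 : m ∘ (fun a : EuclideanSpace ℝ (Fin b) => (a, (1 : G))) = s := by
      ext1 a
      exact R_one (s a)
    rw [h3] at h2
    exact DFunLike.congr_fun (hasMFDerivAt_unique h2 hsd) α
  have hD2 : ∀ ξ, D (0, ξ) = σ ξ := by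
    intro ξ
    have h1 : HasMFDerivAt 𝓘(ℝ, 𝔤)
        (𝓘(ℝ, EuclideanSpace ℝ (Fin b)).prod 𝓘(ℝ, 𝔤))
        (fun g : G => ((0 : EuclideanSpace ℝ (Fin b)), g)) 1
        ((0 : 𝔤 →L[ℝ] _).prod (ContinuousLinearMap.id ℝ 𝔤)) :=
      (hasMFDerivAt_const (0 : EuclideanSpace ℝ (Fin b)) _).prodMk
        (hasMFDerivAt_id (I := 𝓘(ℝ, 𝔤)) (1 : G))
    have h2 := hD.comp 1 h1
    have h3 : m ∘ (fun g : G => ((0 : EuclideanSpace ℝ (Fin b)), g)) = fun g => R Q g q₀ := by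
      ext1 g
      change R Q g (s 0) = R Q g q₀
      rw [hs0]
    rw [h3] at h2
    exact (DFunLike.congr_fun h2.mfderiv ξ).symm
  refine ⟨s, V, hV, h0, hs0, hs, ?_⟩
  have hinj : Function.Injective D := by
    refine (injective_iff_map_eq_zero D).2 ?_
    rintro ⟨α, ξ⟩ h
    have h1 : D (α, ξ) = j α + σ ξ := by
      rw [← hD1, ← hD2, ← map_add]; simp
    rw [h1] at h
    have h2 : j α ∈ C := (l α).2
    have h3 : σ (-ξ) ∈ LinearMap.range σ.toLinearMap := ⟨-ξ, rfl⟩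
    have h4 : j α = σ (-ξ) := by rw [map_neg]; exact eq_neg_of_add_eq_zero_left h
    have h5 : j α = 0 := by
      have : j α ∈ LinearMap.range σ.toLinearMap ⊓ C := ⟨h4 ▸ h3, h2⟩
      rwa [hC.inf_eq_bot, Submodule.mem_bot] at this
    have h6 : l α = 0 := Subtype.ext h5
    have h7 : α = 0 := (map_eq_zero_iff l l.injective).1 h6
    rw [h5] at h4
    have h8 : -ξ = 0 := hσ' (by rw [← h4, map_zero])
    rw [h7, neg_eq_zero.1 h8]
    rfl
  have hfin : Module.finrank ℝ (EuclideanSpace ℝ (Fin b) × 𝔤) = Module.finrank ℝ E := by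
    rw [Module.finrank_prod, finrank_euclideanSpace_fin, hb]
  exact ⟨hinj, (LinearMap.injective_iff_surjective_of_finrank_eq_finrank
    (f := D.toLinearMap) hfin).1 hinj⟩

/-- The coordinates `(u, τ)` are the inverse of `(a, g) ↦ s(a)g`. This map is a local diffeomorphism
near `(0, 1)`. Equivariance extends this to all `g`, and properness with freeness makes it injective
on `V × G` for small `V`. -/
theorem exists_localTriv [LieGroup 𝓘(ℝ, 𝔤) ∞ G] [ProperSMul Gᵐᵒᵖ Q]
    (hact : IsSmoothRightAction E Q 𝔤 G)
    (hfree : ∀ (q : Q) (g : G), R Q g q = q → g = 1) {b : ℕ}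
    (hb : b + Module.finrank ℝ 𝔤 = Module.finrank ℝ E) (q₀ : Q)
    (hσ : Function.Injective (infinitesimalAction E G q₀ : 𝔤 → _)) :
    ∃ T : LocalTriv E Q 𝔤 G b, q₀ ∈ T.dom := by
  have : ContinuousMul G := (topologicalGroup_of_lieGroup 𝓘(ℝ, 𝔤) ∞).toContinuousMul
  obtain ⟨s, V₀, hV₀, h0, hs0, hs, hbij⟩ := exists_transversal hact hb q₀ hσ
  let A := EuclideanSpace ℝ (Fin b)
  let m : A × G → Q := fun z => R Q z.2 (s z.1)
  have hm : ContMDiffOn (𝓘(ℝ, A).prod 𝓘(ℝ, 𝔤)) 𝓘(ℝ, E) ∞ m (V₀ ×ˢ univ) := by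
    refine ContMDiff.comp_contMDiffOn (I' := 𝓘(ℝ, E).prod 𝓘(ℝ, 𝔤))
      (g := fun p : Q × G => R Q p.2 p.1) (f := fun z : A × G => (s z.1, z.2)) hact ?_
    exact (hs.comp contMDiffOn_fst fun z hz => hz.1).prodMk contMDiffOn_snd
  have hCE : CompleteSpace E := FiniteDimensional.complete ℝ E
  have hC𝔤 : CompleteSpace 𝔤 := FiniteDimensional.complete ℝ 𝔤
  obtain ⟨Γ, hΓ0, hΓs, hΓm, hΓ1, hΓ2⟩ := exists_openPartialHomeomorph_of_bijective_mfderiv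
    (I := 𝓘(ℝ, A).prod 𝓘(ℝ, 𝔤)) (hV₀.prod isOpen_univ) (mem_prod.2 ⟨h0, mem_univ (1 : G)⟩)
    hm hbij
  obtain ⟨V₁, N, hV₁, hN, h01, h1N, hVN⟩ := isOpen_prod_iff.1 Γ.open_source 0 1 hΓ0
  obtain ⟨O, hO, hqO, hON⟩ := exists_open_forall_mem_of_properSMul hfree q₀ hN h1N
  let V : Set A := V₁ ∩ (V₀ ∩ s ⁻¹' O)
  have hV : IsOpen V := hV₁.inter (hs.continuousOn.isOpen_inter_preimage hV₀ hO)
  have h0V : (0 : A) ∈ V := ⟨h01, h0, by rw [mem_preimage, hs0]; exact hqO⟩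
  -- If `s(a)g = s(a')g'`, then `g g'⁻¹` carries one point of `O` to another and so lies in `N`. The
  -- points `(a, g g'⁻¹)` and `(a', 1)` are then in the source of `Γ`, where the map is injective.
  have hinj : InjOn m (V ×ˢ univ) := by
    rintro ⟨a, g⟩ ⟨ha, -⟩ ⟨a', g'⟩ ⟨ha', -⟩ e
    have e1 : R Q (g * g'⁻¹) (s a) = s a' := by
      have e' : R Q g (s a) = R Q g' (s a') := e
      rw [← R_R, e', R_inv_R]
    have h1 : g * g'⁻¹ ∈ N := hON (s a) _ ha.2.2 (by rw [e1]; exact ha'.2.2)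
    have h2 : (a, g * g'⁻¹) ∈ Γ.source := hVN ⟨ha.1, h1⟩
    have h3 : (a', (1 : G)) ∈ Γ.source := hVN ⟨ha'.1, h1N⟩
    have h4 := Γ.injOn h2 h3 (by
      rw [hΓm h2, hΓm h3]
      change R Q (g * g'⁻¹) (s a) = R Q 1 (s a')
      rw [e1, R_one])
    obtain ⟨rfl, h5⟩ := Prod.mk.inj h4
    rw [mul_inv_eq_one.1 h5]
  let inv : Q → A × G := Function.invFunOn m (V ×ˢ univ)
  have hinv : ∀ a ∈ V, ∀ g : G, inv (R Q g (s a)) = (a, g) := fun a ha g =>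
    hinj.leftInvOn_invFunOn (⟨ha, mem_univ g⟩ : (a, g) ∈ V ×ˢ univ)
  -- Near `s(a)g` the inverse is obtained by translating by `g⁻¹`, applying `Γ.symm` near `s(a)`,
  -- and multiplying the group component by `g`.
  have hloc : ∀ a ∈ V, ∀ g : G, ContMDiffAt 𝓘(ℝ, E) (𝓘(ℝ, A).prod 𝓘(ℝ, 𝔤)) ∞ inv (R Q g (s a)) ∧
      m '' (V ×ˢ univ) ∈ 𝓝 (R Q g (s a)) := by
    intro a ha g
    have h1 : (a, (1 : G)) ∈ Γ.source := hVN ⟨ha.1, h1N⟩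
    have h2 : s a ∈ Γ.target := by
      have := Γ.map_source h1
      rw [hΓm h1] at this
      rwa [← R_one (G := G) (s a)]
    have h3 : Γ.symm (s a) = (a, 1) := by
      have : Γ (a, 1) = s a := (hΓm h1).trans (R_one (s a))
      rw [← this, Γ.left_inv h1]
    let y : Q → Q := R Q g⁻¹
    have hy : ContMDiff 𝓘(ℝ, E) 𝓘(ℝ, E) ∞ y := hact.contMDiff_R g⁻¹
    have hya : y (R Q g (s a)) = s a := R_inv_R g (s a)
    have hy2 : ContMDiffAt 𝓘(ℝ, E) (𝓘(ℝ, A).prod 𝓘(ℝ, 𝔤)) ∞ (Γ.symm ∘ y) (R Q g (s a)) := by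
      refine ContMDiffAt.comp _ (hΓ2.contMDiffAt (Γ.open_target.mem_nhds ?_)) hy.contMDiffAt
      rw [hya]; exact h2
    have ht : ∀ᶠ x in 𝓝 (R Q g (s a)), y x ∈ Γ.target :=
      hy.continuous.continuousAt.eventually_mem (Γ.open_target.mem_nhds (by rw [hya]; exact h2))
    have hVx : ∀ᶠ x in 𝓝 (R Q g (s a)), Γ.symm (y x) ∈ V ×ˢ (univ : Set G) :=
      hy2.continuousAt.eventually_mem ((hV.prod isOpen_univ).mem_nhds (by
        simp only [Function.comp, hya, h3]; exact ⟨ha, trivial⟩))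
    have hx : ∀ᶠ x in 𝓝 (R Q g (s a)),
        R Q ((Γ.symm (y x)).2 * g) (s (Γ.symm (y x)).1) = x := by
      filter_upwards [ht] with x hx
      have e1 : m (Γ.symm (y x)) = y x := by
        rw [← hΓm (Γ.map_target hx), Γ.right_inv hx]
      have e2 : R Q (Γ.symm (y x)).2 (s (Γ.symm (y x)).1) = R Q g⁻¹ x := e1
      rw [← R_R, e2, R_R_inv]
    refine ⟨?_, ?_⟩
    · have : ContMDiffAt 𝓘(ℝ, E) (𝓘(ℝ, A).prod 𝓘(ℝ, 𝔤)) ∞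
          (fun x => ((Γ.symm (y x)).1, (Γ.symm (y x)).2 * g)) (R Q g (s a)) :=
        hy2.fst.prodMk (hy2.snd.mul contMDiffAt_const)
      refine this.congr_of_eventuallyEq ?_
      filter_upwards [hVx, hx] with x h4 h5
      rw [← hinv _ h4.1 ((Γ.symm (y x)).2 * g), h5]
    · filter_upwards [hVx, hx] with x h4 h5
      exact ⟨((Γ.symm (y x)).1, (Γ.symm (y x)).2 * g), ⟨h4.1, trivial⟩, h5⟩
  have hMD : ∀ a ∈ V, ∀ g : G, MDifferentiableAt (𝓘(ℝ, A).prod 𝓘(ℝ, 𝔤)) 𝓘(ℝ, E) m (a, g) :=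
    fun a ha g => (hm.contMDiffAt ((hV₀.prod isOpen_univ).mem_nhds ⟨ha.2.1, trivial⟩)
      ).mdifferentiableAt (by simp)
  refine ⟨⟨m '' (V ×ˢ univ), fun q => (inv q).1, fun q => (inv q).2,
    ?_, ?_, ?_, ?_, ?_, ?_, ?_, ?_⟩,
    ⟨(0, 1), ⟨h0V, trivial⟩, ?_⟩⟩
  · rw [isOpen_iff_mem_nhds]
    rintro _ ⟨⟨a, g⟩, ⟨ha, -⟩, rfl⟩
    exact (hloc a ha g).2
  · rintro _ ⟨⟨a, g⟩, ⟨ha, -⟩, rfl⟩ g'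
    exact ⟨(a, g * g'), ⟨ha, trivial⟩, (R_R g g' (s a)).symm⟩
  · rintro _ ⟨⟨a, g⟩, ⟨ha, -⟩, rfl⟩
    exact (hloc a ha g).1.fst.contMDiffWithinAt
  · rintro _ ⟨⟨a, g⟩, ⟨ha, -⟩, rfl⟩
    exact (hloc a ha g).1.snd.contMDiffWithinAt
  · rintro _ ⟨⟨a, g⟩, ⟨ha, -⟩, rfl⟩ g'
    change (inv (R Q g' (R Q g (s a)))).1 = (inv (R Q g (s a))).1
    rw [R_R, hinv a ha, hinv a ha]
  · rintro _ ⟨⟨a, g⟩, ⟨ha, -⟩, rfl⟩ g'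
    change (inv (R Q g' (R Q g (s a)))).2 = (inv (R Q g (s a))).2 * g'
    rw [R_R, hinv a ha, hinv a ha]
  · rintro _ ⟨⟨a, g⟩, ⟨ha, -⟩, rfl⟩ _ ⟨⟨a', g'⟩, ⟨ha', -⟩, rfl⟩ e
    have e1 : (inv (R Q g (s a))).1 = (inv (R Q g' (s a'))).1 := e
    rw [hinv a ha, hinv a' ha'] at e1
    have e2 : a = a' := e1
    refine ⟨g⁻¹ * g', ?_⟩
    change R Q (g⁻¹ * g') (R Q g (s a)) = R Q g' (s a')
    rw [R_R, mul_inv_cancel_left, e2]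
  · rintro _ ⟨⟨a, g⟩, ⟨ha, -⟩, rfl⟩ α ξ
    let Dm : A × 𝔤 →L[ℝ] E := mfderiv (𝓘(ℝ, A).prod 𝓘(ℝ, 𝔤)) 𝓘(ℝ, E) m (a, g)
    have hDm : HasMFDerivAt (𝓘(ℝ, A).prod 𝓘(ℝ, 𝔤)) 𝓘(ℝ, E) m (a, g) Dm :=
      (hMD a ha g).hasMFDerivAt
    have hnear : ∀ᶠ z in 𝓝 (a, g), inv (m z) = z := by
      filter_upwards [(hV.prod isOpen_univ).mem_nhds (⟨ha, trivial⟩ : (a, g) ∈ V ×ˢ univ)] with z hz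
      exact hinv z.1 hz.1 z.2
    refine ⟨Dm (α, ξ), ?_, ?_⟩
    · have h1 := ((hloc a ha g).1.fst.mdifferentiableAt (by simp)).hasMFDerivAt.comp (a, g) hDm
      have h2 : HasMFDerivAt (𝓘(ℝ, A).prod 𝓘(ℝ, 𝔤)) 𝓘(ℝ, A) (fun z : A × G => z.1) (a, g)
          (ContinuousLinearMap.fst ℝ A 𝔤) := hasMFDerivAt_fst (a, g)
      have h3 := h2.congr_of_eventuallyEq (f₁ := (fun q => (inv q).1) ∘ m)
        (hnear.mono fun z hz => by simp [hz])
      exact DFunLike.congr_fun (hasMFDerivAt_unique h1 h3) (α, ξ)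
    · have h1 := ((hloc a ha g).1.snd.mdifferentiableAt (by simp)).hasMFDerivAt.comp (a, g) hDm
      have h2 : HasMFDerivAt (𝓘(ℝ, A).prod 𝓘(ℝ, 𝔤)) 𝓘(ℝ, 𝔤) (fun z : A × G => z.2) (a, g)
          (ContinuousLinearMap.snd ℝ A 𝔤) := hasMFDerivAt_snd (a, g)
      have h3 := h2.congr_of_eventuallyEq (f₁ := (fun q => (inv q).2) ∘ m)
        (hnear.mono fun z hz => by simp [hz])
      exact DFunLike.congr_fun (hasMFDerivAt_unique h1 h3) (α, ξ)
  · change R Q 1 (s 0) = q₀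
    rw [R_one, hs0]

end LocalTriv

end

/-! ### Openness of the quotient maps and auxiliary facts on tangent bundles -/

section

/-- A map `γ` preserving the fibres and sending `m` into an open `U` sends a whole neighbourhood of
`m` into `U`, so the saturation of `U` is open. -/
theorem isOpenQuotientMap_of_continuous_of_fibres {M X : Type*} [TopologicalSpace M]
    [TopologicalSpace X] {p : M → X} (hp : IsQuotientMap p)
    (hγ : ∀ m m' : M, p m = p m' → ∃ γ : M → M, Continuous γ ∧ γ m = m' ∧ ∀ x, p (γ x) = p x) :
    IsOpenQuotientMap p := by
  refine ⟨hp.surjective, hp.continuous, fun U hU => ?_⟩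
  rw [← hp.isOpen_preimage, isOpen_iff_mem_nhds]
  rintro m ⟨m', hm', e⟩
  obtain ⟨γ, h1, h2, h3⟩ := hγ m m' e.symm
  filter_upwards [h1.continuousAt.preimage_mem_nhds (hU.mem_nhds (by rwa [h2]))] with x hx
  exact ⟨γ x, hx, h3 x⟩

section LinearAlgebra

variable {V A B : Type*} [AddCommGroup V] [AddCommGroup A] [AddCommGroup B] [Module ℝ V]
  [Module ℝ A] [Module ℝ B]

/-- A block triangular argument: hit the first component, then correct the second inside the kernel
of the first. It gives the submersion property for the slices on `Q × 𝔤` and `TQ`. -/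
theorem surjective_pair_of_triangular {L₁ : V →ₗ[ℝ] A} {L₂ : V →ₗ[ℝ] B}
    (h₁ : Function.Surjective L₁) (h₂ : ∀ β, ∃ v, L₁ v = 0 ∧ L₂ v = β) (α : A) (β : B) :
    ∃ v, L₁ v = α ∧ L₂ v = β := by
  obtain ⟨v, hv⟩ := h₁ α
  obtain ⟨w, hw, hw'⟩ := h₂ (β - L₂ v)
  exact ⟨v + w, by rw [map_add, hv, hw, add_zero], by rw [map_add, hw', add_sub_cancel]⟩

end LinearAlgebra

section TangentBundle

variable {E H M : Type*} [NormedAddCommGroup E] [NormedSpace ℝ E]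
  [TopologicalSpace M] [ChartedSpace E M] [IsManifold 𝓘(ℝ, E) ∞ M]

open Bundle in
-- The local section through `v` that is constant in the trivialization of `TM` is smooth, and its
-- derivative is a right inverse of the derivative of the projection.
theorem exists_mfderiv_tangentBundle_proj_eq (v : TangentBundle 𝓘(ℝ, E) M) (x : E) :
    ∃ w : E × E, (mfderiv 𝓘(ℝ, E).tangent 𝓘(ℝ, E)
      (TotalSpace.proj : TangentBundle 𝓘(ℝ, E) M → M) v : E × E →L[ℝ] E) w = x := by
  let e := trivializationAt E (TangentSpace 𝓘(ℝ, E)) v.proj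
  let s : ∀ q : M, TangentSpace 𝓘(ℝ, E) q := fun q => e.symm q (e v).2
  have hmem : v.proj ∈ e.baseSet := mem_baseSet_trivializationAt E _ v.proj
  have hs : ContMDiffAt 𝓘(ℝ, E) 𝓘(ℝ, E).tangent ∞
      (fun q => (⟨q, s q⟩ : TangentBundle 𝓘(ℝ, E) M)) v.proj := by
    rw [contMDiffAt_section]
    refine (contMDiffAt_const (c := (e v).2)).congr_of_eventuallyEq ?_
    filter_upwards [e.open_baseSet.mem_nhds hmem] with q hq
    have h : e ⟨q, s q⟩ = (q, (e v).2) := e.apply_mk_symm hq (e v).2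
    change (e ⟨q, s q⟩).2 = (e v).2
    rw [h]
  have hsv : (⟨v.proj, s v.proj⟩ : TangentBundle 𝓘(ℝ, E) M) = v := by
    have : s v.proj = v.snd := e.symm_apply_apply_mk hmem v.snd
    rw [this]
  let D : E →L[ℝ] E × E := mfderiv 𝓘(ℝ, E) 𝓘(ℝ, E).tangent
    (fun q => (⟨q, s q⟩ : TangentBundle 𝓘(ℝ, E) M)) v.proj
  have hD : HasMFDerivAt 𝓘(ℝ, E) 𝓘(ℝ, E).tangent
      (fun q => (⟨q, s q⟩ : TangentBundle 𝓘(ℝ, E) M)) v.proj D :=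
    (hs.mdifferentiableAt (by simp)).hasMFDerivAt
  let P : E × E →L[ℝ] E := mfderiv 𝓘(ℝ, E).tangent 𝓘(ℝ, E)
    (TotalSpace.proj : TangentBundle 𝓘(ℝ, E) M → M) v
  have hP : HasMFDerivAt 𝓘(ℝ, E).tangent 𝓘(ℝ, E)
      (TotalSpace.proj : TangentBundle 𝓘(ℝ, E) M → M) ⟨v.proj, s v.proj⟩ P := by
    rw [hsv]
    exact ((contMDiff_proj (TangentSpace 𝓘(ℝ, E)) (n := ∞)).mdifferentiableAt
      (by simp)).hasMFDerivAt
  have h := hP.comp v.proj hD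
  have h' : HasMFDerivAt 𝓘(ℝ, E) 𝓘(ℝ, E) (fun q : M => q) v.proj
    (ContinuousLinearMap.id ℝ E) := hasMFDerivAt_id v.proj
  exact ⟨D x, DFunLike.congr_fun (hasMFDerivAt_unique h h') x⟩

open Bundle in
theorem contMDiffAt_fibre_inclusion [FiniteDimensional ℝ E] (q : M) (w : E) :
    ContMDiffAt 𝓘(ℝ, E) 𝓘(ℝ, E).tangent ∞
      (fun w : E => (⟨q, w⟩ : TangentBundle 𝓘(ℝ, E) M)) w := by
  rw [contMDiffAt_totalSpace]
  refine ⟨contMDiffAt_const, ?_⟩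
  let l : E →L[ℝ] E :=
    (trivializationAt E (TangentSpace 𝓘(ℝ, E)) q).continuousLinearMapAt ℝ q
  have : ContMDiffAt 𝓘(ℝ, E) 𝓘(ℝ, E) ∞ l w := l.contDiff.contMDiff.contMDiffAt
  refine this.congr_of_eventuallyEq (Eventually.of_forall fun x => ?_)
  exact ((trivializationAt E (TangentSpace 𝓘(ℝ, E)) q).continuousLinearMapAt_apply_of_mem
    (R := ℝ) (mem_baseSet_trivializationAt E _ q) x).symm

end TangentBundle

namespace SliceFunction

variable {E H M X : Type*} [NormedAddCommGroup E] [NormedSpace ℝ E] [TopologicalSpace H]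
  [TopologicalSpace M] [ChartedSpace H M] {I : ModelWithCorners ℝ E H} {p : M → X}
  {F F' : Type*} [NormedAddCommGroup F] [NormedSpace ℝ F] [NormedAddCommGroup F']
  [NormedSpace ℝ F']

/-- Composition of a slice function with a linear isomorphism. -/
def postcomp (S : SliceFunction I p F) (l : F ≃L[ℝ] F') : SliceFunction I p F' where
  dom := S.dom
  fn := l ∘ S.fn
  pt := S.pt
  pt_mem := S.pt_mem
  isOpen_dom := S.isOpen_dom
  contMDiffOn := l.contDiff.contMDiff.comp_contMDiffOn S.contMDiffOn
  surjective m hm := by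
    let D : E →L[ℝ] F := mfderiv I 𝓘(ℝ, F) S.fn m
    have hD : HasMFDerivAt I 𝓘(ℝ, F) S.fn m D :=
      ((S.contMDiffOn.contMDiffAt (S.isOpen_dom.mem_nhds hm)).mdifferentiableAt
        (by simp)).hasMFDerivAt
    have h := ((l : F →L[ℝ] F').hasMFDerivAt (x := S.fn m)).comp m hD
    have hs : Function.Surjective ((l : F →L[ℝ] F').comp D) :=
      l.surjective.comp (S.surjective m hm)
    have e : mfderiv I 𝓘(ℝ, F') (l ∘ S.fn) m = (l : F →L[ℝ] F').comp D := h.mfderiv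
    rw [e]
    exact hs
  eq_iff m hm m' hm' := by
    rw [S.eq_iff m hm m' hm', Function.comp, Function.comp, l.injective.eq_iff]

end SliceFunction

section Quotients

variable {E : Type*} [NormedAddCommGroup E] [NormedSpace ℝ E]
  {Q : Type*} [TopologicalSpace Q] [ChartedSpace E Q]
  {𝔤 : Type*} [NormedAddCommGroup 𝔤] [NormedSpace ℝ 𝔤]
  {G : Type*} [TopologicalSpace G] [ChartedSpace 𝔤 G] [Group G]
  [MulAction Gᵐᵒᵖ Q]

section

variable {Q : Type*} [MulAction Gᵐᵒᵖ Q]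

theorem adjointMk_eq_iff [LieGroup 𝓘(ℝ, 𝔤) ∞ G] {a c : Q × 𝔤} :
    adjointMk Q 𝔤 G a = adjointMk Q 𝔤 G c ↔ ∃ g : G, (R Q g a.1, Ad g⁻¹ a.2) = c := by
  rw [adjointMk, adjointMk, Quotient.eq]
  rfl

variable {G : Type*} [Group G] [MulAction Gᵐᵒᵖ Q]

theorem proj_eq_iff {q q' : Q} : proj Q G q = proj Q G q' ↔ ∃ g : G, R Q g q = q' := by
  rw [eq_comm, proj, proj, Quotient.eq]
  constructor
  · rintro ⟨g, hg⟩
    exact ⟨g.unop, hg⟩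
  · rintro ⟨g, hg⟩
    exact ⟨MulOpposite.op g, hg⟩

theorem subProj_eq_iff {K : Subgroup G} {q q' : Q} :
    subProj Q K q = subProj Q K q' ↔ ∃ g ∈ K, R Q g q = q' := by
  rw [eq_comm, subProj, subProj, Quotient.eq]
  constructor
  · rintro ⟨g, hg⟩
    exact ⟨(g : Gᵐᵒᵖ).unop, g.2, hg⟩
  · rintro ⟨g, hgK, hg⟩
    exact ⟨⟨MulOpposite.op g, hgK⟩, hg⟩

end

theorem tangentProj_eq_iff {hact : IsSmoothRightAction E Q 𝔤 G} {K : Subgroup G}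
    {v w : TangentBundle 𝓘(ℝ, E) Q} : tangentProj hact K v = tangentProj hact K w ↔
      ∃ g ∈ K, tangentMap 𝓘(ℝ, E) 𝓘(ℝ, E) (R Q g) v = w := by
  rw [tangentProj, tangentProj, Quotient.eq]
  rfl

theorem exists_smooth_of_proj_eq (hact : IsSmoothRightAction E Q 𝔤 G) (q q' : Q)
    (h : proj Q G q = proj Q G q') : ∃ γ : Q → Q, ContMDiff 𝓘(ℝ, E) 𝓘(ℝ, E) ∞ γ ∧ γ q = q' ∧
      ∀ x, proj Q G (γ x) = proj Q G x := by
  obtain ⟨g, hg⟩ := proj_eq_iff.1 h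
  exact ⟨R Q g, hact.contMDiff_R g, hg, fun x => (proj_eq_iff.2 ⟨g, rfl⟩).symm⟩

theorem exists_smooth_of_subProj_eq (hact : IsSmoothRightAction E Q 𝔤 G) (K : Subgroup G)
    (q q' : Q) (h : subProj Q K q = subProj Q K q') :
    ∃ γ : Q → Q, ContMDiff 𝓘(ℝ, E) 𝓘(ℝ, E) ∞ γ ∧ γ q = q' ∧
      ∀ x, subProj Q K (γ x) = subProj Q K x := by
  obtain ⟨g, hgK, hg⟩ := subProj_eq_iff.1 h
  exact ⟨R Q g, hact.contMDiff_R g, hg, fun x => (subProj_eq_iff.2 ⟨g, hgK, rfl⟩).symm⟩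

theorem exists_smooth_of_tangentProj_eq [IsManifold 𝓘(ℝ, E) ∞ Q]
    (hact : IsSmoothRightAction E Q 𝔤 G) (K : Subgroup G)
    (v w : TangentBundle 𝓘(ℝ, E) Q) (h : tangentProj hact K v = tangentProj hact K w) :
    ∃ γ : TangentBundle 𝓘(ℝ, E) Q → TangentBundle 𝓘(ℝ, E) Q,
      ContMDiff 𝓘(ℝ, E).tangent 𝓘(ℝ, E).tangent ∞ γ ∧ γ v = w ∧
      ∀ x, tangentProj hact K (γ x) = tangentProj hact K x := by
  obtain ⟨g, hgK, hg⟩ := tangentProj_eq_iff.1 h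
  exact ⟨tangentMap 𝓘(ℝ, E) 𝓘(ℝ, E) (R Q g), (hact.contMDiff_R g).contMDiff_tangentMap (by simp),
    hg, fun x => (tangentProj_eq_iff.2 ⟨g, hgK, rfl⟩).symm⟩

theorem exists_smooth_of_adjointMk_eq [LieGroup 𝓘(ℝ, 𝔤) ∞ G]
    (hact : IsSmoothRightAction E Q 𝔤 G)
    (a c : Q × 𝔤) (h : adjointMk Q 𝔤 G a = adjointMk Q 𝔤 G c) :
    ∃ γ : Q × 𝔤 → Q × 𝔤, ContMDiff (𝓘(ℝ, E).prod 𝓘(ℝ, 𝔤)) (𝓘(ℝ, E).prod 𝓘(ℝ, 𝔤)) ∞ γ ∧ γ a = c ∧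
      ∀ x, adjointMk Q 𝔤 G (γ x) = adjointMk Q 𝔤 G x := by
  obtain ⟨g, hg⟩ := adjointMk_eq_iff.1 h
  exact ⟨fun a => (R Q g a.1, Ad g⁻¹ a.2),
    ((hact.contMDiff_R g).comp contMDiff_fst).prodMk
      ((Ad (𝔤 := 𝔤) g⁻¹).contDiff.contMDiff.comp contMDiff_snd), hg,
    fun x => (adjointMk_eq_iff.2 ⟨g, rfl⟩).symm⟩

theorem isOpenQuotientMap_proj (hact : IsSmoothRightAction E Q 𝔤 G) :
    IsOpenQuotientMap (proj Q G) :=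
  isOpenQuotientMap_of_continuous_of_fibres isQuotientMap_quotient_mk' fun q q' h =>
    (exists_smooth_of_proj_eq hact q q' h).imp fun _ hγ => ⟨hγ.1.continuous, hγ.2⟩

theorem isOpenQuotientMap_subProj (hact : IsSmoothRightAction E Q 𝔤 G) (K : Subgroup G) :
    IsOpenQuotientMap (subProj Q K) :=
  isOpenQuotientMap_of_continuous_of_fibres isQuotientMap_quotient_mk' fun q q' h =>
    (exists_smooth_of_subProj_eq hact K q q' h).imp fun _ hγ => ⟨hγ.1.continuous, hγ.2⟩

theorem isOpenQuotientMap_tangentProj [IsManifold 𝓘(ℝ, E) ∞ Q]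
    (hact : IsSmoothRightAction E Q 𝔤 G) (K : Subgroup G) :
    IsOpenQuotientMap (tangentProj hact K) :=
  isOpenQuotientMap_of_continuous_of_fibres isQuotientMap_quotient_mk' fun q q' h =>
    (exists_smooth_of_tangentProj_eq hact K q q' h).imp fun _ hγ => ⟨hγ.1.continuous, hγ.2⟩

theorem isOpenQuotientMap_adjointMk [LieGroup 𝓘(ℝ, 𝔤) ∞ G] (hact : IsSmoothRightAction E Q 𝔤 G) :
    IsOpenQuotientMap (adjointMk Q 𝔤 G) :=
  isOpenQuotientMap_of_continuous_of_fibres isQuotientMap_quotient_mk' fun q q' h =>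
    (exists_smooth_of_adjointMk_eq hact q q' h).imp fun _ hγ => ⟨hγ.1.continuous, hγ.2⟩

end Quotients

end

/-! ### Slice functions on `Q` and `Q × 𝔤` -/

section

/-- A submersion on an open subset of `G` whose fibres are those of `G → G/K`. -/
structure CosetSlice {𝔤 G : Type*} [NormedAddCommGroup 𝔤] [NormedSpace ℝ 𝔤] [TopologicalSpace G]
    [ChartedSpace 𝔤 G] [Group G] (K : Subgroup G) (r : ℕ) where
  /-- the domain -/
  dom : Set G
  /-- the function -/
  fn : G → EuclideanSpace ℝ (Fin r)
  isOpen_dom : IsOpen dom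
  contMDiffOn : ContMDiffOn 𝓘(ℝ, 𝔤) 𝓘(ℝ, EuclideanSpace ℝ (Fin r)) ∞ fn dom
  surjective : ∀ x ∈ dom,
    Function.Surjective (mfderiv 𝓘(ℝ, 𝔤) 𝓘(ℝ, EuclideanSpace ℝ (Fin r)) fn x)
  eq_iff : ∀ x ∈ dom, ∀ y ∈ dom, x⁻¹ * y ∈ K ↔ fn x = fn y

variable {E : Type*} [NormedAddCommGroup E] [NormedSpace ℝ E]
  {Q : Type*} [TopologicalSpace Q] [ChartedSpace E Q]
  {𝔤 : Type*} [NormedAddCommGroup 𝔤] [NormedSpace ℝ 𝔤]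
  {G : Type*} [TopologicalSpace G] [ChartedSpace 𝔤 G] [Group G]
  [MulAction Gᵐᵒᵖ Q] {b r : ℕ} {K : Subgroup G}

theorem IsSmoothRightAction.hasMFDerivAt_orbit (hact : IsSmoothRightAction E Q 𝔤 G) (q : Q) :
    HasMFDerivAt 𝓘(ℝ, 𝔤) 𝓘(ℝ, E) (fun g : G => R Q g q) 1
      (mfderiv 𝓘(ℝ, 𝔤) 𝓘(ℝ, E) (fun g : G => R Q g q) (1 : G)) := by
  have : ContMDiff 𝓘(ℝ, 𝔤) 𝓘(ℝ, E) ∞ (fun g : G => R Q g q) :=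
    ContMDiff.comp (g := fun p : Q × G => R Q p.2 p.1) (f := fun g : G => (q, g)) hact
      (contMDiff_const.prodMk contMDiff_id)
  exact (this.mdifferentiableAt (by simp)).hasMFDerivAt

theorem IsSmoothRightAction.hasMFDerivAt_R (hact : IsSmoothRightAction E Q 𝔤 G) (g : G) (q : Q) :
    HasMFDerivAt 𝓘(ℝ, E) 𝓘(ℝ, E) (R Q g) q (mfderiv 𝓘(ℝ, E) 𝓘(ℝ, E) (R Q g) q) :=
  ((hact.contMDiff_R g).mdifferentiableAt (by simp)).hasMFDerivAt

/-- The infinitesimal action as a linear map. -/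
def infinitesimalActionL (E : Type*) {Q 𝔤 : Type*} [NormedAddCommGroup E] [NormedSpace ℝ E]
    [TopologicalSpace Q] [ChartedSpace E Q] [NormedAddCommGroup 𝔤] [NormedSpace ℝ 𝔤]
    (G : Type*) [TopologicalSpace G] [ChartedSpace 𝔤 G] [Group G] [MulAction Gᵐᵒᵖ Q]
    (q : Q) : 𝔤 →L[ℝ] E :=
  mfderiv 𝓘(ℝ, 𝔤) 𝓘(ℝ, E) (fun g : G => R Q g q) (1 : G)

section Connection

variable [IsManifold 𝓘(ℝ, E) ∞ Q]

/-- The connection form at a point, as a linear map on the model space. -/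
def PrincipalConnection.formL (conn : PrincipalConnection E Q 𝔤 G) (q : Q) : E →L[ℝ] 𝔤 :=
  conn.form q

theorem PrincipalConnection.formL_infinitesimalActionL (conn : PrincipalConnection E Q 𝔤 G)
    (q : Q) (ξ : 𝔤) :
    conn.formL q (infinitesimalActionL E G q ξ) = ξ := conn.vertical q ξ

theorem PrincipalConnection.infinitesimalActionL_injective
    (conn : PrincipalConnection E Q 𝔤 G) (q : Q) :
    Function.Injective (infinitesimalActionL E G q : 𝔤 → E) :=
  Function.LeftInverse.injective (g := conn.formL q) (conn.formL_infinitesimalActionL q)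

end Connection

namespace LocalTriv

variable (T : LocalTriv E Q 𝔤 G b)

/-- The derivative of the base coordinate. -/
def du (q : Q) : E →L[ℝ] EuclideanSpace ℝ (Fin b) :=
  mfderiv 𝓘(ℝ, E) 𝓘(ℝ, EuclideanSpace ℝ (Fin b)) T.u q

/-- The derivative of the group coordinate. -/
def dτ (q : Q) : E →L[ℝ] 𝔤 := mfderiv 𝓘(ℝ, E) 𝓘(ℝ, 𝔤) T.τ q

variable {T}

theorem hasMFDerivAt_u {q : Q} (hq : q ∈ T.dom) :
    HasMFDerivAt 𝓘(ℝ, E) 𝓘(ℝ, EuclideanSpace ℝ (Fin b)) T.u q (T.du q) :=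
  ((T.contMDiffOn_u.contMDiffAt (T.isOpen_dom.mem_nhds hq)).mdifferentiableAt
    (by simp)).hasMFDerivAt

theorem hasMFDerivAt_τ {q : Q} (hq : q ∈ T.dom) :
    HasMFDerivAt 𝓘(ℝ, E) 𝓘(ℝ, 𝔤) T.τ q (T.dτ q) :=
  ((T.contMDiffOn_τ.contMDiffAt (T.isOpen_dom.mem_nhds hq)).mdifferentiableAt
    (by simp)).hasMFDerivAt

theorem exists_du_dτ {q : Q} (hq : q ∈ T.dom) (α : EuclideanSpace ℝ (Fin b)) (ξ : 𝔤) :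
    ∃ v : E, T.du q v = α ∧ T.dτ q v = ξ := T.surjective q hq α ξ

theorem du_surjective {q : Q} (hq : q ∈ T.dom) : Function.Surjective (T.du q) := fun α =>
  (exists_du_dτ hq α 0).imp fun _ h => h.1

theorem du_infinitesimalActionL (hact : IsSmoothRightAction E Q 𝔤 G) {q : Q} (hq : q ∈ T.dom)
    (ξ : 𝔤) : T.du q (infinitesimalActionL E G q ξ) = 0 := by
  have h1 : HasMFDerivAt 𝓘(ℝ, E) 𝓘(ℝ, EuclideanSpace ℝ (Fin b)) T.u (R Q (1 : G) q) (T.du q) := by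
    rw [R_one]; exact hasMFDerivAt_u hq
  have h2 := HasMFDerivAt.comp (1 : G) (f := fun g : G => R Q g q) h1 (hact.hasMFDerivAt_orbit q)
  have h3 : T.u ∘ (fun g : G => R Q g q) = fun _ => T.u q := by
    ext1 g
    exact T.u_R q hq g
  rw [h3] at h2
  exact DFunLike.congr_fun (hasMFDerivAt_unique h2 (hasMFDerivAt_const (T.u q) (1 : G))) ξ

theorem du_R (hact : IsSmoothRightAction E Q 𝔤 G) {q : Q} (hq : q ∈ T.dom) (g : G) (v : E) :
    T.du (R Q g q) ((mfderiv 𝓘(ℝ, E) 𝓘(ℝ, E) (R Q g) q : E →L[ℝ] E) v) = T.du q v := by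
  have h1 := (hasMFDerivAt_u (T.R_mem q hq g)).comp q (hact.hasMFDerivAt_R g q)
  have h2 := h1.congr_of_eventuallyEq (f₁ := T.u) (by
    filter_upwards [T.isOpen_dom.mem_nhds hq] with x hx
    exact (T.u_R x hx g).symm)
  exact DFunLike.congr_fun (hasMFDerivAt_unique h2 (hasMFDerivAt_u hq)) v

theorem proj_eq_iff_u_eq {q q' : Q} (hq : q ∈ T.dom) (hq' : q' ∈ T.dom) :
    proj Q G q = proj Q G q' ↔ T.u q = T.u q' := by
  rw [proj_eq_iff]
  refine ⟨?_, T.exists_R q hq q' hq'⟩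
  rintro ⟨g, rfl⟩
  exact (T.u_R q hq g).symm

/-- The slice function on `Q` for the action of `G`. -/
def baseSlice (T : LocalTriv E Q 𝔤 G b) {q₀ : Q} (h₀ : q₀ ∈ T.dom) :
    SliceFunction 𝓘(ℝ, E) (proj Q G) (EuclideanSpace ℝ (Fin b)) where
  dom := T.dom
  fn := T.u
  pt := q₀
  pt_mem := h₀
  isOpen_dom := T.isOpen_dom
  contMDiffOn := T.contMDiffOn_u
  surjective _ hq := by
    have h := du_surjective hq
    exact h
  eq_iff _ hq _ hq' := proj_eq_iff_u_eq hq hq'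

/-- The slice function on `Q` for the action of a subgroup `K`. -/
def subSlice (T : LocalTriv E Q 𝔤 G b) (κ : CosetSlice (𝔤 := 𝔤) K r) {q₀ : Q} (h₀ : q₀ ∈ T.dom)
    (h₀' : T.τ q₀ ∈ κ.dom) :
    SliceFunction 𝓘(ℝ, E) (subProj Q K)
      (EuclideanSpace ℝ (Fin b) × EuclideanSpace ℝ (Fin r)) where
  dom := T.dom ∩ T.τ ⁻¹' κ.dom
  fn q := (T.u q, κ.fn (T.τ q))
  pt := q₀
  pt_mem := ⟨h₀, h₀'⟩
  isOpen_dom := T.contMDiffOn_τ.continuousOn.isOpen_inter_preimage T.isOpen_dom κ.isOpen_dom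
  contMDiffOn := (T.contMDiffOn_u.mono inter_subset_left).prodMk_space
    (κ.contMDiffOn.comp (T.contMDiffOn_τ.mono inter_subset_left) fun _ hq => hq.2)
  surjective q hq := by
    let Dκ : 𝔤 →L[ℝ] EuclideanSpace ℝ (Fin r) :=
      mfderiv 𝓘(ℝ, 𝔤) 𝓘(ℝ, EuclideanSpace ℝ (Fin r)) κ.fn (T.τ q)
    have hDκ : HasMFDerivAt 𝓘(ℝ, 𝔤) 𝓘(ℝ, EuclideanSpace ℝ (Fin r)) κ.fn (T.τ q) Dκ :=
      ((κ.contMDiffOn.contMDiffAt (κ.isOpen_dom.mem_nhds hq.2)).mdifferentiableAt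
        (by simp)).hasMFDerivAt
    have h := hasMFDerivAt_prodMk_space (hasMFDerivAt_u hq.1) (hDκ.comp q (hasMFDerivAt_τ hq.1))
    have e : mfderiv 𝓘(ℝ, E) 𝓘(ℝ, EuclideanSpace ℝ (Fin b) × EuclideanSpace ℝ (Fin r))
        (fun q => (T.u q, κ.fn (T.τ q))) q = (T.du q).prod (Dκ.comp (T.dτ q)) := h.mfderiv
    rw [e]
    rintro ⟨α, γ⟩
    obtain ⟨ξ, hξ⟩ := κ.surjective (T.τ q) hq.2 γ
    obtain ⟨v, h1, h2⟩ := exists_du_dτ hq.1 α ξ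
    refine ⟨v, ?_⟩
    change (T.du q v, Dκ (T.dτ q v)) = (α, γ)
    rw [h1, h2]
    exact congrArg _ hξ
  eq_iff q hq q' hq' := by
    rw [subProj_eq_iff, Prod.mk.injEq, ← κ.eq_iff _ hq.2 _ hq'.2]
    constructor
    · rintro ⟨g, hg, rfl⟩
      refine ⟨(T.u_R q hq.1 g).symm, ?_⟩
      rw [T.τ_R q hq.1, inv_mul_cancel_left]
      exact hg
    · rintro ⟨h1, h2⟩
      obtain ⟨g, rfl⟩ := T.exists_R q hq.1 q' hq'.1 h1
      rw [T.τ_R q hq.1, inv_mul_cancel_left] at h2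
      exact ⟨g, h2, rfl⟩

section Ad

variable [LieGroup 𝓘(ℝ, 𝔤) ∞ G]

theorem _root_.RouthReduction.Ad_inv_Ad (g : G) (ξ : 𝔤) : Ad g⁻¹ (Ad g ξ) = ξ := by
  have : (Ad (g⁻¹ * g) : 𝔤 →L[ℝ] 𝔤) ξ = ξ := by rw [inv_mul_cancel, Ad_one]; rfl
  rwa [Ad_mul] at this

theorem _root_.RouthReduction.Ad_Ad_inv (g : G) (ξ : 𝔤) : Ad g (Ad g⁻¹ ξ) = ξ := by
  have : (Ad (g * g⁻¹) : 𝔤 →L[ℝ] 𝔤) ξ = ξ := by rw [mul_inv_cancel, Ad_one]; rfl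
  rwa [Ad_mul] at this

theorem _root_.RouthReduction.Ad_injective (g : G) : Function.Injective (Ad g : 𝔤 → 𝔤) :=
  Function.LeftInverse.injective (Ad_inv_Ad g)

/-- The rule `τ(qg) = τ(q)g` cancels `Ad_{g⁻¹}`, so `Ad_{τ(q)} ξ` depends only on the class `[q,
ξ]_G`. It is the fibre coordinate of the adjoint bundle. -/
theorem Ad_τ_R {q : Q} (hq : q ∈ T.dom) (g : G) (ξ : 𝔤) :
    Ad (T.τ (R Q g q)) (Ad g⁻¹ ξ) = Ad (T.τ q) ξ := by
  rw [T.τ_R q hq, Ad_mul, ContinuousLinearMap.comp_apply, Ad_Ad_inv]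

theorem contMDiffOn_Ad_τ :
    ContMDiffOn 𝓘(ℝ, E) 𝓘(ℝ, 𝔤 →L[ℝ] 𝔤) ∞ (fun q => (Ad (T.τ q) : 𝔤 →L[ℝ] 𝔤)) T.dom :=
  contMDiff_Ad.comp_contMDiffOn T.contMDiffOn_τ

/-- The slice function on `Q × 𝔤` for the action of `G`. -/
def adjointSlice (T : LocalTriv E Q 𝔤 G b) {q₀ : Q} (h₀ : q₀ ∈ T.dom) :
    SliceFunction (𝓘(ℝ, E).prod 𝓘(ℝ, 𝔤)) (adjointMk Q 𝔤 G) (EuclideanSpace ℝ (Fin b) × 𝔤) where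
  dom := T.dom ×ˢ univ
  fn a := (T.u a.1, Ad (T.τ a.1) a.2)
  pt := (q₀, 0)
  pt_mem := ⟨h₀, trivial⟩
  isOpen_dom := T.isOpen_dom.prod isOpen_univ
  contMDiffOn := (T.contMDiffOn_u.comp contMDiffOn_fst fun a ha => ha.1).prodMk_space
    ((contMDiffOn_Ad_τ.comp contMDiffOn_fst fun a ha => ha.1).clm_apply contMDiffOn_snd)
  surjective := by
    rintro ⟨q, ξ⟩ ⟨hq, -⟩
    have hnh : T.dom ×ˢ (univ : Set 𝔤) ∈ 𝓝 (q, ξ) :=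
      (T.isOpen_dom.prod isOpen_univ).mem_nhds ⟨hq, trivial⟩
    let f₂ : Q × 𝔤 → 𝔤 := fun a => Ad (T.τ a.1) a.2
    have hf₂ : ContMDiffOn (𝓘(ℝ, E).prod 𝓘(ℝ, 𝔤)) 𝓘(ℝ, 𝔤) ∞ f₂ (T.dom ×ˢ univ) :=
      (contMDiffOn_Ad_τ.comp contMDiffOn_fst fun a ha => ha.1).clm_apply contMDiffOn_snd
    let D₂ : E × 𝔤 →L[ℝ] 𝔤 := mfderiv (𝓘(ℝ, E).prod 𝓘(ℝ, 𝔤)) 𝓘(ℝ, 𝔤) f₂ (q, ξ)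
    have hD₂ : HasMFDerivAt (𝓘(ℝ, E).prod 𝓘(ℝ, 𝔤)) 𝓘(ℝ, 𝔤) f₂ (q, ξ) D₂ :=
      ((hf₂.contMDiffAt hnh).mdifferentiableAt (by simp)).hasMFDerivAt
    let D₁ : E × 𝔤 →L[ℝ] EuclideanSpace ℝ (Fin b) :=
      (T.du q).comp (ContinuousLinearMap.fst ℝ E 𝔤)
    have hD₁ : HasMFDerivAt (𝓘(ℝ, E).prod 𝓘(ℝ, 𝔤)) 𝓘(ℝ, EuclideanSpace ℝ (Fin b))
        (fun a : Q × 𝔤 => T.u a.1) (q, ξ) D₁ :=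
      HasMFDerivAt.comp (q, ξ) (f := (Prod.fst : Q × 𝔤 → Q)) (hasMFDerivAt_u hq)
        (hasMFDerivAt_fst (q, ξ))
    have e : mfderiv (𝓘(ℝ, E).prod 𝓘(ℝ, 𝔤)) 𝓘(ℝ, EuclideanSpace ℝ (Fin b) × 𝔤)
        (fun a : Q × 𝔤 => (T.u a.1, Ad (T.τ a.1) a.2)) (q, ξ) = D₁.prod D₂ :=
      (hasMFDerivAt_prodMk_space hD₁ hD₂).mfderiv
    rw [e]
    have hfib : ∀ η, D₂ (0, η) = Ad (T.τ q) η := by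
      intro η
      have h1 : HasMFDerivAt 𝓘(ℝ, 𝔤) (𝓘(ℝ, E).prod 𝓘(ℝ, 𝔤)) (fun η : 𝔤 => (q, η)) ξ
          ((0 : 𝔤 →L[ℝ] E).prod (ContinuousLinearMap.id ℝ 𝔤)) :=
        (hasMFDerivAt_const q ξ).prodMk (hasMFDerivAt_id ξ)
      have h2 := hD₂.comp ξ h1
      have h3 : HasMFDerivAt 𝓘(ℝ, 𝔤) 𝓘(ℝ, 𝔤) (f₂ ∘ fun η : 𝔤 => (q, η)) ξ
          (Ad (T.τ q) : 𝔤 →L[ℝ] 𝔤) := (Ad (T.τ q) : 𝔤 →L[ℝ] 𝔤).hasMFDerivAt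
      exact DFunLike.congr_fun (hasMFDerivAt_unique h2 h3) η
    rintro ⟨α, β⟩
    obtain ⟨v, hv1, hv2⟩ := surjective_pair_of_triangular (L₁ := D₁.toLinearMap)
      (L₂ := D₂.toLinearMap)
      (fun α => by
        obtain ⟨v, hv⟩ := du_surjective hq α
        exact ⟨(v, 0), hv⟩)
      (fun β => ⟨(0, Ad (T.τ q)⁻¹ β), map_zero (T.du q), (hfib _).trans (Ad_Ad_inv _ _)⟩) α β
    exact ⟨v, Prod.ext hv1 hv2⟩
  eq_iff := by
    rintro ⟨q, ξ⟩ ⟨hq, -⟩ ⟨q', ξ'⟩ ⟨hq', -⟩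
    rw [adjointMk_eq_iff, Prod.mk.injEq]
    constructor
    · rintro ⟨g, hg⟩
      obtain ⟨rfl, rfl⟩ := Prod.mk.inj hg
      exact ⟨(T.u_R q hq g).symm, (Ad_τ_R hq g ξ).symm⟩
    · rintro ⟨h1, h2⟩
      obtain ⟨g, hg⟩ := T.exists_R q hq q' hq' h1
      have hg' : R Q g q = q' := hg
      subst hg'
      refine ⟨g, Prod.ext rfl (Ad_injective (T.τ (R Q g q)) ?_)⟩
      exact (Ad_τ_R hq g ξ).trans h2

end Ad

section Tangent

variable [IsManifold 𝓘(ℝ, E) ∞ Q]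

theorem exists_du_form (hact : IsSmoothRightAction E Q 𝔤 G)
    (conn : PrincipalConnection E Q 𝔤 G) {q : Q} (hq : q ∈ T.dom)
    (α : EuclideanSpace ℝ (Fin b)) (η : 𝔤) : ∃ v : E, T.du q v = α ∧ conn.formL q v = η :=
  surjective_pair_of_triangular (L₁ := (T.du q).toLinearMap) (L₂ := (conn.formL q).toLinearMap)
    (du_surjective hq)
    (fun β => ⟨infinitesimalActionL E G q β, du_infinitesimalActionL hact hq β,
      conn.formL_infinitesimalActionL q β⟩) α η

variable [FiniteDimensional ℝ E]

/-- The vertical space lies in `ker du` and has the same dimension, so `v` is vertical; `ω` recovers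
the generator of a vertical vector, which is therefore zero. -/
theorem eq_zero_of_du_of_form (hact : IsSmoothRightAction E Q 𝔤 G)
    (conn : PrincipalConnection E Q 𝔤 G) (hb : b + Module.finrank ℝ 𝔤 = Module.finrank ℝ E)
    {q : Q} (hq : q ∈ T.dom) {v : E} (h1 : T.du q v = 0) (h2 : conn.formL q v = 0) : v = 0 := by
  have hle : LinearMap.range (infinitesimalActionL E G q : 𝔤 →L[ℝ] E).toLinearMap ≤
      LinearMap.ker (T.du q).toLinearMap := by
    rintro _ ⟨ξ, rfl⟩
    exact du_infinitesimalActionL hact hq ξ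
  have hdim : Module.finrank ℝ (LinearMap.range
      (infinitesimalActionL E G q : 𝔤 →L[ℝ] E).toLinearMap) = Module.finrank ℝ 𝔤 :=
    LinearMap.finrank_range_of_inj (conn.infinitesimalActionL_injective q)
  have hker := (T.du q).toLinearMap.finrank_range_add_finrank_ker
  rw [LinearMap.range_eq_top.2 (du_surjective hq), finrank_top, finrank_euclideanSpace_fin] at hker
  have heq := Submodule.eq_of_le_of_finrank_eq hle (by omega)
  have hv : v ∈ LinearMap.ker (T.du q).toLinearMap := h1
  rw [← heq] at hv
  obtain ⟨ξ, rfl⟩ := hv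
  have h3 : conn.formL q (infinitesimalActionL E G q ξ) = 0 := h2
  rw [conn.formL_infinitesimalActionL] at h3
  rw [h3, map_zero]

end Tangent

end LocalTriv

end

/-! ### Slice functions on `TQ` -/

section

variable {E : Type*} [NormedAddCommGroup E] [NormedSpace ℝ E]
  {Q : Type*} [TopologicalSpace Q] [ChartedSpace E Q] [IsManifold 𝓘(ℝ, E) ∞ Q]
  {𝔤 : Type*} [NormedAddCommGroup 𝔤] [NormedSpace ℝ 𝔤]
  {G : Type*} [TopologicalSpace G] [ChartedSpace 𝔤 G] [Group G] [LieGroup 𝓘(ℝ, 𝔤) ∞ G]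
  [MulAction Gᵐᵒᵖ Q] {b r : ℕ} {K : Subgroup G}

namespace LocalTriv

variable {T : LocalTriv E Q 𝔤 G b}

/-- The coordinates on the fibres of `TQ` given by a local trivialization and a connection. -/
def fibreCoord (T : LocalTriv E Q 𝔤 G b) (conn : PrincipalConnection E Q 𝔤 G) (q : Q) :
    E →L[ℝ] EuclideanSpace ℝ (Fin b) × 𝔤 :=
  (T.du q).prod ((Ad (T.τ q)).comp (conn.formL q))

theorem contMDiffOn_fibreCoord (conn : PrincipalConnection E Q 𝔤 G) :
    ContMDiffOn 𝓘(ℝ, E).tangent 𝓘(ℝ, EuclideanSpace ℝ (Fin b) × 𝔤) ∞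
      (fun v : TangentBundle 𝓘(ℝ, E) Q => T.fibreCoord conn v.proj v.snd)
      (Bundle.TotalSpace.proj ⁻¹' T.dom) := by
  have hproj : ContMDiff 𝓘(ℝ, E).tangent 𝓘(ℝ, E) ∞
      (Bundle.TotalSpace.proj : TangentBundle 𝓘(ℝ, E) Q → Q) :=
    Bundle.contMDiff_proj (TangentSpace 𝓘(ℝ, E))
  refine ContMDiffOn.prodMk_space ?_ ?_
  · have h := T.contMDiffOn_u.contMDiffOn_tangentMapWithin (m := ∞) (by simp)
      T.isOpen_dom.uniqueMDiffOn
    have h2 := (contMDiff_snd_tangentBundle_modelSpace (EuclideanSpace ℝ (Fin b))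
      𝓘(ℝ, EuclideanSpace ℝ (Fin b)) (n := ∞)).comp_contMDiffOn h
    refine h2.congr fun v hv => ?_
    have e := mfderivWithin_of_isOpen (I := 𝓘(ℝ, E)) (I' := 𝓘(ℝ, EuclideanSpace ℝ (Fin b)))
      (f := T.u) T.isOpen_dom hv
    exact (DFunLike.congr_fun e v.snd).symm
  · exact (contMDiffOn_Ad_τ.comp hproj.contMDiffOn fun v hv => hv).clm_apply
      conn.smooth.contMDiffOn

theorem exists_fibreCoord_eq (hact : IsSmoothRightAction E Q 𝔤 G)
    (conn : PrincipalConnection E Q 𝔤 G) {q : Q} (hq : q ∈ T.dom)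
    (z : EuclideanSpace ℝ (Fin b) × 𝔤) : ∃ v : E, T.fibreCoord conn q v = z := by
  obtain ⟨v, h1, h2⟩ := exists_du_form hact conn hq z.1 (Ad (T.τ q)⁻¹ z.2)
  refine ⟨v, Prod.ext h1 ?_⟩
  change Ad (T.τ q) (conn.formL q v) = z.2
  rw [h2, Ad_Ad_inv]

theorem fibreCoord_injective [FiniteDimensional ℝ E] (hact : IsSmoothRightAction E Q 𝔤 G)
    (conn : PrincipalConnection E Q 𝔤 G) (hb : b + Module.finrank ℝ 𝔤 = Module.finrank ℝ E)
    {q : Q} (hq : q ∈ T.dom) : Function.Injective (T.fibreCoord conn q) := by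
  refine (injective_iff_map_eq_zero _).2 fun v hv => ?_
  refine eq_zero_of_du_of_form hact conn hb hq (congrArg Prod.fst hv) (Ad_injective (T.τ q) ?_)
  rw [map_zero]
  exact congrArg Prod.snd hv

/-- Invariance of `u` handles the first component. In the second, the factor `Ad_{g⁻¹}` from the
equivariance of `ω` is absorbed by `τ(qg) = τ(q)g`. -/
theorem fibreCoord_R (hact : IsSmoothRightAction E Q 𝔤 G)
    (conn : PrincipalConnection E Q 𝔤 G) {q : Q} (hq : q ∈ T.dom) (g : G) (v : E) :
    T.fibreCoord conn (R Q g q) ((mfderiv 𝓘(ℝ, E) 𝓘(ℝ, E) (R Q g) q : E →L[ℝ] E) v) =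
      T.fibreCoord conn q v := by
  refine Prod.ext (du_R hact hq g v) ?_
  have h : conn.formL (R Q g q) ((mfderiv 𝓘(ℝ, E) 𝓘(ℝ, E) (R Q g) q : E →L[ℝ] E) v) =
    Ad g⁻¹ (conn.formL q v) := conn.equivariant g q v
  change Ad (T.τ (R Q g q)) (conn.formL (R Q g q) _) = Ad (T.τ q) (conn.formL q v)
  rw [h, Ad_τ_R hq]

/-- The slice function on `TQ` for the lifted action of `K`. -/
def tangentSlice [FiniteDimensional ℝ E] (hact : IsSmoothRightAction E Q 𝔤 G)
    (conn : PrincipalConnection E Q 𝔤 G)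
    (hb : b + Module.finrank ℝ 𝔤 = Module.finrank ℝ E)
    (T : LocalTriv E Q 𝔤 G b) (κ : CosetSlice (𝔤 := 𝔤) K r) {q₀ : Q} (h₀ : q₀ ∈ T.dom)
    (h₀' : T.τ q₀ ∈ κ.dom) :
    SliceFunction 𝓘(ℝ, E).tangent (tangentProj hact K)
      ((EuclideanSpace ℝ (Fin b) × EuclideanSpace ℝ (Fin r)) × (EuclideanSpace ℝ (Fin b) × 𝔤)) where
  dom := Bundle.TotalSpace.proj ⁻¹' (T.subSlice κ h₀ h₀').dom
  fn v := ((T.subSlice κ h₀ h₀').fn v.proj, T.fibreCoord conn v.proj v.snd)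
  pt := ⟨q₀, 0⟩
  pt_mem := (T.subSlice κ h₀ h₀').pt_mem
  isOpen_dom := (T.subSlice κ h₀ h₀').isOpen_dom.preimage
    (FiberBundle.continuous_proj E (TangentSpace 𝓘(ℝ, E)))
  contMDiffOn := ((T.subSlice κ h₀ h₀').contMDiffOn.comp
      (Bundle.contMDiff_proj (TangentSpace 𝓘(ℝ, E))).contMDiffOn fun _ hv => hv).prodMk_space
    ((contMDiffOn_fibreCoord conn).mono fun _ hv => hv.1)
  surjective := by
    intro v hv
    let S := T.subSlice κ h₀ h₀'
    let DS : E →L[ℝ] EuclideanSpace ℝ (Fin b) × EuclideanSpace ℝ (Fin r) :=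
      mfderiv 𝓘(ℝ, E) 𝓘(ℝ, EuclideanSpace ℝ (Fin b) × EuclideanSpace ℝ (Fin r)) S.fn v.proj
    have hDS : HasMFDerivAt 𝓘(ℝ, E) 𝓘(ℝ, EuclideanSpace ℝ (Fin b) × EuclideanSpace ℝ (Fin r))
        S.fn v.proj DS :=
      ((S.contMDiffOn.contMDiffAt (S.isOpen_dom.mem_nhds hv)).mdifferentiableAt
        (by simp)).hasMFDerivAt
    let P : E × E →L[ℝ] E := mfderiv 𝓘(ℝ, E).tangent 𝓘(ℝ, E)
      (Bundle.TotalSpace.proj : TangentBundle 𝓘(ℝ, E) Q → Q) v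
    have hP : HasMFDerivAt 𝓘(ℝ, E).tangent 𝓘(ℝ, E)
        (Bundle.TotalSpace.proj : TangentBundle 𝓘(ℝ, E) Q → Q) v P :=
      ((Bundle.contMDiff_proj (TangentSpace 𝓘(ℝ, E)) (n := ∞)).mdifferentiableAt
        (by simp)).hasMFDerivAt
    have h1 : HasMFDerivAt 𝓘(ℝ, E).tangent
        𝓘(ℝ, EuclideanSpace ℝ (Fin b) × EuclideanSpace ℝ (Fin r))
        (fun v : TangentBundle 𝓘(ℝ, E) Q => S.fn v.proj) v (DS.comp P) := hDS.comp v hP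
    let f₂ : TangentBundle 𝓘(ℝ, E) Q → EuclideanSpace ℝ (Fin b) × 𝔤 :=
      fun v => T.fibreCoord conn v.proj v.snd
    let D₂ : E × E →L[ℝ] EuclideanSpace ℝ (Fin b) × 𝔤 :=
      mfderiv 𝓘(ℝ, E).tangent 𝓘(ℝ, EuclideanSpace ℝ (Fin b) × 𝔤) f₂ v
    have hD₂ : HasMFDerivAt 𝓘(ℝ, E).tangent 𝓘(ℝ, EuclideanSpace ℝ (Fin b) × 𝔤) f₂ v D₂ := by
      have hopen : Bundle.TotalSpace.proj ⁻¹' T.dom ∈ 𝓝 v :=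
        (T.isOpen_dom.preimage (FiberBundle.continuous_proj E (TangentSpace 𝓘(ℝ, E)))).mem_nhds
          hv.1
      exact (((contMDiffOn_fibreCoord conn).contMDiffAt hopen).mdifferentiableAt
        (by simp)).hasMFDerivAt
    have e : mfderiv 𝓘(ℝ, E).tangent
        𝓘(ℝ, (EuclideanSpace ℝ (Fin b) × EuclideanSpace ℝ (Fin r)) ×
          (EuclideanSpace ℝ (Fin b) × 𝔤))
        (fun v : TangentBundle 𝓘(ℝ, E) Q => (S.fn v.proj, T.fibreCoord conn v.proj v.snd)) v =
        (DS.comp P).prod D₂ := (hasMFDerivAt_prodMk_space h1 hD₂).mfderiv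
    rw [e]
    rintro ⟨α, β⟩
    let q : Q := v.proj
    let w₀ : E := v.snd
    -- Along the fibre of `TQ` the first component is constant and the second is the linear map
    -- `fibreCoord`, which is onto; this gives the triangular shape.
    let c : E → TangentBundle 𝓘(ℝ, E) Q := fun w => ⟨q, w⟩
    let Dc : E →L[ℝ] E × E := mfderiv 𝓘(ℝ, E) 𝓘(ℝ, E).tangent c w₀
    have hDc : HasMFDerivAt 𝓘(ℝ, E) 𝓘(ℝ, E).tangent c w₀ Dc :=
      ((contMDiffAt_fibre_inclusion q w₀).mdifferentiableAt (by simp)).hasMFDerivAt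
    have hc1 : ∀ x, DS (P (Dc x)) = 0 := fun x =>
      DFunLike.congr_fun (hasMFDerivAt_unique
        (HasMFDerivAt.comp (f := c) (f' := Dc) w₀ h1 hDc)
        (hasMFDerivAt_const (I := 𝓘(ℝ, E)) (S.fn q) w₀)) x
    have hL : HasMFDerivAt 𝓘(ℝ, E) 𝓘(ℝ, EuclideanSpace ℝ (Fin b) × 𝔤)
        (T.fibreCoord conn q : E → EuclideanSpace ℝ (Fin b) × 𝔤) w₀ (T.fibreCoord conn q) :=
      (T.fibreCoord conn q).hasMFDerivAt
    have hc2 : ∀ x, D₂ (Dc x) = T.fibreCoord conn q x := fun x =>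
      DFunLike.congr_fun (hasMFDerivAt_unique
        (HasMFDerivAt.comp (f := c) (f' := Dc) w₀ hD₂ hDc) hL) x
    obtain ⟨w, hw1, hw2⟩ := surjective_pair_of_triangular (L₁ := (DS.comp P).toLinearMap)
      (L₂ := D₂.toLinearMap)
      (fun α => by
        obtain ⟨x, hx⟩ := S.surjective v.proj hv α
        obtain ⟨w, hw⟩ := exists_mfderiv_tangentBundle_proj_eq v x
        refine ⟨w, ?_⟩
        change DS (P w) = α
        have hw' : P w = x := hw
        rw [hw']
        exact hx)
      (fun β => by
        obtain ⟨x, hx⟩ := exists_fibreCoord_eq hact conn hv.1 β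
        exact ⟨Dc x, hc1 x, (hc2 x).trans hx⟩) α β
    exact ⟨w, Prod.ext hw1 hw2⟩
  eq_iff := by
    rintro ⟨q, v⟩ hq ⟨q', v'⟩ hq'
    rw [tangentProj_eq_iff, Prod.mk.injEq,
      ← (T.subSlice κ h₀ h₀').eq_iff q hq q' hq', subProj_eq_iff]
    constructor
    · rintro ⟨g, hg, h⟩
      have h1 : R Q g q = q' := congrArg Bundle.TotalSpace.proj h
      subst h1
      refine ⟨⟨g, hg, rfl⟩, ?_⟩
      have h2 : ((mfderiv 𝓘(ℝ, E) 𝓘(ℝ, E) (R Q g) q : E →L[ℝ] E) v : E) = v' :=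
        eq_of_heq (Bundle.TotalSpace.mk.inj h).2
      change T.fibreCoord conn q v = T.fibreCoord conn (R Q g q) v'
      exact ((fibreCoord_R hact conn hq.1 g v).symm).trans
        (congrArg (T.fibreCoord conn (R Q g q)) h2)
    · rintro ⟨⟨g, hg, h1⟩, h2⟩
      subst h1
      refine ⟨g, hg, ?_⟩
      -- The element `g` is found on base points alone; it carries `v` to `v'` because both have the
      -- same coordinates in the fibre at `qg` and these coordinates are injective.
      have h3 : (mfderiv 𝓘(ℝ, E) 𝓘(ℝ, E) (R Q g) q : E →L[ℝ] E) v = v' := by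
        refine fibreCoord_injective hact conn hb hq'.1 ?_
        exact (fibreCoord_R hact conn hq.1 g v).trans h2
      exact congrArg (fun w : E => (⟨R Q g q, w⟩ : TangentBundle 𝓘(ℝ, E) Q)) h3

end LocalTriv

theorem exists_cosetSlice [FiniteDimensional ℝ 𝔤] (μ : 𝔤 →L[ℝ] ℝ) (g₀ : G) :
    ∃ κ : CosetSlice (𝔤 := 𝔤) (isotropy G μ) (orbitDim G μ), g₀ ∈ κ.dom := by
  obtain ⟨κ, N, h1, h2, h3, h4, h5⟩ := exists_coadjoint_slice μ g₀
  exact ⟨⟨N, κ, h1, h3, h4, h5⟩, h2⟩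

end

/-! ### Countability of `TQ` and the Hausdorff property of the quotients -/

section

section SecondCountable

theorem secondCountableTopology_tangentBundle {E : Type*} [NormedAddCommGroup E] [NormedSpace ℝ E]
    [FiniteDimensional ℝ E] {Q : Type*} [TopologicalSpace Q] [ChartedSpace E Q]
    [IsManifold 𝓘(ℝ, E) 1 Q] [SecondCountableTopology Q] :
    SecondCountableTopology (TangentBundle 𝓘(ℝ, E) Q) := by
  have : ProperSpace E := FiniteDimensional.proper_real E
  have : SecondCountableTopology (ModelProd E E) :=
    inferInstanceAs (SecondCountableTopology (E × E))
  obtain ⟨s, hs, hcov⟩ :=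
    TopologicalSpace.countable_cover_nhds fun x : Q => chart_source_mem_nhds E x
  refine ChartedSpace.secondCountable_of_countable_cover (ModelProd E E)
    (s := (fun x : Q => (⟨x, 0⟩ : TangentBundle 𝓘(ℝ, E) Q)) '' s) ?_ (hs.image _)
  refine eq_univ_of_forall fun v => ?_
  have hv : v.proj ∈ ⋃ x ∈ s, (chartAt E x).source := hcov ▸ mem_univ _
  simp only [mem_iUnion] at hv
  obtain ⟨x, hx, hxv⟩ := hv
  refine mem_iUnion₂.2 ⟨_, ⟨x, hx, rfl⟩, ?_⟩
  exact (TangentBundle.mem_chart_source_iff v ⟨x, 0⟩).2 hxv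

end SecondCountable

variable {E : Type*} [NormedAddCommGroup E] [NormedSpace ℝ E] [FiniteDimensional ℝ E]
  {Q : Type*} [TopologicalSpace Q] [ChartedSpace E Q] [IsManifold 𝓘(ℝ, E) ∞ Q]
  {𝔤 : Type*} [NormedAddCommGroup 𝔤] [NormedSpace ℝ 𝔤] [FiniteDimensional ℝ 𝔤]
  {G : Type*} [TopologicalSpace G] [ChartedSpace 𝔤 G] [Group G] [LieGroup 𝓘(ℝ, 𝔤) ∞ G]
  [MulAction Gᵐᵒᵖ Q] {b r : ℕ} {K : Subgroup G}

theorem PrincipalConnection.exists_localTriv [T2Space G] [ProperSMul Gᵐᵒᵖ Q]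
    (conn : PrincipalConnection E Q 𝔤 G) (hact : IsSmoothRightAction E Q 𝔤 G)
    (hfree : ∀ (q : Q) (g : G), R Q g q = q → g = 1)
    (hb : b + Module.finrank ℝ 𝔤 = Module.finrank ℝ E) (q₀ : Q) :
    ∃ T : LocalTriv E Q 𝔤 G b, q₀ ∈ T.dom :=
  RouthReduction.exists_localTriv hact hfree hb q₀ (conn.infinitesimalActionL_injective q₀)

theorem t2Space_orbitSpace [ProperSMul Gᵐᵒᵖ Q] : T2Space (OrbitSpace Q G) :=
  t2Space_quotient_mulAction_of_properSMul

/-- A closed subgroup of a properly acting group acts properly. -/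
theorem t2Space_subOrbitSpace [ProperSMul Gᵐᵒᵖ Q] (hK : IsClosed (K : Set G)) :
    T2Space (SubOrbitSpace Q K) := by
  have : IsClosed (K.op : Set Gᵐᵒᵖ) := hK.preimage MulOpposite.continuous_unop
  exact t2Space_quotient_mulAction_of_properSMul

theorem t2Space_adjointBundle [T2Space (OrbitSpace Q G)]
    (hact : IsSmoothRightAction E Q 𝔤 G)
    (hcov : ∀ q : Q, ∃ T : LocalTriv E Q 𝔤 G b, q ∈ T.dom) :
    T2Space (AdjointBundle Q 𝔤 G) := by
  have hcont : Continuous (adjointToOrbit Q 𝔤 G) :=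
    ((isOpenQuotientMap_proj hact).continuous.comp continuous_fst).quotient_lift _
  refine SliceFunction.t2Space_of_base (I := 𝓘(ℝ, E).prod 𝓘(ℝ, 𝔤))
    (F := EuclideanSpace ℝ (Fin b) × 𝔤) (isOpenQuotientMap_adjointMk hact) hcont fun x x' hx => ?_
  obtain ⟨⟨q, ξ⟩, rfl⟩ := (isOpenQuotientMap_adjointMk hact).surjective x
  obtain ⟨⟨q', ξ'⟩, rfl⟩ := (isOpenQuotientMap_adjointMk hact).surjective x'
  obtain ⟨g, rfl⟩ := proj_eq_iff.1 (show proj Q G q = proj Q G q' from hx)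
  obtain ⟨T, hT⟩ := hcov q
  exact ⟨T.adjointSlice hT, ⟨_, ⟨hT, trivial⟩, rfl⟩, ⟨_, ⟨T.R_mem q hT g, trivial⟩, rfl⟩⟩

/-- The projection `TQ/K → Q/K`. -/
def tangentToSubOrbit (hact : IsSmoothRightAction E Q 𝔤 G) (K : Subgroup G) :
    TangentQuotient hact K → SubOrbitSpace Q K :=
  Quotient.lift (fun v => subProj Q K v.proj) (by
    rintro v _ ⟨g, hg, rfl⟩
    exact subProj_eq_iff.2 ⟨g, hg, rfl⟩)

theorem t2Space_tangentQuotient [T2Space (SubOrbitSpace Q K)]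
    (hact : IsSmoothRightAction E Q 𝔤 G) (conn : PrincipalConnection E Q 𝔤 G)
    (hb : b + Module.finrank ℝ 𝔤 = Module.finrank ℝ E)
    (hcov : ∀ q : Q, ∃ T : LocalTriv E Q 𝔤 G b, q ∈ T.dom)
    (hcovK : ∀ g : G, ∃ κ : CosetSlice (𝔤 := 𝔤) K r, g ∈ κ.dom) :
    T2Space (TangentQuotient hact K) := by
  have hcont : Continuous (tangentToSubOrbit hact K) :=
    ((isOpenQuotientMap_subProj hact K).continuous.comp
      (FiberBundle.continuous_proj E (TangentSpace 𝓘(ℝ, E)))).quotient_lift _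
  have hp := isOpenQuotientMap_tangentProj hact K
  refine SliceFunction.t2Space_of_base (I := 𝓘(ℝ, E).tangent)
    (F := (EuclideanSpace ℝ (Fin b) × EuclideanSpace ℝ (Fin r)) × (EuclideanSpace ℝ (Fin b) × 𝔤))
    hp hcont fun x x' hx => ?_
  obtain ⟨v, rfl⟩ := hp.surjective x
  obtain ⟨v', rfl⟩ := hp.surjective x'
  -- Translating `v'` by this `g` puts both vectors over the same point of `Q`, hence in the domain
  -- of any slice around that point.
  obtain ⟨g, hg, h⟩ := subProj_eq_iff.1 (show subProj Q K v'.proj = subProj Q K v.proj from hx.symm)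
  obtain ⟨T, hT⟩ := hcov v.proj
  obtain ⟨κ, hκ⟩ := hcovK (T.τ v.proj)
  refine ⟨T.tangentSlice hact conn hb κ hT hκ, ⟨v, ⟨hT, hκ⟩, rfl⟩,
    ⟨tangentMap 𝓘(ℝ, E) 𝓘(ℝ, E) (R Q g) v', ?_, (tangentProj_eq_iff.2 ⟨g, hg, rfl⟩).symm⟩⟩
  change R Q g v'.proj ∈ (T.subSlice κ hT hκ).dom
  rw [h]
  exact ⟨hT, hκ⟩

end

/-! ### Transport of smooth structures; embeddings that are linear in charts -/

section

section Transport

variable {F : Type*} [NormedAddCommGroup F] [NormedSpace ℝ F]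
  {X : Type*} [TopologicalSpace X] [ChartedSpace F X] {Y : Type*} [TopologicalSpace Y]

/-- The charted space structure transported along a homeomorphism, with the transported atlas. -/
@[reducible] def transportedChartedSpace (f : X ≃ₜ Y) : ChartedSpace F Y where
  atlas := (fun e => f.symm.transOpenPartialHomeomorph e) '' atlas F X
  chartAt y := f.symm.transOpenPartialHomeomorph (chartAt F (f.symm y))
  mem_chart_source y := mem_chart_source F (f.symm y)
  chart_mem_atlas y := ⟨_, chart_mem_atlas F (f.symm y), rfl⟩

theorem isManifold_transported [IsManifold 𝓘(ℝ, F) ∞ X] (f : X ≃ₜ Y) [ChartedSpace F Y]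
    (hat : atlas F Y = (fun e => f.symm.transOpenPartialHomeomorph e) '' atlas F X) :
    IsManifold 𝓘(ℝ, F) ∞ Y := by
  have : HasGroupoid Y (contDiffGroupoid ∞ 𝓘(ℝ, F)) := ⟨by
    rw [hat]
    rintro _ _ ⟨e, he, rfl⟩ ⟨e', he', rfl⟩
    refine (contDiffGroupoid ∞ 𝓘(ℝ, F)).mem_of_eqOnSource
      (HasGroupoid.compatible (G := contDiffGroupoid ∞ 𝓘(ℝ, F)) he he') ⟨?_, fun a _ => ?_⟩
    · ext a
      simp
    · simp⟩
  exact IsManifold.mk' _ _ _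

theorem contMDiff_transported [IsManifold 𝓘(ℝ, F) ∞ X] (f : X ≃ₜ Y) [ChartedSpace F Y]
    [IsManifold 𝓘(ℝ, F) ∞ Y]
    (hat : atlas F Y = (fun e => f.symm.transOpenPartialHomeomorph e) '' atlas F X) :
    ContMDiff 𝓘(ℝ, F) 𝓘(ℝ, F) ∞ f ∧ ContMDiff 𝓘(ℝ, F) 𝓘(ℝ, F) ∞ f.symm := by
  have hmem : ∀ x : X, f.symm.transOpenPartialHomeomorph (chartAt F x) ∈
      IsManifold.maximalAtlas 𝓘(ℝ, F) ∞ Y := fun x =>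
    IsManifold.subset_maximalAtlas (by rw [hat]; exact ⟨_, chart_mem_atlas F x, rfl⟩)
  have key : ∀ x : X, ContMDiffAt 𝓘(ℝ, F) 𝓘(ℝ, F) ∞ f x ∧
      ContMDiffAt 𝓘(ℝ, F) 𝓘(ℝ, F) ∞ f.symm (f x) := by
    intro x
    let e := chartAt F x
    let e' := f.symm.transOpenPartialHomeomorph e
    have he : e ∈ IsManifold.maximalAtlas 𝓘(ℝ, F) ∞ X := IsManifold.chart_mem_maximalAtlas x
    have hx : x ∈ e.source := mem_chart_source F x
    have hx' : f x ∈ e'.source := by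
      change f.symm (f x) ∈ e.source
      rwa [f.symm_apply_apply]
    constructor
    · have h : ContMDiffOn 𝓘(ℝ, F) 𝓘(ℝ, F) ∞ (e'.symm ∘ e) e.source :=
        (contMDiffOn_symm_of_mem_maximalAtlas (hmem x)).comp
          (contMDiffOn_of_mem_maximalAtlas he) fun y hy => e.map_source hy
      refine (h.congr fun y hy => ?_).contMDiffAt (e.open_source.mem_nhds hx)
      exact (congrArg f (e.left_inv hy)).symm
    · have h : ContMDiffOn 𝓘(ℝ, F) 𝓘(ℝ, F) ∞ (e.symm ∘ e') e'.source :=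
        (contMDiffOn_symm_of_mem_maximalAtlas he).comp
          (contMDiffOn_of_mem_maximalAtlas (hmem x)) fun y hy => e'.map_source hy
      refine (h.congr fun y hy => ?_).contMDiffAt (e'.open_source.mem_nhds hx')
      exact (e.left_inv hy).symm
  refine ⟨fun x => (key x).1, fun y => ?_⟩
  have := (key (f.symm y)).2
  rwa [f.apply_symm_apply] at this

end Transport

theorem exists_equiv_prod_of_injective {F F' : Type*} [NormedAddCommGroup F] [NormedSpace ℝ F]
    [FiniteDimensional ℝ F] [NormedAddCommGroup F'] [NormedSpace ℝ F'] [FiniteDimensional ℝ F']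
    (L : F →L[ℝ] F') (hL : Function.Injective L) :
    ∃ l : (F × EuclideanSpace ℝ (Fin (Module.finrank ℝ F' - Module.finrank ℝ F))) ≃L[ℝ] F',
      ∀ x, l (x, 0) = L x := by
  obtain ⟨W, hW⟩ := Submodule.exists_isCompl (LinearMap.range L.toLinearMap)
  have h1 := Submodule.finrank_add_eq_of_isCompl hW
  rw [LinearMap.finrank_range_of_inj hL] at h1
  have e : EuclideanSpace ℝ (Fin (Module.finrank ℝ F' - Module.finrank ℝ F)) ≃ₗ[ℝ] W :=
    LinearEquiv.ofFinrankEq _ _ (by rw [finrank_euclideanSpace_fin]; omega)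
  refine ⟨(((LinearEquiv.ofInjective L.toLinearMap hL).prodCongr e).trans
    (Submodule.prodEquivOfIsCompl _ W hW)).toContinuousLinearEquiv, fun x => ?_⟩
  simp

section Embedding

variable {F : Type*} [NormedAddCommGroup F] [NormedSpace ℝ F] [FiniteDimensional ℝ F]
  {X : Type*} [TopologicalSpace X] [ChartedSpace F X] [IsManifold 𝓘(ℝ, F) ∞ X]
  {F' : Type*} [NormedAddCommGroup F'] [NormedSpace ℝ F'] [FiniteDimensional ℝ F']
  {H' : Type*} [TopologicalSpace H'] {J : ModelWithCorners ℝ F' H'}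
  {N : Type*} [TopologicalSpace N] [ChartedSpace H' N] [IsManifold J ∞ N]

/-- `Ψ` is linear and injective in suitable charts, and the domain of the chart of `X` is the
preimage of the domain of the chart of `N`. -/
def HasLinearCharts (J : ModelWithCorners ℝ F' H') (Ψ : X → N) : Prop :=
  ∀ x : X, ∃ e ∈ IsManifold.maximalAtlas 𝓘(ℝ, F) ∞ X, ∃ e' ∈ IsManifold.maximalAtlas J ∞ N,
    ∃ L : F →L[ℝ] F', Function.Injective L ∧ x ∈ e.source ∧ Ψ ⁻¹' e'.source = e.source ∧
      ∀ y ∈ e.source, e'.extend J (Ψ y) = L (e y)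

variable {Ψ : X → N}

omit [IsManifold 𝓘(ℝ, F) ∞ X] [IsManifold J ∞ N] in
-- Locally a linear left inverse of `L` gives a continuous left inverse of `Ψ`. The condition that
-- the source of `e` is the full preimage of the source of `e'` rules out points outside the chart
-- that return close to `Ψ x`, so `Ψ` is injective and an embedding, not only an immersion.
theorem HasLinearCharts.isEmbedding (h : HasLinearCharts (F := F) J Ψ) : IsEmbedding Ψ := by
  have hinj : Function.Injective Ψ := by
    intro x y hxy
    obtain ⟨e, -, e', -, L, hL, hx, hs, hf⟩ := h x
    have hy : y ∈ e.source := by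
      rw [← hs, mem_preimage, ← hxy]
      exact hs.symm.subset hx
    refine e.injOn hx hy (hL ?_)
    rw [← hf x hx, ← hf y hy, hxy]
  refine ⟨isInducing_iff_nhds.2 fun x => ?_, hinj⟩
  obtain ⟨e, -, e', -, L, hL, hx, hs, hf⟩ := h x
  have hx' : Ψ x ∈ e'.source := hs.symm.subset hx
  obtain ⟨l, hl⟩ := exists_equiv_prod_of_injective L hL
  have hsymm : ∀ y ∈ e.source, (e'.extend J).symm (L (e y)) = Ψ y := fun y hy => by
    rw [← hf y hy]
    exact e'.extend_left_inv (hs.symm.subset hy)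
  apply le_antisymm
  · refine Tendsto.le_comap ?_
    have h1 : ContinuousAt ((e'.extend J).symm ∘ L ∘ e) x := by
      refine ContinuousAt.comp ?_ (L.continuous.continuousAt.comp (e.continuousAt hx))
      rw [Function.comp, ← hf x hx]
      exact e'.continuousAt_extend_symm hx'
    have h2 := h1.congr (f := (e'.extend J).symm ∘ L ∘ e) (g := Ψ) (by
      filter_upwards [e.open_source.mem_nhds hx] with y hy using hsymm y hy)
    exact h2
  · have hg : ContinuousAt (fun n => e.symm (l.symm (e'.extend J n)).1) (Ψ x) := by
      have h1 : ContinuousAt (fun n => (l.symm (e'.extend J n)).1) (Ψ x) :=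
        (continuous_fst.comp l.symm.continuous).continuousAt.comp (e'.continuousAt_extend hx')
      refine ContinuousAt.comp (g := e.symm) ?_ h1
      have h2 : (l.symm (e'.extend J (Ψ x))).1 = e x := by
        rw [hf x hx, ← hl, l.symm_apply_apply]
      rw [h2]
      exact e.continuousAt_symm (e.map_source hx)
    have hgx : ∀ y ∈ e.source, e.symm (l.symm (e'.extend J (Ψ y))).1 = y := fun y hy => by
      rw [hf y hy, ← hl, l.symm_apply_apply]
      exact e.left_inv hy
    intro s hs'
    rw [mem_comap]
    rw [ContinuousAt, hgx x hx] at hg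
    refine ⟨_, inter_mem (hg hs') (e'.open_source.mem_nhds hx'), ?_⟩
    rintro y ⟨hy1, hy2⟩
    have hy : y ∈ e.source := hs.subset hy2
    exact hgx y hy ▸ hy1

omit [IsManifold J ∞ N] in
theorem HasLinearCharts.exists_smoothEmbedding (h : HasLinearCharts (F := F) J Ψ) {s : Set N}
    (hs : range Ψ = s) :
    ∃ (_ : ChartedSpace F s), IsManifold 𝓘(ℝ, F) ∞ s ∧
      Manifold.IsSmoothEmbedding 𝓘(ℝ, F) J ∞ (Subtype.val : s → N) ∧
      ∃ Φ : X ≃ₘ^∞⟮𝓘(ℝ, F), 𝓘(ℝ, F)⟯ s, ∀ x, (Φ x).1 = Ψ x := by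
  subst hs
  let f : X ≃ₜ range Ψ := h.isEmbedding.toHomeomorph
  let _ : ChartedSpace F (range Ψ) := transportedChartedSpace f
  have hM : IsManifold 𝓘(ℝ, F) ∞ (range Ψ) := isManifold_transported (F := F) f rfl
  obtain ⟨h1, h2⟩ := contMDiff_transported (F := F) f rfl
  refine ⟨inferInstance, hM, ⟨?_, IsEmbedding.subtypeVal⟩, ⟨f.toEquiv, h1, h2⟩, fun x => rfl⟩
  refine Manifold.IsImmersionOfComplement.isImmersion
    (F := EuclideanSpace ℝ (Fin (Module.finrank ℝ F' - Module.finrank ℝ F))) fun z => ?_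
  obtain ⟨x, rfl⟩ := f.surjective z
  obtain ⟨e, he, e', he', L, hL, hx, hs, hf⟩ := h x
  obtain ⟨l, hl⟩ := exists_equiv_prod_of_injective L hL
  have hmem : f.symm.transOpenPartialHomeomorph e ∈
      IsManifold.maximalAtlas 𝓘(ℝ, F) ∞ (range Ψ) := by
    -- The chart `e` is only known to lie in the maximal atlas, while the transported atlas uses
    -- charts of the atlas itself, so smoothness of `f` and its inverse is used.
    refine OpenPartialHomeomorph.mem_maximalAtlas_of_contMDiffOn (I := 𝓘(ℝ, F)) (n := ∞) _ ?_ ?_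
    · exact (contMDiffOn_of_mem_maximalAtlas he).comp h2.contMDiffOn fun y hy => hy
    · exact h1.comp_contMDiffOn (contMDiffOn_symm_of_mem_maximalAtlas he)
  refine Manifold.IsImmersionAtOfComplement.mk_of_continuousAt continuous_subtype_val.continuousAt
    l (f.symm.transOpenPartialHomeomorph e) e' ?_ (hs.symm.subset hx) hmem he' ?_
  · change f.symm (f x) ∈ e.source
    rwa [f.symm_apply_apply]
  · intro a ha
    have ha' : a ∈ e.target := by simpa using ha
    change e'.extend J (Ψ (e.symm a)) = l (a, 0)
    rw [hf _ (e.map_target ha'), e.right_inv ha', hl]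

end Embedding

end

/-! ### The derivative of `π` and horizontal lifts -/

section

variable {E : Type*} [NormedAddCommGroup E] [NormedSpace ℝ E]
  {Q : Type*} [TopologicalSpace Q] [ChartedSpace E Q]
  {𝔤 : Type*} [NormedAddCommGroup 𝔤] [NormedSpace ℝ 𝔤]
  {G : Type*} [TopologicalSpace G] [ChartedSpace 𝔤 G] [Group G]
  [MulAction Gᵐᵒᵖ Q] {b r : ℕ} {K : Subgroup G}

section Base

variable [ChartedSpace (EuclideanSpace ℝ (Fin b)) (OrbitSpace Q G)]

variable (E G b) in
/-- The derivative of `π : Q → Q/G` at `q`, as a linear map between the model spaces. -/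
def mfderivProj (q : Q) : E →L[ℝ] EuclideanSpace ℝ (Fin b) :=
  mfderiv 𝓘(ℝ, E) (𝓡 b) (proj Q G) q

omit [TopologicalSpace G] [ChartedSpace 𝔤 G] in
theorem hasMFDerivAt_proj (hπ : MDifferentiable 𝓘(ℝ, E) (𝓡 b) (proj Q G)) (q : Q) :
    HasMFDerivAt 𝓘(ℝ, E) (𝓡 b) (proj Q G) q (mfderivProj E G b q) :=
  (hπ q).hasMFDerivAt

theorem mfderivProj_infinitesimalActionL (hact : IsSmoothRightAction E Q 𝔤 G)
    (hπ : MDifferentiable 𝓘(ℝ, E) (𝓡 b) (proj Q G)) (q : Q) (ξ : 𝔤) :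
    mfderivProj E G b q (infinitesimalActionL E G q ξ) = 0 := by
  have e : proj Q G ∘ (fun g : G => R Q g q) = fun _ => proj Q G q := by
    ext g
    exact (proj_eq_iff.2 ⟨g, rfl⟩).symm
  have h1 : HasMFDerivAt 𝓘(ℝ, E) (𝓡 b) (proj Q G) (R Q (1 : G) q) (mfderivProj E G b q) := by
    rw [R_one]
    exact hasMFDerivAt_proj hπ q
  have h2 := HasMFDerivAt.comp (f := fun g : G => R Q g q) (1 : G) h1 (hact.hasMFDerivAt_orbit q)
  rw [e] at h2
  exact DFunLike.congr_fun (hasMFDerivAt_unique h2 (hasMFDerivAt_const (I := 𝓘(ℝ, 𝔤))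
    (proj Q G q) (1 : G))) ξ

theorem tangentMap_proj_R (hact : IsSmoothRightAction E Q 𝔤 G)
    (hπ : MDifferentiable 𝓘(ℝ, E) (𝓡 b) (proj Q G)) (g : G) (v : TangentBundle 𝓘(ℝ, E) Q) :
    tangentMap 𝓘(ℝ, E) (𝓡 b) (proj Q G) (tangentMap 𝓘(ℝ, E) 𝓘(ℝ, E) (R Q g) v) =
      tangentMap 𝓘(ℝ, E) (𝓡 b) (proj Q G) v := by
  have e : proj Q G ∘ R Q g = proj Q G := by
    ext q
    exact (proj_eq_iff.2 ⟨g, rfl⟩).symm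
  have h := tangentMap_comp (I := 𝓘(ℝ, E)) (I' := 𝓘(ℝ, E)) (I'' := 𝓡 b) hπ
    ((hact.contMDiff_R g).mdifferentiable (by simp))
  rw [e] at h
  exact (congrFun h v).symm

variable [FiniteDimensional ℝ E] [IsManifold 𝓘(ℝ, E) ∞ Q] {T : LocalTriv E Q 𝔤 G b}
  {q₀ : Q} {h₀ : q₀ ∈ T.dom}
  (hact : IsSmoothRightAction E Q 𝔤 G)

/-- In a chart coming from a local trivialization the projection `T(Q/G) → A` composed with `Tπ`
is the derivative of the base coordinate. -/
theorem mfderiv_chart_mfderivProj [IsManifold (𝓡 b) 1 (OrbitSpace Q G)]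
    (hπ : MDifferentiable 𝓘(ℝ, E) (𝓡 b) (proj Q G)) {x : OrbitSpace Q G}
    (hx : chartAt (EuclideanSpace ℝ (Fin b)) x =
      (T.baseSlice h₀).chart (isOpenQuotientMap_proj hact)) {q : Q} (hq : q ∈ T.dom) (v : E) :
    (mfderiv (𝓡 b) (𝓡 b) (chartAt (EuclideanSpace ℝ (Fin b)) x) (proj Q G q) :
      EuclideanSpace ℝ (Fin b) →L[ℝ] EuclideanSpace ℝ (Fin b)) (mfderivProj E G b q v) =
      T.du q v := by
  have hmem : proj Q G q ∈ (chartAt (EuclideanSpace ℝ (Fin b)) x).source := by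
    rw [hx]
    exact ⟨q, hq, rfl⟩
  have h1 := ((mdifferentiableAt_atlas (I := 𝓡 b) (chart_mem_atlas _ x) hmem).hasMFDerivAt).comp q
    (hasMFDerivAt_proj hπ q)
  have h2 : HasMFDerivAt 𝓘(ℝ, E) (𝓡 b) (chartAt (EuclideanSpace ℝ (Fin b)) x ∘ proj Q G) q
      (T.du q) := by
    refine (LocalTriv.hasMFDerivAt_u hq).congr_of_eventuallyEq ?_
    filter_upwards [T.isOpen_dom.mem_nhds hq] with q' hq'
    change chartAt (EuclideanSpace ℝ (Fin b)) x (proj Q G q') = T.u q'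
    rw [hx]
    exact SliceFunction.chart_apply _ (T.baseSlice h₀) hq'
  exact DFunLike.congr_fun (hasMFDerivAt_unique h1 h2) v

/-- The derivative of a chart of `Q/G` is injective and turns `Tπ` into `du`. -/
theorem mfderivProj_eq_iff [IsManifold (𝓡 b) 1 (OrbitSpace Q G)]
    (hπ : MDifferentiable 𝓘(ℝ, E) (𝓡 b) (proj Q G)) {x : OrbitSpace Q G}
    (hx : chartAt (EuclideanSpace ℝ (Fin b)) x =
      (T.baseSlice h₀).chart (isOpenQuotientMap_proj hact)) {q : Q} (hq : q ∈ T.dom) (v w : E) :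
    mfderivProj E G b q v = mfderivProj E G b q w ↔ T.du q v = T.du q w := by
  have hmem : proj Q G q ∈ (chartAt (EuclideanSpace ℝ (Fin b)) x).source := by
    rw [hx]
    exact ⟨q, hq, rfl⟩
  rw [← mfderiv_chart_mfderivProj hact hπ hx hq, ← mfderiv_chart_mfderivProj hact hπ hx hq]
  exact ((mdifferentiable_chart (I := 𝓡 b) x).mfderiv_injective hmem).eq_iff.symm

theorem mfderivProj_surjective [IsManifold (𝓡 b) 1 (OrbitSpace Q G)]
    (hπ : MDifferentiable 𝓘(ℝ, E) (𝓡 b) (proj Q G)) {x : OrbitSpace Q G}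
    (hx : chartAt (EuclideanSpace ℝ (Fin b)) x =
      (T.baseSlice h₀).chart (isOpenQuotientMap_proj hact)) {q : Q} (hq : q ∈ T.dom) :
    Function.Surjective (mfderivProj E G b q) := by
  have hmem : proj Q G q ∈ (chartAt (EuclideanSpace ℝ (Fin b)) x).source := by
    rw [hx]
    exact ⟨q, hq, rfl⟩
  intro w
  obtain ⟨v, hv⟩ := LocalTriv.du_surjective hq
    ((mfderiv (𝓡 b) (𝓡 b) (chartAt (EuclideanSpace ℝ (Fin b)) x) (proj Q G q) :
      EuclideanSpace ℝ (Fin b) →L[ℝ] EuclideanSpace ℝ (Fin b)) w)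
  rw [← mfderiv_chart_mfderivProj hact hπ hx hq] at hv
  exact ⟨v, (mdifferentiable_chart (I := 𝓡 b) x).mfderiv_injective hmem hv⟩

/-- Subtracting `σ_q(ω(v))` from any lift `v` makes it horizontal without changing its projection.
Two horizontal lifts differ by a vector killed by both `du` and `ω`. -/
theorem existsUnique_horizontal_lift [IsManifold (𝓡 b) 1 (OrbitSpace Q G)]
    (hπ : MDifferentiable 𝓘(ℝ, E) (𝓡 b) (proj Q G)) {x : OrbitSpace Q G}
    (hx : chartAt (EuclideanSpace ℝ (Fin b)) x =
      (T.baseSlice h₀).chart (isOpenQuotientMap_proj hact))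
    (conn : PrincipalConnection E Q 𝔤 G) (hb : b + Module.finrank ℝ 𝔤 = Module.finrank ℝ E)
    {q : Q} (hq : q ∈ T.dom) (w : EuclideanSpace ℝ (Fin b)) :
    ∃! h : E, conn.formL q h = 0 ∧ mfderivProj E G b q h = w := by
  obtain ⟨v, rfl⟩ := mfderivProj_surjective hact hπ hx hq w
  refine ⟨v - infinitesimalActionL E G q (conn.formL q v), ⟨?_, ?_⟩, ?_⟩
  · rw [map_sub, conn.formL_infinitesimalActionL, sub_self]
  · rw [map_sub, mfderivProj_infinitesimalActionL hact hπ, sub_zero]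
  · rintro h ⟨h1, h2⟩
    rw [← sub_eq_zero]
    refine LocalTriv.eq_zero_of_du_of_form hact conn hb hq ?_ ?_
    · rw [map_sub, sub_eq_zero, ← mfderivProj_eq_iff hact hπ hx hq, h2, map_sub,
        mfderivProj_infinitesimalActionL hact hπ, sub_zero]
    · rw [map_sub, h1, map_sub, conn.formL_infinitesimalActionL, sub_self, sub_zero]

end Base

end

/-! ### The map `φ_ω`: well-definedness, image and coordinate form -/

section

variable {E : Type*} [NormedAddCommGroup E] [NormedSpace ℝ E]
  {Q : Type*} [TopologicalSpace Q] [ChartedSpace E Q] [IsManifold 𝓘(ℝ, E) ∞ Q]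
  {𝔤 : Type*} [NormedAddCommGroup 𝔤] [NormedSpace ℝ 𝔤]
  {G : Type*} [TopologicalSpace G] [ChartedSpace 𝔤 G] [Group G] [LieGroup 𝓘(ℝ, 𝔤) ∞ G]
  [MulAction Gᵐᵒᵖ Q] {b r : ℕ} [ChartedSpace (EuclideanSpace ℝ (Fin b)) (OrbitSpace Q G)]

omit [TopologicalSpace Q] in
theorem adjointMk_R (g : G) (q : Q) (ξ : 𝔤) :
    adjointMk Q 𝔤 G (R Q g q, Ad g⁻¹ ξ) = adjointMk Q 𝔤 G (q, ξ) :=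
  (adjointMk_eq_iff (a := (q, ξ)).2 ⟨g, rfl⟩).symm

/-- The map `[v_q]_K ↦ (Tπ(v_q), π_K(q), [q, ω(v_q)]_G)`. -/
def reducedMap (hact : IsSmoothRightAction E Q 𝔤 G) (conn : PrincipalConnection E Q 𝔤 G)
    (hπ : MDifferentiable 𝓘(ℝ, E) (𝓡 b) (proj Q G)) (K : Subgroup G) :
    TangentQuotient hact K → TangentBundle 𝓘(ℝ, EuclideanSpace ℝ (Fin b)) (OrbitSpace Q G) ×
      SubOrbitSpace Q K × AdjointBundle Q 𝔤 G :=
  Quotient.lift (fun v => (tangentMap 𝓘(ℝ, E) (𝓡 b) (proj Q G) v, subProj Q K v.proj,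
    adjointMk Q 𝔤 G (v.proj, conn.form v.proj v.snd))) (by
    rintro ⟨q, v⟩ _ ⟨g, hg, rfl⟩
    refine Prod.ext (tangentMap_proj_R hact hπ g _).symm
      (Prod.ext (subProj_eq_iff.2 ⟨g, hg, rfl⟩) ?_)
    refine (adjointMk_R g q (conn.form q v)).symm.trans ?_
    exact congrArg (fun η => adjointMk Q 𝔤 G (R Q g q, η)) (conn.equivariant g q v).symm)

variable {hact : IsSmoothRightAction E Q 𝔤 G} {conn : PrincipalConnection E Q 𝔤 G}
  {hπ : MDifferentiable 𝓘(ℝ, E) (𝓡 b) (proj Q G)} {K : Subgroup G}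

theorem reducedMap_tangentProj (q : Q) (v : E) :
    reducedMap hact conn hπ K (tangentProj hact K ⟨q, v⟩) =
      (⟨proj Q G q, mfderivProj E G b q v⟩, subProj Q K q,
        adjointMk Q 𝔤 G (q, conn.formL q v)) := rfl

theorem reducedMap_horizontal_add_vertical (q : Q) {h : E} (hh : conn.formL q h = 0) (ξ : 𝔤) :
    reducedMap hact conn hπ K (tangentProj hact K ⟨q, h + infinitesimalActionL E G q ξ⟩) =
      (⟨proj Q G q, mfderivProj E G b q h⟩, subProj Q K q, adjointMk Q 𝔤 G (q, ξ)) := by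
  rw [reducedMap_tangentProj, map_add, map_add, mfderivProj_infinitesimalActionL hact hπ, hh,
    conn.formL_infinitesimalActionL, add_zero, zero_add]

/-- A point of the fibred product has representatives over the same orbit. Translating that of the
adjoint class by `g` makes the base points agree, and then horizontal lift plus vertical vector is a
preimage. -/
theorem range_reducedMap
    (hlift : ∀ (q : Q) (w : EuclideanSpace ℝ (Fin b)),
      ∃ h : E, conn.formL q h = 0 ∧ mfderivProj E G b q h = w) :
    range (reducedMap hact conn hπ K) = fibredProduct (EuclideanSpace ℝ (Fin b)) Q 𝔤 K := by
  apply Subset.antisymm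
  · rintro _ ⟨x, rfl⟩
    obtain ⟨⟨q, v⟩, rfl⟩ := (isOpenQuotientMap_tangentProj hact K).surjective x
    exact ⟨rfl, rfl⟩
  · rintro ⟨⟨x, w⟩, y, z⟩ ⟨h1, h2⟩
    obtain ⟨q, rfl⟩ := (isOpenQuotientMap_subProj hact K).surjective y
    obtain ⟨⟨q', ξ⟩, rfl⟩ := (isOpenQuotientMap_adjointMk hact).surjective z
    have h1' : proj Q G q = x := h1
    subst h1'
    obtain ⟨g, rfl⟩ := proj_eq_iff.1 (show proj Q G q' = proj Q G q from h2)
    obtain ⟨h, hh, rfl⟩ := hlift (R Q g q') w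
    refine ⟨tangentProj hact K ⟨R Q g q', h + infinitesimalActionL E G (R Q g q') (Ad g⁻¹ ξ)⟩, ?_⟩
    rw [reducedMap_horizontal_add_vertical _ hh, adjointMk_R]

variable [FiniteDimensional ℝ E] [FiniteDimensional ℝ 𝔤]

/-- The reduced map in the coordinates of a local trivialization. -/
def reducedMapCoord (b r : ℕ) (𝔤 : Type*) [NormedAddCommGroup 𝔤] [NormedSpace ℝ 𝔤] :
    (EuclideanSpace ℝ (Fin b) × EuclideanSpace ℝ (Fin r)) × (EuclideanSpace ℝ (Fin b) × 𝔤) →L[ℝ]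
      (EuclideanSpace ℝ (Fin b) × EuclideanSpace ℝ (Fin b)) ×
        (EuclideanSpace ℝ (Fin b) × EuclideanSpace ℝ (Fin r)) × (EuclideanSpace ℝ (Fin b) × 𝔤) :=
  let A := EuclideanSpace ℝ (Fin b)
  let C := EuclideanSpace ℝ (Fin r)
  let p₁ := ContinuousLinearMap.fst ℝ (A × C) (A × 𝔤)
  let p₂ := ContinuousLinearMap.snd ℝ (A × C) (A × 𝔤)
  let u := (ContinuousLinearMap.fst ℝ A C).comp p₁
  (u.prod ((ContinuousLinearMap.fst ℝ A 𝔤).comp p₂)).prod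
    (p₁.prod (u.prod ((ContinuousLinearMap.snd ℝ A 𝔤).comp p₂)))

theorem reducedMapCoord_apply (b r : ℕ) (𝔤 : Type*) [NormedAddCommGroup 𝔤] [NormedSpace ℝ 𝔤]
    (z : (EuclideanSpace ℝ (Fin b) × EuclideanSpace ℝ (Fin r)) × (EuclideanSpace ℝ (Fin b) × 𝔤)) :
    reducedMapCoord b r 𝔤 z = ((z.1.1, z.2.1), z.1, (z.1.1, z.2.2)) := rfl

theorem reducedMapCoord_injective (b r : ℕ) (𝔤 : Type*) [NormedAddCommGroup 𝔤] [NormedSpace ℝ 𝔤] :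
    Function.Injective (reducedMapCoord b r 𝔤) := by
  rintro ⟨⟨u, k⟩, v, η⟩ ⟨⟨u', k'⟩, v', η'⟩ h
  simp only [reducedMapCoord_apply, Prod.mk.injEq] at h ⊢
  tauto

theorem hasLinearCharts_reducedMap [IsManifold (𝓡 b) ∞ (OrbitSpace Q G)]
    (hbase : ∀ x : OrbitSpace Q G, ∃ (T : LocalTriv E Q 𝔤 G b) (q : Q) (h : q ∈ T.dom),
      chartAt (EuclideanSpace ℝ (Fin b)) x = (T.baseSlice h).chart (isOpenQuotientMap_proj hact))
    (hcovK : ∀ g : G, ∃ κ : CosetSlice (𝔤 := 𝔤) K r, g ∈ κ.dom)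
    (hb : Q → b + Module.finrank ℝ 𝔤 = Module.finrank ℝ E)
    {Y A Z : Type*} [NormedAddCommGroup Y] [NormedSpace ℝ Y] [FiniteDimensional ℝ Y]
    [NormedAddCommGroup A] [NormedSpace ℝ A] [FiniteDimensional ℝ A]
    [NormedAddCommGroup Z] [NormedSpace ℝ Z] [FiniteDimensional ℝ Z]
    (lY : (EuclideanSpace ℝ (Fin b) × EuclideanSpace ℝ (Fin r)) ≃L[ℝ] Y)
    (lA : (EuclideanSpace ℝ (Fin b) × 𝔤) ≃L[ℝ] A)
    (lZ : ((EuclideanSpace ℝ (Fin b) × EuclideanSpace ℝ (Fin r)) ×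
      (EuclideanSpace ℝ (Fin b) × 𝔤)) ≃L[ℝ] Z)
    [ChartedSpace Y (SubOrbitSpace Q K)] [IsManifold 𝓘(ℝ, Y) ∞ (SubOrbitSpace Q K)]
    (hatY : atlas Y (SubOrbitSpace Q K) = range (SliceFunction.chart (I := 𝓘(ℝ, E)) (F := Y)
      (isOpenQuotientMap_subProj hact K)))
    [ChartedSpace A (AdjointBundle Q 𝔤 G)] [IsManifold 𝓘(ℝ, A) ∞ (AdjointBundle Q 𝔤 G)]
    (hatA : atlas A (AdjointBundle Q 𝔤 G) = range (SliceFunction.chart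
      (I := 𝓘(ℝ, E).prod 𝓘(ℝ, 𝔤)) (F := A) (isOpenQuotientMap_adjointMk hact)))
    [ChartedSpace Z (TangentQuotient hact K)] [IsManifold 𝓘(ℝ, Z) ∞ (TangentQuotient hact K)]
    (hatZ : atlas Z (TangentQuotient hact K) = range (SliceFunction.chart
      (I := 𝓘(ℝ, E).tangent) (F := Z) (isOpenQuotientMap_tangentProj hact K))) :
    HasLinearCharts (F := Z) ((𝓡 b).tangent.prod (𝓘(ℝ, Y).prod 𝓘(ℝ, A)))
      (reducedMap hact conn hπ K) := by
  intro x
  obtain ⟨⟨q₀, v₀⟩, rfl⟩ := (isOpenQuotientMap_tangentProj hact K).surjective x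
  -- The trivialization must be the one behind the preferred chart of `Q/G` at `π(q₀)`, since that
  -- chart induces the chart of `T(Q/G)`. It was chosen at another point of the orbit, but its
  -- domain is invariant.
  obtain ⟨T, q₁, h₁, hx⟩ := hbase (proj Q G q₀)
  have h₀ : q₀ ∈ T.dom := by
    have h := mem_chart_source (EuclideanSpace ℝ (Fin b)) (proj Q G q₀)
    rw [hx] at h
    obtain ⟨q, hq, hqq⟩ := h
    obtain ⟨g, rfl⟩ := proj_eq_iff.1 hqq
    exact T.R_mem q hq g
  obtain ⟨κ, hκ⟩ := hcovK (T.τ q₀)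
  let SZ := (T.tangentSlice hact conn (hb q₀) κ h₀ hκ).postcomp lZ
  let SY := (T.subSlice κ h₀ hκ).postcomp lY
  let SA := (T.adjointSlice h₀).postcomp lA
  let c₀ : TangentBundle (𝓡 b) (OrbitSpace Q G) := ⟨proj Q G q₀, 0⟩
  let e₀ := chartAt (ModelProd (EuclideanSpace ℝ (Fin b)) (EuclideanSpace ℝ (Fin b))) c₀
  let eY := SY.chart (isOpenQuotientMap_subProj hact K)
  let eA := SA.chart (isOpenQuotientMap_adjointMk hact)
  let eZ := SZ.chart (isOpenQuotientMap_tangentProj hact K)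
  let L := ((ContinuousLinearMap.id ℝ (EuclideanSpace ℝ (Fin b) × EuclideanSpace ℝ (Fin b))).prodMap
    ((lY : _ →L[ℝ] Y).prodMap (lA : _ →L[ℝ] A))).comp
      ((reducedMapCoord b r 𝔤).comp (lZ.symm : Z →L[ℝ] _))
  refine ⟨eZ, SliceFunction.chart_mem_maximalAtlas _ hatZ SZ, e₀.prod (eY.prod eA),
    IsManifold.mem_maximalAtlas_prod (IsManifold.chart_mem_maximalAtlas c₀)
      (IsManifold.mem_maximalAtlas_prod (SliceFunction.chart_mem_maximalAtlas _ hatY SY)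
        (SliceFunction.chart_mem_maximalAtlas _ hatA SA)), L, ?_, ?_, ?_, ?_⟩
  · have h : Function.Injective (Prod.map
        (id : EuclideanSpace ℝ (Fin b) × EuclideanSpace ℝ (Fin b) → _) (Prod.map lY lA) ∘ reducedMapCoord b r 𝔤 ∘ lZ.symm) :=
      (Function.injective_id.prodMap (lY.injective.prodMap lA.injective)).comp
        ((reducedMapCoord_injective b r 𝔤).comp lZ.symm.injective)
    exact h
  · exact ⟨⟨q₀, v₀⟩, ⟨h₀, hκ⟩, rfl⟩
  · apply Subset.antisymm
    -- The component in `Q/K` alone decides: a representative of `π_K(q)` in the domain is some `qg`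
    -- with `g ∈ K`, and the translated vector then lies in the domain of the slice on `TQ`.
    · intro y hy
      obtain ⟨⟨q, v⟩, rfl⟩ := (isOpenQuotientMap_tangentProj hact K).surjective y
      obtain ⟨q', hq', h⟩ : subProj Q K q ∈ subProj Q K '' (T.subSlice κ h₀ hκ).dom := hy.2.1
      obtain ⟨g, hg, rfl⟩ := subProj_eq_iff.1 h.symm
      exact ⟨tangentMap 𝓘(ℝ, E) 𝓘(ℝ, E) (R Q g) ⟨q, v⟩, hq',
        (tangentProj_eq_iff.2 ⟨g, hg, rfl⟩).symm⟩
    · rintro _ ⟨⟨q, v⟩, hq, rfl⟩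
      refine ⟨?_, ⟨q, hq, rfl⟩, ⟨(q, conn.formL q v), ⟨hq.1, trivial⟩, rfl⟩⟩
      refine (TangentBundle.mem_chart_source_iff _ c₀).2 ?_
      change proj Q G q ∈ (chartAt (EuclideanSpace ℝ (Fin b)) (proj Q G q₀)).source
      rw [hx]
      exact ⟨q, hq.1, rfl⟩
  · rintro _ ⟨⟨q, v⟩, hq, rfl⟩
    have hZ : eZ (tangentProj hact K ⟨q, v⟩) = lZ ((T.u q, κ.fn (T.τ q)), T.fibreCoord conn q v) :=
      SliceFunction.chart_apply _ SZ hq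
    have hY : eY (subProj Q K q) = lY (T.u q, κ.fn (T.τ q)) := SliceFunction.chart_apply _ SY hq
    have hA : eA (adjointMk Q 𝔤 G (q, conn.formL q v)) = lA (T.u q, Ad (T.τ q) (conn.formL q v)) :=
      SliceFunction.chart_apply _ SA (m := (q, conn.formL q v)) ⟨hq.1, trivial⟩
    have hmem : proj Q G q ∈ (chartAt (EuclideanSpace ℝ (Fin b)) (proj Q G q₀)).source := by
      rw [hx]
      exact ⟨q, hq.1, rfl⟩
    have h0 : (e₀ (⟨proj Q G q, mfderivProj E G b q v⟩ : TangentBundle (𝓡 b) (OrbitSpace Q G)) :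
        EuclideanSpace ℝ (Fin b) × EuclideanSpace ℝ (Fin b)) = (T.u q, T.du q v) := by
      have h := tangentMap_chart (I := 𝓡 b) (p := c₀)
        (q := (⟨proj Q G q, mfderivProj E G b q v⟩ : TangentBundle (𝓡 b) (OrbitSpace Q G))) hmem
      refine (congrArg (Bundle.TotalSpace.toProd _ _) h).symm.trans (Prod.ext ?_ ?_)
      · change chartAt (EuclideanSpace ℝ (Fin b)) (proj Q G q₀) (proj Q G q) = T.u q
        rw [hx]
        exact SliceFunction.chart_apply _ (T.baseSlice h₁) hq.1
      · exact mfderiv_chart_mfderivProj hact hπ hx hq.1 v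
    have hL : L (eZ (tangentProj hact K ⟨q, v⟩)) = ((T.u q, T.du q v), lY (T.u q, κ.fn (T.τ q)),
        lA (T.u q, Ad (T.τ q) (conn.formL q v))) := by
      rw [hZ]
      change Prod.map id (Prod.map lY lA) (reducedMapCoord b r 𝔤 (lZ.symm (lZ _))) = _
      rw [lZ.symm_apply_apply]
      rfl
    rw [hL]
    exact Prod.ext h0 (Prod.ext hY hA)

end

end RouthReduction

end

/-! ### The main theorem -/

theorem mainTheorem12
    {E : Type*} [NormedAddCommGroup E] [NormedSpace ℝ E] [FiniteDimensional ℝ E]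
    {Q : Type*} [TopologicalSpace Q] [ChartedSpace E Q] [IsManifold 𝓘(ℝ, E) ∞ Q]
    [T2Space Q] [SecondCountableTopology Q]
    {𝔤 : Type*} [NormedAddCommGroup 𝔤] [NormedSpace ℝ 𝔤] [FiniteDimensional ℝ 𝔤]
    {G : Type*} [TopologicalSpace G] [ChartedSpace 𝔤 G] [Group G] [LieGroup 𝓘(ℝ, 𝔤) ∞ G]
    [T2Space G] [SecondCountableTopology G]
    [MulAction Gᵐᵒᵖ Q] [ProperSMul Gᵐᵒᵖ Q]
    (hact : IsSmoothRightAction E Q 𝔤 G)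
    (hfree : ∀ (q : Q) (g : G), R Q g q = q → g = 1)
    (μ : 𝔤 →L[ℝ] ℝ)
    (conn : PrincipalConnection E Q 𝔤 G) :
    -- the quotient manifolds `Q/G`, `Q/G_μ`, `(Q × 𝔤)/G` and `TQ/G_μ`
    ∃ (b y a t p : ℕ)
      (_ : ChartedSpace (EuclideanSpace ℝ (Fin b)) (OrbitSpace Q G))
      (_ : IsManifold (𝓡 b) ∞ (OrbitSpace Q G))
      (_ : ChartedSpace (EuclideanSpace ℝ (Fin y)) (SubOrbitSpace Q (isotropy G μ)))
      (_ : ChartedSpace (EuclideanSpace ℝ (Fin a)) (AdjointBundle Q 𝔤 G))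
      (_ : ChartedSpace (EuclideanSpace ℝ (Fin t)) (TangentQuotient hact (isotropy G μ)))
      -- the fibred product as an embedded submanifold of the product
      (_ : ChartedSpace (EuclideanSpace ℝ (Fin p))
        (fibredProduct (EuclideanSpace ℝ (Fin b)) Q 𝔤 (isotropy G μ))),
      IsQuotientManifold 𝓘(ℝ, E) (𝓡 b) (proj Q G) ∧
      IsQuotientManifold 𝓘(ℝ, E) (𝓡 y) (subProj Q (isotropy G μ)) ∧
      IsQuotientManifold (𝓘(ℝ, E).prod 𝓘(ℝ, 𝔤)) (𝓡 a) (adjointMk Q 𝔤 G) ∧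
      IsQuotientManifold 𝓘(ℝ, E).tangent (𝓡 t) (tangentProj hact (isotropy G μ)) ∧
      IsManifold (𝓡 p) ∞
        (fibredProduct (EuclideanSpace ℝ (Fin b)) Q 𝔤 (isotropy G μ)) ∧
      Manifold.IsSmoothEmbedding (𝓡 p)
        ((𝓡 b).tangent.prod ((𝓡 y).prod (𝓡 a))) ∞
        (Subtype.val : fibredProduct (EuclideanSpace ℝ (Fin b)) Q 𝔤 (isotropy G μ) → _) ∧
      -- every tangent vector of `Q/G` at `π(q)` has a unique horizontal lift to `q`
      (∀ (q : Q) (v : TangentSpace (𝓡 b) (proj Q G q)),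
        ∃! h : TangentSpace 𝓘(ℝ, E) q, conn.form q h = 0 ∧
          mfderiv 𝓘(ℝ, E) (𝓡 b) (proj Q G) q h = v) ∧
      ∃ Φ : TangentQuotient hact (isotropy G μ) ≃ₘ^∞⟮𝓡 t, 𝓡 p⟯
          fibredProduct (EuclideanSpace ℝ (Fin b)) Q 𝔤 (isotropy G μ),
        -- `[v_q] ↦ (Tπ(v_q), π_μ(q), [q, ω(v_q)]_G)`
        (∀ v : TangentBundle 𝓘(ℝ, E) Q,
          (Φ (tangentProj hact (isotropy G μ) v)).1 =
            (tangentMap 𝓘(ℝ, E) (𝓡 b) (proj Q G) v,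
              subProj Q (isotropy G μ) v.proj,
              adjointMk Q 𝔤 G (v.proj, conn.form v.proj v.snd))) ∧
        -- the inverse: `(v_x, [q], [q, ξ]_G) ↦ [h + σ_q(ξ)]`, `h` the horizontal lift of `v_x` to `q`
        (∀ (z : fibredProduct (EuclideanSpace ℝ (Fin b)) Q 𝔤 (isotropy G μ))
            (q : Q) (ξ : 𝔤) (h : TangentSpace 𝓘(ℝ, E) q),
          z.1.2.1 = subProj Q (isotropy G μ) q →
          z.1.2.2 = adjointMk Q 𝔤 G (q, ξ) →
          conn.form q h = 0 →
          tangentMap 𝓘(ℝ, E) (𝓡 b) (proj Q G) ⟨q, h⟩ = z.1.1 →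
          Φ.symm z = tangentProj hact (isotropy G μ)
            ⟨q, h + infinitesimalAction E G q ξ⟩) := by
  let b := Module.finrank ℝ E - Module.finrank ℝ 𝔤
  let r := orbitDim G μ
  let K := isotropy G μ
  -- The subtraction in `b` is truncated. It is exact because `σ_q` is injective, with left inverse
  -- `ω_q`, which needs a point of `Q`; the identity may fail when `Q` is empty.
  have hb : Q → b + Module.finrank ℝ 𝔤 = Module.finrank ℝ E := fun q =>
    Nat.sub_add_cancel (LinearMap.finrank_le_finrank_of_injective
      (f := (infinitesimalActionL E G q : 𝔤 →L[ℝ] E).toLinearMap)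
      (conn.infinitesimalActionL_injective q))
  have hcov : ∀ q : Q, ∃ T : LocalTriv E Q 𝔤 G b, q ∈ T.dom := fun q =>
    conn.exists_localTriv hact hfree (hb q) q
  have hcovK : ∀ g : G, ∃ κ : CosetSlice (𝔤 := 𝔤) K r, g ∈ κ.dom := exists_cosetSlice μ
  choose T hT using hcov
  choose κ hκ using hcovK
  have hpB := isOpenQuotientMap_proj hact
  have hpY := isOpenQuotientMap_subProj hact K
  have hpA := isOpenQuotientMap_adjointMk hact
  have hpZ := isOpenQuotientMap_tangentProj hact K
  let VY := EuclideanSpace ℝ (Fin b) × EuclideanSpace ℝ (Fin r)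
  let VA := EuclideanSpace ℝ (Fin b) × 𝔤
  have lY : VY ≃L[ℝ] EuclideanSpace ℝ (Fin (Module.finrank ℝ VY)) :=
    ContinuousLinearEquiv.ofFinrankEq (by simp)
  have lA : VA ≃L[ℝ] EuclideanSpace ℝ (Fin (Module.finrank ℝ VA)) :=
    ContinuousLinearEquiv.ofFinrankEq (by simp)
  have lZ : (VY × VA) ≃L[ℝ] EuclideanSpace ℝ (Fin (Module.finrank ℝ (VY × VA))) :=
    ContinuousLinearEquiv.ofFinrankEq (by simp)
  let SY : Q → SliceFunction 𝓘(ℝ, E) (subProj Q K) _ := fun q =>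
    ((T q).subSlice (κ ((T q).τ q)) (hT q) (hκ _)).postcomp lY
  let SA : Q × 𝔤 → SliceFunction (𝓘(ℝ, E).prod 𝓘(ℝ, 𝔤)) (adjointMk Q 𝔤 G) _ := fun a =>
    ((T a.1).adjointSlice (hT a.1)).postcomp lA
  let SZ : TangentBundle 𝓘(ℝ, E) Q → SliceFunction 𝓘(ℝ, E).tangent (tangentProj hact K) _ :=
    fun v => ((T v.proj).tangentSlice hact conn (hb v.proj) (κ ((T v.proj).τ v.proj))
      (hT v.proj) (hκ _)).postcomp lZ
  let sB := Function.surjInv hpB.surjective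
  let sY := Function.surjInv hpY.surjective
  let sA := Function.surjInv hpA.surjective
  let sZ := Function.surjInv hpZ.surjective
  let cB : ChartedSpace (EuclideanSpace ℝ (Fin b)) (OrbitSpace Q G) :=
    SliceFunction.chartedSpace hpB (fun x => (T (sB x)).baseSlice (hT (sB x)))
      fun x => ⟨sB x, hT _, Function.surjInv_eq hpB.surjective x⟩
  let cY : ChartedSpace (EuclideanSpace ℝ (Fin (Module.finrank ℝ VY))) (SubOrbitSpace Q K) :=
    SliceFunction.chartedSpace hpY (fun x => SY (sY x))
      fun x => ⟨sY x, ⟨hT _, hκ _⟩, Function.surjInv_eq hpY.surjective x⟩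
  let cA : ChartedSpace (EuclideanSpace ℝ (Fin (Module.finrank ℝ VA))) (AdjointBundle Q 𝔤 G) :=
    SliceFunction.chartedSpace hpA (fun x => SA (sA x))
      fun x => ⟨sA x, ⟨hT _, trivial⟩, Function.surjInv_eq hpA.surjective x⟩
  let cZ : ChartedSpace (EuclideanSpace ℝ (Fin (Module.finrank ℝ (VY × VA))))
      (TangentQuotient hact K) :=
    SliceFunction.chartedSpace hpZ (fun x => SZ (sZ x))
      fun x => ⟨sZ x, ⟨hT _, hκ _⟩, Function.surjInv_eq hpZ.surjective x⟩
  have t2B : T2Space (OrbitSpace Q G) := t2Space_orbitSpace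
  have t2Y : T2Space (SubOrbitSpace Q K) := t2Space_subOrbitSpace (isClosed_isotropy μ)
  have t2A : T2Space (AdjointBundle Q 𝔤 G) := t2Space_adjointBundle hact fun q => ⟨T q, hT q⟩
  have t2Z : T2Space (TangentQuotient hact K) := by
    rcases isEmpty_or_nonempty Q with hQ | ⟨⟨q⟩⟩
    · have : IsEmpty (TangentQuotient hact K) := ⟨fun x => hQ.elim (sZ x).proj⟩
      infer_instance
    · exact t2Space_tangentQuotient hact conn (hb q) (fun q => ⟨T q, hT q⟩) fun g => ⟨κ g, hκ g⟩
  have : ProperSpace 𝔤 := FiniteDimensional.proper_real 𝔤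
  have := secondCountableTopology_tangentBundle (E := E) (Q := Q)
  have qB : IsQuotientManifold 𝓘(ℝ, E) (𝓡 b) (proj Q G) :=
    SliceFunction.isQuotientManifold hpB (exists_smooth_of_proj_eq hact) rfl
      (fun q => ⟨(T q).baseSlice (hT q), hT q⟩) t2B
  have qY : IsQuotientManifold 𝓘(ℝ, E) (𝓡 (Module.finrank ℝ VY)) (subProj Q K) :=
    SliceFunction.isQuotientManifold hpY (exists_smooth_of_subProj_eq hact K) rfl
      (fun q => ⟨SY q, hT q, hκ _⟩) t2Y
  have qA : IsQuotientManifold (𝓘(ℝ, E).prod 𝓘(ℝ, 𝔤)) (𝓡 (Module.finrank ℝ VA))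
      (adjointMk Q 𝔤 G) :=
    SliceFunction.isQuotientManifold hpA (exists_smooth_of_adjointMk_eq hact) rfl
      (fun a => ⟨SA a, hT a.1, trivial⟩) t2A
  have qZ : IsQuotientManifold 𝓘(ℝ, E).tangent (𝓡 (Module.finrank ℝ (VY × VA)))
      (tangentProj hact K) :=
    SliceFunction.isQuotientManifold hpZ (exists_smooth_of_tangentProj_eq hact K) rfl
      (fun v => ⟨SZ v, hT v.proj, hκ _⟩) t2Z
  have mB := qB.isManifold
  have mY := qY.isManifold
  have mA := qA.isManifold
  have mZ := qZ.isManifold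
  have hπ : MDifferentiable 𝓘(ℝ, E) (𝓡 b) (proj Q G) :=
    qB.isSubmersion.contMDiff.mdifferentiable (by simp)
  have mB1 : IsManifold (𝓡 b) 1 (OrbitSpace Q G) := IsManifold.of_le (n := ∞) (by simp)
  have hlift : ∀ (q : Q) (w : EuclideanSpace ℝ (Fin b)),
      ∃! h : E, conn.formL q h = 0 ∧ mfderivProj E G b q h = w := by
    intro q w
    -- The preferred chart at `π(q)` comes from a trivialization at the chosen representative of the
    -- orbit; its invariant domain also contains `q`.
    obtain ⟨g, hg⟩ := proj_eq_iff.1 (Function.surjInv_eq hpB.surjective (proj Q G q))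
    have hq := (T (sB (proj Q G q))).R_mem _ (hT _) g
    rw [show R Q g (sB (proj Q G q)) = q from hg] at hq
    exact existsUnique_horizontal_lift hact hπ (x := proj Q G q) rfl conn (hb q) hq w
  have hlin : HasLinearCharts (F := EuclideanSpace ℝ (Fin (Module.finrank ℝ (VY × VA))))
      ((𝓡 b).tangent.prod ((𝓡 (Module.finrank ℝ VY)).prod (𝓡 (Module.finrank ℝ VA))))
      (reducedMap hact conn hπ K) :=
    hasLinearCharts_reducedMap (fun x => ⟨T (sB x), sB x, hT _, rfl⟩) (fun g => ⟨κ g, hκ g⟩) hb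
      lY lA lZ rfl rfl rfl
  obtain ⟨cP, mP, hP, Φ, hΦ⟩ := hlin.exists_smoothEmbedding
    (range_reducedMap (K := K) (hπ := hπ) fun q w => (hlift q w).exists)
  refine ⟨b, Module.finrank ℝ VY, Module.finrank ℝ VA, Module.finrank ℝ (VY × VA),
    Module.finrank ℝ (VY × VA), cB, mB, cY, cA, cZ, cP, qB, qY, qA, qZ, mP, hP,
    fun q v => hlift q v, Φ, fun v => hΦ _, ?_⟩
  intro z q ξ h h1 h2 h3 h4
  let w : E := h
  have h3' : conn.formL q w = 0 := h3
  -- It suffices to apply `Φ` to the proposed preimage, since `Φ` is invertible.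
  have key : Φ (tangentProj hact K ⟨q, w + infinitesimalActionL E G q ξ⟩) = z := by
    refine Subtype.ext ((hΦ _).trans ?_)
    refine (reducedMap_horizontal_add_vertical q h3' ξ).trans ?_
    exact Prod.ext h4 (Prod.ext h1.symm h2.symm)
  exact (congrArg Φ.symm key).symm.trans (Φ.symm_apply_apply _)
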